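/- Let $\mathbb R^{n+2}_1$ be Minkowski space with inner product $\langle\!\langle\cdot,\cdot\rangle\!\rangle$, $\mathcal L$ its light cone (nonzero null vectors), and $S^n=\mathbb P(\mathcal L)$ the conformal $n$-sphere; write $\langle x\rangle$ for the point spanned by $x\in\mathcal L$, and $(v\wedge w)(x)=\langle\!\langle v,x\rangle\!\rangle w-\langle\!\langle w,x\rangle\!\rangle v$. Let $b,\varepsilon>0$, let $c:(-\varepsilon,b)\to\mathcal L$ be a smooth light cone lift of a regular (immersed) curve $\langle c\rangle$ in $S^n$, and let $Q(t)\,dt^2$ be a nowhere vanishing quadratic differential on $(0,b)$ with a pole of second order at $0$, i.e. $t^2Q(t)$ extends smoothly to some $(-\tilde\varepsilon,b)$, $\tilde\varepsilon>0$, with nonzero value $q_0$ at $0$. Put $\Omega(t)=\dfrac{Q(t)}{\|c'(t)\|^2}\,c(t)\wedge c'(t)$, and for $\lambda\in\mathbb R$, $p\in(0,b)$ let $t\mapsto\Gamma_p^t$ be the map from $(0,b)$ to the Lorentz group with $\frac{d}{dt}\Gamma_p^t=\Gamma_p^t\,\lambda\Omega(t)$, $\Gamma_p^p=\mathrm{id}$.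 The $\lambda$-Calapso transform normalized at $p$ is $\langle c_{\lambda,p}(t)\rangle=\Gamma_p^t\langle c(t)\rangle$, and the $\lambda$-Darboux transform with initial point $x\in S^n$ at $p$ is $\langle\hat c(t)\rangle=(\Gamma_p^t)^{-1}x$, $t\in(0,b)$. Suppose $1-2\lambda q_0<0$ (that is, $1-2\lambda<0$ if $Q$ is normalized so that $q_0=1$, e.g. $Q=dt^2/t^2$). Then the set $\mathcal C$ of all limit points of $\langle c_{\lambda,p}(t)\rangle$ as $t\downarrow0$ is a circle (the limit circle of the Calapso transform), and for every $x\in S^n$ the $\lambda$-Darboux transform $\langle\hat c\rangle$ with initial point $x$ at $p$ satisfies: 1. if $x\notin\mathcal C$, then $\lim_{t\downarrow0}\langle\hat c(t)\rangle=\langle c(0)\rangle$; 2. if $x\in\mathcal C$, then as $t\downarrow0$ the curve $\langle\hat c\rangle$ approaches the curvature circle of $\langle c\rangle$ at $0$, i.e. the circle of points of $W=\mathrm{span}(c(0),c'(0),c''(0))$ (every neighbourhood of this circle contains $\langle\hat c(t)\rangle$ for all small $t>0$), and it rotates on it with frequency tending to infinity. Precisely: for every pseudo-orthonormal basis $(\tau,e_1,e_2)$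 of $W$ with $\tau$ timelike there are $\delta>0$, a differentiable $\varphi:(0,\delta)\to\mathbb R$ and $\sigma\in\{1,-1\}$ such that for $t\in(0,\delta)$ the representative of $\langle\hat c(t)\rangle$ with $\tau$-component $1$ is $\tau+\rho(t)(\cos\varphi(t)\,e_1+\sin\varphi(t)\,e_2)+Z(t)$ with $\rho(t)>0$, $Z(t)\perp W$; $\sigma\varphi(t)\to+\infty$ as $t\downarrow0$; for every $N$ and all small $t>0$ a full turn, $\varphi(s)=\varphi(t)+2\pi\sigma$, is made between $t$ and some $s\in(0,t)$ with $1/(t-s)>N$; and for every neighbourhood $U$ of $\langle c(0)\rangle$, $-\sigma\varphi'(t)\to+\infty$ as $t\downarrow0$ with $\langle\hat c(t)\rangle\notin U$. -/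

import Mathlib

open Set Filter Topology
open scoped ContDiff

noncomputable section

/-- The underlying vector space of `(n+2)`-dimensional Minkowski space. -/
abbrev Mink (n : ℕ) : Type := EuclideanSpace ℝ (Fin (n + 2))

namespace Mink

variable {n : ℕ}

/-- The Minkowski inner product `-x₀ y₀ + x₁ y₁ + ⋯ + xₙ₊₁ yₙ₊₁`. -/
def form (n : ℕ) : Mink n →ₗ[ℝ] Mink n →ₗ[ℝ] ℝ :=
  LinearMap.mk₂ ℝ (fun x y => -(x 0 * y 0) + ∑ i : Fin (n + 1), x i.succ * y i.succ)
    (fun x x' y => by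
      simp only [PiLp.add_apply, add_mul, Finset.sum_add_distrib]; ring)
    (fun a x y => by
      simp only [PiLp.smul_apply, smul_eq_mul, mul_add, Finset.mul_sum, mul_assoc, mul_neg])
    (fun x y y' => by
      simp only [PiLp.add_apply, mul_add, Finset.sum_add_distrib]; ring)
    (fun a x y => by
      simp only [PiLp.smul_apply, smul_eq_mul, mul_add, Finset.mul_sum, mul_left_comm, mul_neg])

/-- `(v ∧ w)(x) = ⟪v, x⟫ w - ⟪w, x⟫ v`, an element of the Lie algebra of the Lorentz group. -/
def wedge (v w : Mink n) : Mink n →L[ℝ] Mink n :=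
  LinearMap.toContinuousLinearMap ((form n v).smulRight w - (form n w).smulRight v)

/-- The Lorentz group of Minkowski space. -/
def lorentz (n : ℕ) : Subgroup (Mink n ≃L[ℝ] Mink n) where
  carrier := {A | ∀ x y, form n (A x) (A y) = form n x y}
  one_mem' := fun _ _ => rfl
  mul_mem' := fun {A B} hA hB x y => (hA (B x) (B y)).trans (hB x y)
  inv_mem' := fun {A} hA x y => by
    have h := hA (A⁻¹ x) (A⁻¹ y)
    have e : ∀ z, A (A⁻¹ z) = z := fun z => A.apply_symm_apply z
    rw [e, e] at h
    exact h.symm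

/-- The light cone: nonzero null vectors. -/
def LightCone (n : ℕ) : Type := {x : Mink n // x ≠ 0 ∧ form n x x = 0}

/-- Two light-like vectors are identified if they span the same line. -/
instance lineSetoid (n : ℕ) : Setoid (LightCone n) where
  r x y := ∃ a : ℝ, a ≠ 0 ∧ y.1 = a • x.1
  iseqv :=
    { refl := fun x => ⟨1, one_ne_zero, (one_smul ℝ x.1).symm⟩
      symm := fun {x y} ⟨a, ha, h⟩ => ⟨a⁻¹, inv_ne_zero ha, by rw [h, smul_smul, inv_mul_cancel₀ ha, one_smul]⟩
      trans := fun {x y z} ⟨a, ha, h⟩ ⟨a', ha', h'⟩ => ⟨a' * a, mul_ne_zero ha' ha, by rw [h', h, smul_smul]⟩ }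

instance (n : ℕ) : TopologicalSpace (LightCone n) := instTopologicalSpaceSubtype

/-- The conformal `n`-sphere: the projectivized light cone, with the quotient topology. -/
def Sphere (n : ℕ) : Type := Quotient (lineSetoid n)

instance (n : ℕ) : TopologicalSpace (Sphere n) :=
  inferInstanceAs (TopologicalSpace (Quotient (lineSetoid n)))

/-- The point `⟨x⟩` of the conformal sphere spanned by a light-like vector `x`. -/
def span (x : LightCone n) : Sphere n := Quotient.mk (lineSetoid n) x

/-- The action of a Lorentz transformation on the light cone. -/
def coneMap (A : lorentz n) (x : LightCone n) : LightCone n :=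
  ⟨A.1 x.1, fun h => x.2.1 (A.1.map_eq_zero_iff.1 h), (A.2 x.1 x.1).trans x.2.2⟩

/-- The action of a Lorentz transformation on the conformal sphere. -/
def act (A : lorentz n) : Sphere n → Sphere n :=
  Quotient.map (coneMap A) (fun x y ⟨a, ha, h⟩ => ⟨a, ha, by
    change A.1 y.1 = a • A.1 x.1
    rw [h, map_smul]⟩)

/-- `Γ` is a primitive on the open set `s` of the Lie algebra valued 1-form `Ψ(t) dt`, normalized
at `p`: `dΓ = Γ Ψ` and `Γ(p) = id`. -/
def IsPrimitive (Ψ : ℝ → Mink n →L[ℝ] Mink n) (s : Set ℝ) (p : ℝ) (Γ : ℝ → lorentz n) : Prop :=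
  Γ p = 1 ∧ ∀ t ∈ s, HasDerivAt (fun τ => ((Γ τ).1 : Mink n →L[ℝ] Mink n))
    (((Γ t).1 : Mink n →L[ℝ] Mink n).comp (Ψ t)) t

open Classical in
/-- The primitive `t ↦ Γ_p^t(Ψ)`. For an interval `s` containing `p` and a continuous Lie algebra
valued `Ψ` it exists and is unique on `s`. -/
def primitive (Ψ : ℝ → Mink n →L[ℝ] Mink n) (s : Set ℝ) (p : ℝ) : ℝ → lorentz n :=
  if h : ∃ Γ, IsPrimitive Ψ s p Γ then Classical.choose h else fun _ => 1

/-- `c`, restricted to the open set `s`, is a smooth light cone lift of a regular curve `⟨c⟩`,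
i.e. of an immersion into the conformal sphere. -/
def IsRegularLift (c : ℝ → LightCone n) (s : Set ℝ) : Prop :=
  ContDiffOn ℝ ∞ (fun t => (c t).1) s ∧
    ∀ t ∈ s, LinearIndependent ℝ ![(c t).1, deriv (fun τ => (c τ).1) t]

/-- The quadratic differential `Q(t) dt²` on `(a, b)` has a pole of order `k` at `a`. -/
def HasPole (Q : ℝ → ℝ) (a b : ℝ) (k : ℕ) : Prop :=
  ∃ ε > 0, ∃ h : ℝ → ℝ, ContDiffOn ℝ ∞ h (Ioo (a - ε) b) ∧ h a ≠ 0 ∧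
    ∀ t ∈ Ioo a b, h t = Q t * (a - t) ^ k

/-- The orthogonal lift of the 1-form `ω = 𝔔 c ∧ dc`, where `Q = 𝔔 ‖dc‖²`, associated to the
polarized curve `(⟨c⟩, Q)`. -/
def assocForm (c : ℝ → LightCone n) (Q : ℝ → ℝ) (t : ℝ) : Mink n →L[ℝ] Mink n :=
  (Q t / form n (deriv (fun τ => (c τ).1) t) (deriv (fun τ => (c τ).1) t)) •
    wedge (c t).1 (deriv (fun τ => (c τ).1) t)

/-- The `lam`-Darboux transform `t ↦ Γ_t^p(lam ω) x` of the polarized curve `(⟨c⟩, Q)` on `s` with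
initial point `x` at `p`; here `Γ_t^p` is the inverse of `Γ_p^t`. -/
def darboux (c : ℝ → LightCone n) (Q : ℝ → ℝ) (s : Set ℝ) (lam p : ℝ) (x : Sphere n) (t : ℝ) :
    Sphere n :=
  act (primitive (fun τ => lam • assocForm c Q τ) s p t)⁻¹ x

/-- The `lam`-Calapso transform `t ↦ Γ_p^t(lam ω) ⟨c(t)⟩` of the polarized curve `(⟨c⟩, Q)` on `s`
normalized at `p`. -/
def calapso (c : ℝ → LightCone n) (Q : ℝ → ℝ) (s : Set ℝ) (lam p : ℝ) (t : ℝ) : Sphere n :=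
  act (primitive (fun τ => lam • assocForm c Q τ) s p t) (span (c t))

/-- The set of limit points of a curve in the conformal sphere as `t ↓ 0`. -/
def limitSet (f : ℝ → Sphere n) : Set (Sphere n) := {P | MapClusterPt P (𝓝[>] (0 : ℝ)) f}

/-- The points of the conformal sphere that lie in the linear subspace `W`. -/
def pointsOf (W : Submodule ℝ (Mink n)) : Set (Sphere n) := {P | ∃ x : LightCone n, span x = P ∧ x.1 ∈ W}

/-- A circle in the conformal sphere: the points in a 3-dimensional Minkowski subspace. -/
def IsCircle (S : Set (Sphere n)) : Prop :=
  ∃ W : Submodule ℝ (Mink n), Module.finrank ℝ W = 3 ∧ (∃ τ ∈ W, form n τ τ < 0) ∧ S = pointsOf W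

/-- The 3-dimensional subspace `⟨c(t), c'(t), c''(t)⟩`, whose points form the curvature
(osculating) circle of `⟨c⟩` at `t`. -/
def osculatingSpace (c : ℝ → LightCone n) (t : ℝ) : Submodule ℝ (Mink n) :=
  Submodule.span ℝ {(c t).1, deriv (fun τ => (c τ).1) t, deriv (deriv (fun τ => (c τ).1)) t}

/-- The curvature circle of `⟨c⟩` at `t`. -/
def curvatureCircle (c : ℝ → LightCone n) (t : ℝ) : Set (Sphere n) := pointsOf (osculatingSpace c t)

/-- A pseudo-orthonormal basis `(τ, e₁, e₂)` of a 3-dimensional Minkowski subspace `W`. The points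
of `W` are then exactly the `⟨τ + cos θ e₁ + sin θ e₂⟩`. -/
structure IsFrame (W : Submodule ℝ (Mink n)) (τ e₁ e₂ : Mink n) : Prop where
  mem_τ : τ ∈ W
  mem_e₁ : e₁ ∈ W
  mem_e₂ : e₂ ∈ W
  form_τ : form n τ τ = -1
  form_e₁ : form n e₁ e₁ = 1
  form_e₂ : form n e₂ e₂ = 1
  form_τ_e₁ : form n τ e₁ = 0
  form_τ_e₂ : form n τ e₂ = 0
  form_e₁_e₂ : form n e₁ e₂ = 0

/-- `θ` is an angle of the point `P` around the circle with frame `(τ, e₁, e₂)`: the light-like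
vector `x` over `P` with `⟪x, τ⟫ = -1` is `τ + ρ (cos θ e₁ + sin θ e₂) + Z` with `ρ > 0` and `Z`
orthogonal to the circle's subspace. -/
def HasAngle (τ e₁ e₂ : Mink n) (P : Sphere n) (θ : ℝ) : Prop :=
  ∃ x : LightCone n, span x = P ∧ form n x.1 τ = -1 ∧
    ∃ ρ > 0, form n x.1 e₁ = ρ * Real.cos θ ∧ form n x.1 e₂ = ρ * Real.sin θ

/-- The curve `f` rotates around the circle `pointsOf W` with frequency tending to infinity as
`t ↓ 0`. In every frame of the circle, for small `t > 0` the curve has a differentiable angle `φ`,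
and for a sense of rotation `σ = ±1`:
* as `t ↓ 0`, the angle tends to `σ ∞`, i.e. the curve makes infinitely many turns;
* the frequency `1 / (t - s)` of a full turn made between `t` and some `s < t` tends to infinity;
* away from every neighbourhood of the point `P₀`, the angular velocity in the sense `σ` (as `t`
  decreases) also tends to infinity. -/
def RotatesFast (f : ℝ → Sphere n) (W : Submodule ℝ (Mink n)) (P₀ : Sphere n) : Prop :=
  ∀ τ e₁ e₂ : Mink n, IsFrame W τ e₁ e₂ →
    ∃ δ > 0, ∃ φ : ℝ → ℝ, DifferentiableOn ℝ φ (Ioo 0 δ) ∧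
      (∀ t ∈ Ioo 0 δ, HasAngle τ e₁ e₂ (f t) (φ t)) ∧
      ∃ σ : ℝ, (σ = 1 ∨ σ = -1) ∧
        Tendsto (fun t => σ * φ t) (𝓝[>] 0) atTop ∧
        (∀ N : ℝ, ∀ᶠ t in 𝓝[>] (0 : ℝ),
          ∃ s ∈ Ioo 0 t, φ s = φ t + σ * (2 * Real.pi) ∧ N < 1 / (t - s)) ∧
        ∀ U ∈ 𝓝 P₀, Tendsto (fun t => -(σ * deriv φ t)) (𝓝[{t | 0 < t ∧ f t ∉ U}] 0) atTop

end Mink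

end

open Set Filter Topology
open scoped ContDiff

noncomputable section

namespace Mink

variable {n : ℕ}

/-! ### The Minkowski form -/

/-! Rescaled to unit speed, the lift of the curve becomes a null curve C with a moving frame (C, T,
N) of its osculating spaces: C' = T, T' = N - qC, N' = K - qT, with K normal to the frame. The form
λΩ becomes (μ/t²) C ∧ T, where μ = λt²Q is smooth up to 0 and μ₀ = μ(0) = λq₀ > 1/2. The Darboux
transform with initial point x is represented by y = Γ⁻¹x, a solution of y' = -(μ/t²)(C ∧ T)y
(`exists_curveFrame_of_hasPole`).

In the variables ⟨C,y⟩/t, ⟨T,y⟩, t⟨N,y⟩ and the time log t, this equation has, up to errors of order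
t, a constant matrix with eigenvalues 0 and ±iω, ω² = 2μ₀ - 1. The hypothesis on λq₀ says exactly
that ω is real and positive. Undoing the rotation leaves slow variables: one axial component, two
components in the rotating plane, and the part ν of y normal to the frame. Their velocity is bounded
by a multiple of their size, so they converge at a linear rate (`IsSol.exists_slow_limit`). The
limit depends linearly on x, and the Minkowski form of x is a fixed expression in it
(`form_limit_eq`).

Pairing Γ C/t with x gives ⟨C,y⟩/t. Hence Γ C/t is asymptotic to X₀ + cos(ω log t) X₁ + sin(ω log t)
X₂, the Xᵢ representing the limit functionals. These vectors are null, which forces ωX₀, ωX₁, ωX₂ to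
be a pseudo-orthonormal basis of a Minkowski space W, equal to the kernel of the limit of ν
(`gram_of_form_eq`). The limit circle consists of the points of W (`exists_limitCircle`).

For null y, 2⟨C,y⟩⟨N,y⟩ = ⟨T,y⟩² + ⟨ν,ν⟩. If x is off the circle, ⟨ν,ν⟩ has a positive limit while
⟨C,y⟩ = O(t), so ⟨N,y⟩ is at least of order 1/t and dominates: the line of y tends to that of C(0)
(`HasLimit.tendsto_C_of_normal_pos`).

If x is on the circle, then ν = O(t²), whereas ‖y‖ is at least of order t; so the line of y
approaches the osculating space (`HasLimit.exists_tangential_bound`). The angular velocity in a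
frame of that space is, up to a bounded error, of one sign and at least a multiple of (⟨T,y⟩² +
⟨C,y⟩²)/(t²‖y‖²), because the governing quadratic form is definite (`IsFrame.discriminant`). This
tends to infinity away from C(0). The angle therefore either diverges or converges. It cannot
converge, since the line of y returns arbitrarily late to both C(0) and N(0)
(`HasLimit.not_tendsto_angle`). -/

lemma form_apply (x y : Mink n) :
    form n x y = -(x 0 * y 0) + ∑ i : Fin (n + 1), x i.succ * y i.succ := rfl

lemma form_comm (x y : Mink n) : form n x y = form n y x := by
  simp only [form_apply, mul_comm]

lemma form_eq_inner (x y : Mink n) : form n x y = inner ℝ x y - 2 * (x 0 * y 0) := by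
  simp only [form_apply, PiLp.inner_apply, Fin.sum_univ_succ (n := n + 1), RCLike.inner_apply,
    conj_trivial, mul_comm (y _) (x _)]
  ring

lemma abs_coord_le (x : Mink n) (i : Fin (n + 2)) : |x i| ≤ ‖x‖ := by
  simpa using PiLp.norm_apply_le x i

lemma abs_form_le (x y : Mink n) : |form n x y| ≤ 3 * ‖x‖ * ‖y‖ := by
  rw [form_eq_inner]
  have h1 := abs_real_inner_le_norm x y
  have h2 : |x 0 * y 0| ≤ ‖x‖ * ‖y‖ := by
    rw [abs_mul]
    exact mul_le_mul (abs_coord_le x 0) (abs_coord_le y 0) (abs_nonneg _) (norm_nonneg _)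
  rw [abs_le] at *
  constructor <;> linarith [h1.1, h1.2, h2.1, h2.2]

/-- The Minkowski form as a continuous bilinear map. -/
def formL (n : ℕ) : Mink n →L[ℝ] Mink n →L[ℝ] ℝ :=
  (form n).mkContinuous₂ 3 (fun x y => by simpa using abs_form_le x y)

lemma _root_.HasDerivAt.form {f g : ℝ → Mink n} {f' g' : Mink n} {t : ℝ}
    (hf : HasDerivAt f f' t) (hg : HasDerivAt g g' t) :
    HasDerivAt (fun s => Mink.form n (f s) (g s)) (Mink.form n f' (g t) + Mink.form n (f t) g') t :=
  ((formL n).hasFDerivAt.comp_hasDerivAt t hf).clm_apply hg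

lemma continuous_form : Continuous fun p : Mink n × Mink n => form n p.1 p.2 :=
  (formL n).continuous₂

lemma _root_.Filter.Tendsto.form {α : Type*} {l : Filter α} {f g : α → Mink n} {x y : Mink n}
    (hf : Tendsto f l (𝓝 x)) (hg : Tendsto g l (𝓝 y)) :
    Tendsto (fun a => Mink.form n (f a) (g a)) l (𝓝 (Mink.form n x y)) :=
  (continuous_form.tendsto (x, y)).comp (hf.prodMk_nhds hg)

lemma _root_.ContinuousOn.form {α : Type*} [TopologicalSpace α] {s : Set α} {f g : α → Mink n}
    (hf : ContinuousOn f s) (hg : ContinuousOn g s) :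
    ContinuousOn (fun a => Mink.form n (f a) (g a)) s :=
  continuous_form.comp_continuousOn (hf.prodMk hg)

/-- The reflection in the hyperplane of vectors without time component. -/
def reflect (x : Mink n) : Mink n := x - (2 * x 0) • EuclideanSpace.single 0 1

/-- Through this identity nondegeneracy, the Riesz representation and coordinates pass from the
Euclidean inner product to the indefinite form. -/
lemma form_reflect (x y : Mink n) : form n x (reflect y) = inner ℝ x y := by
  rw [form_eq_inner, reflect, inner_sub_right, inner_smul_right]
  simp [EuclideanSpace.inner_single_right]; ring

lemma eq_of_forall_form_eq {x y : Mink n} (h : ∀ z, form n x z = form n y z) : x = y :=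
  ext_inner_right ℝ fun z => by rw [← form_reflect, ← form_reflect, h]

/-- Every linear functional is represented by a vector. -/
lemma exists_form_eq (k : Mink n →ₗ[ℝ] ℝ) : ∃ X : Mink n, ∀ x, k x = form n X x := by
  refine ⟨reflect ((InnerProductSpace.toDual ℝ (Mink n)).symm (LinearMap.toContinuousLinearMap k)),
    fun x => ?_⟩
  rw [form_comm, form_reflect, real_inner_comm, InnerProductSpace.toDual_symm_apply]
  rfl

lemma coord_eq_form (x : Mink n) (i : Fin (n + 2)) :
    x i = form n x (reflect (EuclideanSpace.single i 1)) := by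
  rw [form_reflect]
  simp [EuclideanSpace.inner_single_right]

/-- Coordinates are pairings with fixed vectors, so weak convergence is convergence. Limits of Γ C
can thus be read off from pairings ⟨C, Γ⁻¹x⟩ with solutions of the Darboux equation. -/
lemma tendsto_of_forall_form {α : Type*} {l : Filter α} {f : α → Mink n} {x : Mink n}
    (h : ∀ z, Tendsto (fun a => form n (f a) z) l (𝓝 (form n x z))) : Tendsto f l (𝓝 x) := by
  have h2 : Tendsto (fun a => (WithLp.ofLp (f a) : Fin (n + 2) → ℝ)) l (𝓝 (WithLp.ofLp x)) := by
    rw [tendsto_pi_nhds]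
    intro i
    simpa only [← coord_eq_form] using h (reflect (EuclideanSpace.single i 1))
  exact ((PiLp.continuous_toLp 2 _).tendsto _).comp h2

lemma hasDerivAt_of_forall_form {f : ℝ → Mink n} {f' : Mink n} {t : ℝ}
    (h : ∀ z, HasDerivAt (fun s => form n (f s) z) (form n f' z) t) : HasDerivAt f f' t := by
  rw [hasDerivAt_iff_tendsto_slope]
  refine tendsto_of_forall_form fun z => ?_
  have := hasDerivAt_iff_tendsto_slope.1 (h z)
  refine this.congr fun s => ?_
  simp [slope, vsub_eq_sub]

/-- Cauchy–Schwarz for the spatial parts, with the spatial inner product written as form plus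
product of time coordinates. -/
lemma tail_cauchy_schwarz (x y : Mink n) :
    (form n x y + x 0 * y 0) ^ 2 ≤ (form n x x + x 0 ^ 2) * (form n y y + y 0 ^ 2) := by
  have h := Finset.sum_mul_sq_le_sq_mul_sq Finset.univ
    (fun i : Fin (n + 1) => x i.succ) (fun i => y i.succ)
  have e (u v : Mink n) : form n u v + u 0 * v 0 = ∑ i : Fin (n + 1), u i.succ * v i.succ := by
    rw [form_apply]; ring
  simp only [pow_two, e] at h ⊢
  exact h

lemma tail_nonneg (x : Mink n) : 0 ≤ form n x x + x 0 ^ 2 := by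
  rw [form_apply]
  have : 0 ≤ ∑ i : Fin (n + 1), x i.succ * x i.succ :=
    Finset.sum_nonneg fun i _ => mul_self_nonneg _
  nlinarith

lemma norm_sq_eq (x : Mink n) : ‖x‖ ^ 2 = form n x x + 2 * x 0 ^ 2 := by
  rw [form_eq_inner, real_inner_self_eq_norm_sq]; ring

lemma coord_ne_zero {x : Mink n} (hx : x ≠ 0) (h : form n x x = 0) : x 0 ≠ 0 := by
  intro h0
  have := norm_sq_eq x
  rw [h, h0] at this
  exact hx (norm_eq_zero.1 (by simpa using this))

/-- A timelike vector has a positive definite orthogonal complement. -/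
lemma form_self_of_orthogonal_timelike {τ z : Mink n} (hτ : form n τ τ < 0)
    (h : form n τ z = 0) : 0 ≤ form n z z ∧ (form n z z = 0 → z = 0) := by
  have h1 := tail_cauchy_schwarz τ z
  have h2 := tail_nonneg τ
  have h3 := tail_nonneg z
  rw [h, zero_add] at h1
  have h4 : 0 < τ 0 ^ 2 := by linarith
  have h5 : 0 ≤ form n z z := by
    have : (form n τ τ + τ 0 ^ 2) * (form n z z + z 0 ^ 2) ≤
        τ 0 ^ 2 * (form n z z + z 0 ^ 2) :=
      mul_le_mul_of_nonneg_right (by linarith) h3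
    have : 0 ≤ τ 0 ^ 2 * form n z z := by nlinarith
    exact nonneg_of_mul_nonneg_right this h4
  refine ⟨h5, fun h6 => ?_⟩
  rw [h6, zero_add] at h1
  have h7 : z 0 ^ 2 = 0 := by nlinarith [sq_nonneg (z 0)]
  have := norm_sq_eq z
  rw [h6, h7] at this
  exact norm_eq_zero.1 (by simpa using this)

/-- The orthogonal complement of a null line is positive semidefinite, with that line as kernel. -/
lemma form_self_of_orthogonal_null {x z : Mink n} (hx : x ≠ 0) (hx0 : form n x x = 0)
    (h : form n x z = 0) : 0 ≤ form n z z ∧ (form n z z = 0 → ∃ a : ℝ, z = a • x) := by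
  have hc := coord_ne_zero hx hx0
  -- Subtracting this multiple of x removes the time coordinate without changing ⟨z, z⟩, because x
  -- is null and orthogonal to z.
  set w := z - (z 0 / x 0) • x with hw
  have h0 : w 0 = 0 := by simp [hw, hc]
  have h1 : form n w w = form n z z := by
    simp [hw, hx0, h, form_comm z x]
  have h2 := tail_nonneg w
  rw [h0, h1] at h2
  refine ⟨by simpa using h2, fun h3 => ⟨z 0 / x 0, ?_⟩⟩
  have := norm_sq_eq w
  rw [h1, h3, h0] at this
  exact sub_eq_zero.1 (norm_eq_zero.1 (by simpa using this))

/-- A null vector is never close to the orthogonal complement of a timelike vector. -/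
lemma exists_le_abs_form {τ : Mink n} (hτ : form n τ τ < 0) :
    ∃ k > 0, ∀ y, form n y y = 0 → k * ‖y‖ ≤ |form n y τ| := by
  have h2 := tail_nonneg τ
  set B := √(form n τ τ + τ 0 ^ 2) with hB
  have hB2 : B ^ 2 = form n τ τ + τ 0 ^ 2 := Real.sq_sqrt h2
  have hB0 : 0 ≤ B := Real.sqrt_nonneg _
  have hlt : B < |τ 0| := by
    apply lt_of_pow_lt_pow_left₀ 2 (abs_nonneg _)
    rw [sq_abs, hB2]; linarith
  -- The spatial part of a null y has length |y₀|, so |⟨y,τ⟩| ≥ |y₀|(|τ₀| - B), with B the spatial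
  -- length of τ. The divisor 2 comes from ‖y‖ ≤ 2|y₀|.
  refine ⟨(|τ 0| - B) / 2, by linarith, fun y hy => ?_⟩
  have h1 := tail_cauchy_schwarz y τ
  rw [hy, zero_add, ← hB2] at h1
  have h3 : |form n y τ + y 0 * τ 0| ≤ |y 0| * B := by
    apply abs_le_of_sq_le_sq _ (by positivity)
    rw [mul_pow, sq_abs]; exact h1
  have h4 : |y 0| * |τ 0| ≤ |form n y τ| + |y 0| * B := by
    rw [← abs_mul]
    calc |y 0 * τ 0| = |(form n y τ + y 0 * τ 0) - form n y τ| := by ring_nf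
      _ ≤ |form n y τ + y 0 * τ 0| + |form n y τ| := abs_sub _ _
      _ ≤ _ := by linarith
  have h5 : ‖y‖ ≤ 2 * |y 0| := by
    apply le_of_sq_le_sq _ (by positivity)
    rw [norm_sq_eq, hy, mul_pow, sq_abs]; nlinarith [sq_nonneg (y 0)]
  nlinarith [abs_nonneg (y 0)]

end Mink

/-! ### Linear differential equations on an open interval -/

namespace LinearODE

variable {E : Type*} [NormedAddCommGroup E] [NormedSpace ℝ E]

/-- The terms of the Picard series of the initial value problem `dX/dt = A X`, `X(p) = x₀`. -/
def picardTerm (A : ℝ → E →L[ℝ] E) (p : ℝ) (x₀ : E) : ℕ → ℝ → E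
  | 0 => fun _ => x₀
  | k + 1 => fun t => ∫ s in p..t, A s (picardTerm A p x₀ k s)

variable {A : ℝ → E →L[ℝ] E} {a b p : ℝ} {x₀ : E}

lemma picardTerm_self (k : ℕ) : picardTerm A p x₀ k p = if k = 0 then x₀ else 0 := by
  cases k <;> simp [picardTerm]

/-- The factorial from the iterated integrals dominates the Picard series by an exponential series,
which permits termwise differentiation. -/
lemma norm_picardTerm_le {M : ℝ} (hM : 0 ≤ M) (hbd : ∀ s ∈ Ioo a b, ‖A s‖ ≤ M)
    (hp : p ∈ Ioo a b) (k : ℕ) {t : ℝ} (ht : t ∈ Ioo a b) :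
    ‖picardTerm A p x₀ k t‖ ≤ ‖x₀‖ * ((M * |t - p|) ^ k / k.factorial) := by
  induction k generalizing t with
  | zero => simp [picardTerm]
  | succ k ih =>
    have hsub : uIcc p t ⊆ Ioo a b := (ordConnected_Ioo.uIcc_subset hp ht)
    have h1 : ‖picardTerm A p x₀ (k + 1) t‖ ≤
        |∫ s in p..t, ‖x₀‖ * M ^ (k + 1) / k.factorial * |s - p| ^ k| := by
      apply intervalIntegral.norm_integral_le_abs_of_norm_le
      · refine MeasureTheory.ae_restrict_of_forall_mem measurableSet_uIoc fun s hs => ?_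
        have hs' := hsub (uIoc_subset_uIcc hs)
        calc ‖A s (picardTerm A p x₀ k s)‖ ≤ ‖A s‖ * ‖picardTerm A p x₀ k s‖ :=
              (A s).le_opNorm _
          _ ≤ M * (‖x₀‖ * ((M * |s - p|) ^ k / k.factorial)) :=
              mul_le_mul (hbd s hs') (ih hs') (norm_nonneg _) hM
          _ = _ := by rw [mul_pow]; ring
      · apply Continuous.intervalIntegrable
        fun_prop
    refine h1.trans_eq ?_
    rw [intervalIntegral.integral_const_mul, abs_mul,
      intervalIntegral.abs_integral_eq_abs_integral_uIoc, integral_pow_abs_sub_uIoc,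
      abs_of_nonneg (by positivity), abs_of_nonneg (by positivity),
      Nat.factorial_succ, mul_pow]
    push_cast
    field_simp

variable [CompleteSpace E]

lemma hasDerivAt_integral_of_mem_Ioo {f : ℝ → E} (hf : ContinuousOn f (Ioo a b))
    (hp : p ∈ Ioo a b) {t : ℝ} (ht : t ∈ Ioo a b) :
    HasDerivAt (fun u => ∫ s in p..u, f s) (f t) t := by
  have hsub : uIcc p t ⊆ Ioo a b := (ordConnected_Ioo.uIcc_subset hp ht)
  apply intervalIntegral.integral_hasDerivAt_right
  · exact (hf.mono hsub).intervalIntegrable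
  · exact hf.stronglyMeasurableAtFilter isOpen_Ioo t ht
  · exact hf.continuousAt (isOpen_Ioo.mem_nhds ht)

lemma continuousOn_picardTerm (hA : ContinuousOn A (Ioo a b)) (hp : p ∈ Ioo a b) (k : ℕ) :
    ContinuousOn (picardTerm A p x₀ k) (Ioo a b) := by
  induction k with
  | zero => exact continuousOn_const
  | succ k ih =>
    intro t ht
    exact (hasDerivAt_integral_of_mem_Ioo (hA.clm_apply ih) hp ht).continuousAt.continuousWithinAt

lemma hasDerivAt_picardTerm_succ (hA : ContinuousOn A (Ioo a b)) (hp : p ∈ Ioo a b) (k : ℕ)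
    {t : ℝ} (ht : t ∈ Ioo a b) :
    HasDerivAt (picardTerm A p x₀ (k + 1)) (A t (picardTerm A p x₀ k t)) t :=
  hasDerivAt_integral_of_mem_Ioo (hA.clm_apply (continuousOn_picardTerm hA hp k)) hp ht

/-- A linear differential equation with continuous coefficients has a solution on the whole
interval. -/
theorem exists_solution (hA : ContinuousOn A (Ioo a b)) (hp : p ∈ Ioo a b) (x₀ : E) :
    ∃ X : ℝ → E, X p = x₀ ∧ ∀ t ∈ Ioo a b, HasDerivAt X (A t (X t)) t := by
  refine ⟨fun t => ∑' k, picardTerm A p x₀ k t, ?_, fun t ht => ?_⟩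
  · simp only [picardTerm_self]
    exact tsum_ite_eq 0 (fun _ => x₀)
  -- The coefficient may be unbounded near the ends of the interval; on a compact subinterval
  -- containing p and t it is bounded.
  obtain ⟨a', ha', ha2⟩ : ∃ a', a < a' ∧ a' < min p t := exists_between (lt_min hp.1 ht.1)
  obtain ⟨b', hb2, hb'⟩ : ∃ b', max p t < b' ∧ b' < b := exists_between (max_lt hp.2 ht.2)
  have hsub : Icc a' b' ⊆ Ioo a b := Icc_subset_Ioo ha' hb'
  have hsub' : Ioo a' b' ⊆ Ioo a b := Ioo_subset_Icc_self.trans hsub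
  have hp' : p ∈ Ioo a' b' := ⟨ha2.trans_le (min_le_left _ _), (le_max_left _ _).trans_lt hb2⟩
  have ht' : t ∈ Ioo a' b' := ⟨ha2.trans_le (min_le_right _ _), (le_max_right _ _).trans_lt hb2⟩
  obtain ⟨M, hM⟩ := isCompact_Icc.exists_bound_of_continuousOn (hA.mono hsub)
  have hM0 : 0 ≤ M := (norm_nonneg _).trans (hM p (Ioo_subset_Icc_self hp'))
  have hbd : ∀ s ∈ Ioo a' b', ‖A s‖ ≤ M := fun s hs => hM s (Ioo_subset_Icc_self hs)
  have hbound : ∀ k, ∀ s ∈ Ioo a' b', ‖picardTerm A p x₀ k s‖ ≤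
      ‖x₀‖ * ((M * (b' - a')) ^ k / k.factorial) := fun k s hs =>
    (norm_picardTerm_le hM0 hbd hp' k hs).trans (by
      have : |s - p| ≤ b' - a' := by
        rw [abs_le]; constructor <;> linarith [hs.1, hs.2, hp'.1, hp'.2]
      gcongr)
  have hsum : Summable fun k : ℕ => ‖x₀‖ * ((M * (b' - a')) ^ k / k.factorial) :=
    (Real.summable_pow_div_factorial _).mul_left _
  have hsumX : ∀ s ∈ Ioo a' b', Summable fun k => picardTerm A p x₀ k s := fun s hs =>
    Summable.of_norm_bounded hsum fun k => hbound k s hs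
  have key : HasDerivAt (fun s => ∑' k, picardTerm A p x₀ (k + 1) s)
      (∑' k, A t (picardTerm A p x₀ k t)) t :=
    hasDerivAt_tsum_of_isPreconnected (hsum.mul_left M) isOpen_Ioo isPreconnected_Ioo
      (fun k s hs => hasDerivAt_picardTerm_succ hA hp k (hsub' hs))
      (fun k s hs => ((A s).le_opNorm _).trans
        (mul_le_mul (hbd s hs) (hbound k s hs) (norm_nonneg _) hM0))
      ht' ((summable_nat_add_iff 1).2 (hsumX t ht')) ht'
  rw [← ContinuousLinearMap.map_tsum _ (hsumX t ht')] at key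
  refine (key.const_add x₀).congr_of_eventuallyEq ?_
  filter_upwards [isOpen_Ioo.mem_nhds ht'] with s hs
  rw [(hsumX s hs).tsum_eq_zero_add]
  rfl

end LinearODE

namespace Mink

variable {n : ℕ}

/-! ### Primitives of Lie algebra valued forms -/

lemma form_inv_apply (A : lorentz n) (x z : Mink n) :
    form n ((A⁻¹).1 x) z = form n x (A.1 z) := by
  have h := A.2 ((A⁻¹).1 x) z
  have e : A.1 ((A⁻¹).1 x) = x := A.1.apply_symm_apply x
  rw [e] at h
  exact h.symm

lemma form_apply_left (A : lorentz n) (x z : Mink n) :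
    form n (A.1 x) z = form n x ((A⁻¹).1 z) := by
  rw [form_comm x, form_inv_apply, form_comm]

/-- Solve X' = XΨ and Y' = -ΨY with X(p) = Y(p) = id. Then XY is constant, so Y is a right inverse
of X, and by finite dimension a two-sided one. Skewness of Ψ makes Y, hence X, preserve the form. -/
theorem exists_isPrimitive {Ψ : ℝ → Mink n →L[ℝ] Mink n} {a b p : ℝ}
    (hΨ : ContinuousOn Ψ (Ioo a b)) (hp : p ∈ Ioo a b)
    (hskew : ∀ t ∈ Ioo a b, ∀ x y, form n (Ψ t x) y = -form n x (Ψ t y)) :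
    ∃ Γ, IsPrimitive Ψ (Ioo a b) p Γ := by
  classical
  obtain ⟨X, hXp, hX⟩ := LinearODE.exists_solution
    (A := fun t => (ContinuousLinearMap.compL ℝ (Mink n) (Mink n) (Mink n)).flip (Ψ t))
    ((ContinuousLinearMap.continuous _).comp_continuousOn hΨ) hp (ContinuousLinearMap.id ℝ _)
  obtain ⟨Y, hYp, hY⟩ := LinearODE.exists_solution
    (A := fun t => (ContinuousLinearMap.compL ℝ (Mink n) (Mink n) (Mink n)) (-Ψ t))
    ((ContinuousLinearMap.continuous _).comp_continuousOn hΨ.neg) hp (ContinuousLinearMap.id ℝ _)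
  replace hX : ∀ t ∈ Ioo a b, HasDerivAt X ((X t).comp (Ψ t)) t := hX
  replace hY : ∀ t ∈ Ioo a b, HasDerivAt Y ((-Ψ t).comp (Y t)) t := hY
  have hYx : ∀ x, ∀ t ∈ Ioo a b, HasDerivAt (fun s => Y s x) (-(Ψ t (Y t x))) t := fun x t ht => by
    simpa using (hY t ht).clm_apply (hasDerivAt_const t x)
  have hYform : ∀ x y, ∀ t ∈ Ioo a b, form n (Y t x) (Y t y) = form n x y := by
    intro x y t ht
    have := isOpen_Ioo.is_const_of_deriv_eq_zero isPreconnected_Ioo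
      (f := fun s => form n (Y s x) (Y s y))
      (fun s hs => ((hYx x s hs).form (hYx y s hs)).differentiableAt.differentiableWithinAt)
      (fun s hs => by
        rw [((hYx x s hs).form (hYx y s hs)).deriv]
        simp [hskew s hs]) ht hp
    simpa [hYp] using this
  have hXY : ∀ t ∈ Ioo a b, (X t).comp (Y t) = ContinuousLinearMap.id ℝ _ := by
    intro t ht
    have hd : ∀ s ∈ Ioo a b, HasDerivAt (fun s => (X s).comp (Y s)) 0 s := fun s hs => by
      convert (hX s hs).clm_comp (hY s hs) using 1
      ext x
      simp
    have := isOpen_Ioo.is_const_of_deriv_eq_zero isPreconnected_Ioo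
      (f := fun s => (X s).comp (Y s))
      (fun s hs => (hd s hs).differentiableAt.differentiableWithinAt)
      (fun s hs => (hd s hs).deriv) ht hp
    simpa [hYp, hXp] using this
  have hYX : ∀ t ∈ Ioo a b, (Y t).comp (X t) = ContinuousLinearMap.id ℝ _ := fun t ht => by
    have h : (X t : Mink n →ₗ[ℝ] Mink n) * (Y t : Mink n →ₗ[ℝ] Mink n) = 1 := by
      have := hXY t ht
      ext1 x
      exact congrArg (fun f : Mink n →L[ℝ] Mink n => f x) this
    have h' := mul_eq_one_comm.1 h
    ext1 x
    exact congrArg (fun f : Mink n →ₗ[ℝ] Mink n => f x) h'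
  have h1 : ∀ t ∈ Ioo a b, ∀ x, X t (Y t x) = x := fun t ht x =>
    congrArg (fun f : Mink n →L[ℝ] Mink n => f x) (hXY t ht)
  have h2 : ∀ t ∈ Ioo a b, ∀ x, Y t (X t x) = x := fun t ht x =>
    congrArg (fun f : Mink n →L[ℝ] Mink n => f x) (hYX t ht)
  have hG : ∀ t, ∃ G : lorentz n, t ∈ Ioo a b → (G.1 : Mink n →L[ℝ] Mink n) = X t := fun t => by
    by_cases ht : t ∈ Ioo a b
    · refine ⟨⟨ContinuousLinearEquiv.equivOfInverse (X t) (Y t) (h2 t ht) (h1 t ht),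
        fun x y => ?_⟩, fun _ => rfl⟩
      have := hYform (X t x) (X t y) t ht
      rw [h2 t ht, h2 t ht] at this
      exact this.symm
    · exact ⟨1, fun h => absurd h ht⟩
  choose G hG using hG
  refine ⟨G, ?_, fun t ht => ?_⟩
  · apply Subtype.ext
    apply ContinuousLinearEquiv.coe_injective
    rw [hG p hp, hXp]
    rfl
  · rw [hG t ht]
    refine (hX t ht).congr_of_eventuallyEq ?_
    filter_upwards [isOpen_Ioo.mem_nhds ht] with s hs
    exact hG s hs

lemma isPrimitive_primitive {Ψ : ℝ → Mink n →L[ℝ] Mink n} {a b p : ℝ}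
    (hΨ : ContinuousOn Ψ (Ioo a b)) (hp : p ∈ Ioo a b)
    (hskew : ∀ t ∈ Ioo a b, ∀ x y, form n (Ψ t x) y = -form n x (Ψ t y)) :
    IsPrimitive Ψ (Ioo a b) p (primitive Ψ (Ioo a b) p) := by
  have h := exists_isPrimitive hΨ hp hskew
  rw [primitive, dif_pos h]
  exact Classical.choose_spec h

/-- For a Lorentz transformation the inverse is the adjoint, ⟨Γ⁻¹x, z⟩ = ⟨x, Γz⟩, so it is
differentiated weakly, without differentiating inversion. -/
lemma IsPrimitive.hasDerivAt_inv_apply {Ψ : ℝ → Mink n →L[ℝ] Mink n} {s : Set ℝ} {p : ℝ}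
    {Γ : ℝ → lorentz n} (hΓ : IsPrimitive Ψ s p Γ) {t : ℝ} (ht : t ∈ s)
    (hskew : ∀ x y, form n (Ψ t x) y = -form n x (Ψ t y)) (x : Mink n) :
    HasDerivAt (fun r => ((Γ r)⁻¹).1 x) (-Ψ t (((Γ t)⁻¹).1 x)) t := by
  refine hasDerivAt_of_forall_form fun z => ?_
  simp only [form_inv_apply]
  have h := (hasDerivAt_const t x).form ((hΓ.2 t ht).clm_apply (hasDerivAt_const t z))
  have e : form n (-Ψ t (((Γ t)⁻¹).1 x)) z = form n x ((Γ t).1 (Ψ t z)) := by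
    rw [← form_inv_apply, map_neg, LinearMap.neg_apply, hskew, neg_neg]
  rw [e]
  simp only [map_zero, LinearMap.zero_apply, zero_add, add_zero] at h
  exact h

lemma wedge_apply (v w x : Mink n) : wedge v w x = form n v x • w - form n w x • v := rfl

lemma form_wedge (v w x y : Mink n) : form n (wedge v w x) y = -form n x (wedge v w y) := by
  simp only [wedge_apply, map_sub, map_smul, LinearMap.sub_apply, LinearMap.smul_apply, smul_eq_mul,
    form_comm x]
  ring

lemma continuousOn_wedge {f g : ℝ → Mink n} {s : Set ℝ} (hf : ContinuousOn f s)
    (hg : ContinuousOn g s) : ContinuousOn (fun t => wedge (f t) (g t)) s := by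
  rw [continuousOn_clm_apply]
  intro x
  simp only [wedge_apply]
  exact ((hf.form continuousOn_const).smul hg).sub ((hg.form continuousOn_const).smul hf)

/-! ### The topology of the conformal sphere -/

lemma continuous_span : Continuous (span : LightCone n → Sphere n) := continuous_quotient_mk'

lemma LightCone.isInducing_val : IsInducing (fun x : LightCone n => x.1) := ⟨rfl⟩

lemma span_eq_span {x y : LightCone n} {a : ℝ} (ha : a ≠ 0) (h : y.1 = a • x.1) :
    span x = span y :=
  Quotient.sound ⟨a, ha, h⟩

lemma exists_of_span_eq {x y : LightCone n} (h : span x = span y) :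
    ∃ a : ℝ, a ≠ 0 ∧ y.1 = a • x.1 :=
  Quotient.exact h

lemma exists_span_eq (P : Sphere n) : ∃ x, span x = P := Quotient.exists_rep P

/-- The light-like vector `a x`. -/
def LightCone.scale (a : ℝ) (ha : a ≠ 0) (x : LightCone n) : LightCone n :=
  ⟨a • x.1, smul_ne_zero ha x.2.1, by simp [x.2.2]⟩

lemma span_scale (a : ℝ) (ha : a ≠ 0) (x : LightCone n) : span (x.scale a ha) = span x :=
  (span_eq_span ha rfl).symm

/-- Convergence of lines may be tested on arbitrarily rescaled representatives. The representatives
Γ⁻¹x need not converge themselves, but suitable multiples do. -/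
lemma tendsto_span {α : Type*} {l : Filter α} {y : α → LightCone n} {s : α → ℝ} {z : LightCone n}
    (hs : ∀ᶠ a in l, s a ≠ 0) (h : Tendsto (fun a => s a • (y a).1) l (𝓝 z.1)) :
    Tendsto (fun a => span (y a)) l (𝓝 (span z)) := by
  classical
  -- Where the factor vanishes the default value z is used; this happens only off a set of the
  -- filter.
  let y' : α → LightCone n := fun a => if ha : s a ≠ 0 then (y a).scale (s a) ha else z
  have hy' : ∀ a (ha : s a ≠ 0), y' a = (y a).scale (s a) ha := fun a ha => dif_pos ha
  have h1 : Tendsto y' l (𝓝 z) := by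
    rw [LightCone.isInducing_val.tendsto_nhds_iff]
    refine h.congr' ?_
    filter_upwards [hs] with a ha
    rw [Function.comp_apply, hy' a ha]
    rfl
  refine ((continuous_span.tendsto z).comp h1).congr' ?_
  filter_upwards [hs] with a ha
  rw [Function.comp_apply, hy' a ha, span_scale]

lemma mem_pointsOf {W : Submodule ℝ (Mink n)} {x : LightCone n} :
    span x ∈ pointsOf W ↔ x.1 ∈ W := by
  constructor
  · rintro ⟨y, hy, hW⟩
    obtain ⟨a, -, h⟩ := exists_of_span_eq hy
    rw [h]; exact W.smul_mem a hW
  · exact fun h => ⟨x, rfl, h⟩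

/-- The relative size of the image of a point of the conformal sphere under a linear map. -/
def ratio (π : Mink n →L[ℝ] Mink n) : Sphere n → ℝ :=
  Quotient.lift (fun x : LightCone n => ‖π x.1‖ / ‖x.1‖) (by
    rintro x y ⟨a, ha, h⟩
    rw [h, map_smul, norm_smul, norm_smul, mul_div_mul_left _ _ (norm_ne_zero_iff.2 ha)])

lemma ratio_span (π : Mink n →L[ℝ] Mink n) (x : LightCone n) :
    ratio π (span x) = ‖π x.1‖ / ‖x.1‖ := rfl

lemma continuous_ratio (π : Mink n →L[ℝ] Mink n) : Continuous (ratio π) := by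
  refine Continuous.quotient_lift ?_ _
  have : Continuous (fun x : LightCone n => x.1) := continuous_subtype_val
  exact ((π.continuous.comp this).norm).div this.norm fun x => norm_ne_zero_iff.2 x.2.1

lemma ratio_nonneg (π : Mink n →L[ℝ] Mink n) (P : Sphere n) : 0 ≤ ratio π P := by
  obtain ⟨x, rfl⟩ := exists_span_eq P
  rw [ratio_span]; positivity

lemma ratio_eq_zero_iff {π : Mink n →L[ℝ] Mink n} {W : Submodule ℝ (Mink n)}
    (hπ : ∀ x, π x = 0 ↔ x ∈ W) (P : Sphere n) : ratio π P = 0 ↔ P ∈ pointsOf W := by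
  obtain ⟨x, rfl⟩ := exists_span_eq P
  rw [ratio_span, mem_pointsOf, ← hπ, div_eq_zero_iff, norm_eq_zero, norm_eq_zero]
  simp [x.2.1]

/-- Null vectors of Euclidean norm one form a compact set that maps onto the sphere. -/
instance : CompactSpace (Sphere n) := by
  let S : Set (Mink n) := {x | ‖x‖ = 1 ∧ form n x x = 0}
  have hS : IsCompact S := by
    have h1 : S = Metric.sphere 0 1 ∩ {x | form n x x = 0} := by
      ext x; simp [S]
    rw [h1]
    refine (isCompact_sphere _ _).inter_right (isClosed_eq ?_ continuous_const)
    exact continuous_form.comp (continuous_id.prodMk continuous_id)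
  have : CompactSpace S := isCompact_iff_compactSpace.1 hS
  let g : S → LightCone n := fun x => ⟨x.1, fun h => by
    have := x.2.1
    rw [h, norm_zero] at this
    exact zero_ne_one this, x.2.2⟩
  have hg : Continuous g := continuous_induced_rng.2 continuous_subtype_val
  refine Function.Surjective.compactSpace (f := span ∘ g) (continuous_span.comp hg) ?_
  intro P
  obtain ⟨x, rfl⟩ := exists_span_eq P
  have hx : ‖x.1‖⁻¹ ≠ 0 := inv_ne_zero (norm_ne_zero_iff.2 x.2.1)
  refine ⟨⟨‖x.1‖⁻¹ • x.1, ?_, ?_⟩, ?_⟩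
  · rw [norm_smul, norm_inv, norm_norm, inv_mul_cancel₀ (norm_ne_zero_iff.2 x.2.1)]
  · simp [x.2.2]
  · exact (span_eq_span hx rfl).symm

/-- Off an open neighbourhood of the points of W, a compact set, the continuous function `ratio π`
attains a positive minimum. -/
lemma tendsto_nhdsSet_pointsOf {α : Type*} {l : Filter α} {π : Mink n →L[ℝ] Mink n}
    {W : Submodule ℝ (Mink n)} (hπ : ∀ x, π x = 0 ↔ x ∈ W) {f : α → Sphere n}
    (h : Tendsto (fun a => ratio π (f a)) l (𝓝 0)) : Tendsto f l (𝓝ˢ (pointsOf W)) := by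
  rw [(hasBasis_nhdsSet (pointsOf W)).tendsto_right_iff]
  rintro U ⟨hU, hWU⟩
  have hc : IsCompact Uᶜ := hU.isClosed_compl.isCompact
  rcases Set.eq_empty_or_nonempty Uᶜ with h0 | h0
  · rw [compl_empty_iff] at h0
    simp [h0]
  obtain ⟨P, hP, hmin⟩ := hc.exists_isMinOn h0 (continuous_ratio π).continuousOn
  have hpos : 0 < ratio π P := (ratio_nonneg π P).lt_of_ne fun h =>
    hP (hWU ((ratio_eq_zero_iff hπ P).1 h.symm))
  filter_upwards [h.eventually_lt_const hpos] with a ha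
  by_contra hn
  exact absurd (hmin hn) (not_le.2 ha)

lemma mem_pointsOf_of_mapClusterPt {α : Type*} {l : Filter α} {π : Mink n →L[ℝ] Mink n}
    {W : Submodule ℝ (Mink n)} (hπ : ∀ x, π x = 0 ↔ x ∈ W) {f : α → Sphere n}
    (h : Tendsto (fun a => ratio π (f a)) l (𝓝 0)) {P : Sphere n} (hP : MapClusterPt P l f) :
    P ∈ pointsOf W := by
  have h1 : MapClusterPt (ratio π P) l (ratio π ∘ f) :=
    hP.continuousAt_comp (continuous_ratio π).continuousAt
  have h2 := h1.clusterPt.mono (show map (ratio π ∘ f) l ≤ 𝓝 0 from h)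
  have h3 : (𝓝 (ratio π P) ⊓ 𝓝 0).NeBot := h2
  exact (ratio_eq_zero_iff hπ P).1 (eq_of_nhds_neBot h3)

/-- A neighbourhood of a point of the conformal sphere contains all light-like vectors close to a
representative. -/
lemma exists_ball_of_mem_nhds {z : LightCone n} {U : Set (Sphere n)} (hU : U ∈ 𝓝 (span z)) :
    ∃ r > 0, ∀ (y : LightCone n) (s : ℝ), s ≠ 0 → ‖s • y.1 - z.1‖ < r → span y ∈ U := by
  have h1 : span ⁻¹' U ∈ 𝓝 z := continuous_span.continuousAt hU
  rw [LightCone.isInducing_val.nhds_eq_comap, mem_comap] at h1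
  obtain ⟨V, hV, hVU⟩ := h1
  obtain ⟨r, hr, hball⟩ := Metric.mem_nhds_iff.1 hV
  refine ⟨r, hr, fun y s hs h => ?_⟩
  rw [← span_scale s hs y]
  exact hVU (hball (by simpa [dist_eq_norm, LightCone.scale] using h))

end Mink

/-- A curve whose velocity is controlled by its position converges at a linear rate. -/
lemma exists_limit_of_norm_deriv_le {E : Type*} [NormedAddCommGroup E] [NormedSpace ℝ E]
    [CompleteSpace E] {X X' : ℝ → E} {d L : ℝ} (hd : 0 < d) (hL : 0 ≤ L)
    (hX : ∀ t ∈ Ioc 0 d, HasDerivAt X (X' t) t) (hb : ∀ t ∈ Ioc 0 d, ‖X' t‖ ≤ L * ‖X t‖) :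
    ∃ X₀ : E, ∃ B ≥ 0, ∀ t ∈ Ioc 0 d, ‖X t - X₀‖ ≤ B * t := by
  -- Grönwall's inequality is applied backwards in time from d, so the bound is uniform down to 0.
  -- It makes X Lipschitz, hence Cauchy at 0.
  have hbd : ∀ t ∈ Ioc 0 d, ‖X t‖ ≤ ‖X d‖ * Real.exp (L * d) := by
    intro t ht
    have hmem : ∀ s ∈ Icc 0 (d - t), d - s ∈ Ioc 0 d := fun s hs =>
      ⟨by linarith [hs.2, ht.1], by linarith [hs.1]⟩
    have hder : ∀ s ∈ Icc 0 (d - t), HasDerivAt (fun s => X (d - s)) (-X' (d - s)) s :=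
      fun s hs => by
        simpa [Function.comp_def] using
          (hX _ (hmem s hs)).scomp s ((hasDerivAt_id s).const_sub d)
    have := norm_le_gronwallBound_of_norm_deriv_right_le (f := fun s => X (d - s))
      (f' := fun s => -X' (d - s)) (δ := ‖X d‖) (K := L) (ε := 0) (a := 0) (b := d - t)
      (fun s hs => (hder s hs).continuousAt.continuousWithinAt)
      (fun s hs => (hder s (Ico_subset_Icc_self hs)).hasDerivWithinAt) (by simp)
      (fun s hs => by simpa using hb _ (hmem s (Ico_subset_Icc_self hs))) (d - t)
      ⟨by linarith [ht.2], le_rfl⟩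
    simp only [sub_sub_cancel, gronwallBound_ε0, sub_zero] at this
    refine this.trans ?_
    gcongr
    linarith [ht.1]
  set B := L * (‖X d‖ * Real.exp (L * d)) with hB
  have hB0 : 0 ≤ B := by positivity
  have hlip : ∀ s ∈ Ioc 0 d, ∀ t ∈ Ioc 0 d, ‖X t - X s‖ ≤ B * |t - s| := fun s hs t ht => by
    simpa using (convex_Ioc 0 d).norm_image_sub_le_of_norm_hasDerivWithin_le
      (fun r hr => (hX r hr).hasDerivWithinAt)
      (fun r hr => (hb r hr).trans (mul_le_mul_of_nonneg_left (hbd r hr) hL)) hs ht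
  have hcauchy : Cauchy (map X (𝓝[>] 0)) := by
    rw [Metric.cauchy_iff]
    refine ⟨inferInstance, fun e he => ?_⟩
    set r := min d (e / (B + 1)) with hr
    have hr0 : 0 < r := lt_min hd (by positivity)
    refine ⟨X '' Ioo 0 r, image_mem_map (Ioo_mem_nhdsGT hr0), ?_⟩
    rintro _ ⟨s, hs, rfl⟩ _ ⟨t, ht, rfl⟩
    have hrd : r ≤ d := min_le_left _ _
    rw [dist_eq_norm]
    have h1 := hlip t ⟨ht.1, by linarith [ht.2]⟩ s ⟨hs.1, by linarith [hs.2]⟩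
    have h2 : |s - t| < e / (B + 1) := by
      refine lt_of_lt_of_le ?_ (min_le_right d _)
      rw [abs_lt]; constructor <;> linarith [hs.1, hs.2, ht.1, ht.2]
    rw [lt_div_iff₀ (by positivity)] at h2
    nlinarith [abs_nonneg (s - t)]
  obtain ⟨X₀, hX₀⟩ := cauchy_map_iff_exists_tendsto.1 hcauchy
  refine ⟨X₀, B, hB0, fun t ht => ?_⟩
  have h1 : Tendsto (fun s => ‖X t - X s‖) (𝓝[>] 0) (𝓝 ‖X t - X₀‖) :=
    (tendsto_const_nhds.sub hX₀).norm
  refine le_of_tendsto h1 ?_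
  filter_upwards [Ioo_mem_nhdsGT ht.1] with s hs
  refine (hlip s ⟨hs.1, hs.2.le.trans ht.2⟩ t ht).trans ?_
  rw [abs_of_pos (by linarith [hs.2])]
  exact mul_le_mul_of_nonneg_left (by linarith [hs.1]) hB0

namespace Mink

variable {n : ℕ}

/-! ### Null frames -/

/-- `C` and `N` are null with `⟪C, N⟫ = -1`, and `T` is a unit vector orthogonal to both. -/
structure IsNullFrame (C T N : Mink n) : Prop where
  CC : form n C C = 0
  CT : form n C T = 0
  TT : form n T T = 1
  CN : form n C N = -1
  TN : form n T N = 0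
  NN : form n N N = 0

/-- The component orthogonal to a null frame. -/
def normalPart (C T N z : Mink n) : Mink n :=
  z + form n N z • C - form n T z • T + form n C z • N

namespace IsNullFrame

variable {C T N : Mink n}

lemma form_normalPart (h : IsNullFrame C T N) (z : Mink n) :
    form n C (normalPart C T N z) = 0 ∧
    form n T (normalPart C T N z) = 0 ∧ form n N (normalPart C T N z) = 0 := by
  have h1 := form_comm N C
  have h2 := form_comm T C
  have h3 := form_comm N T
  refine ⟨?_, ?_, ?_⟩ <;>
    simp [normalPart, h.CC, h.CT, h.TT, h.CN, h.TN, h.NN, h1, h2, h3]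

lemma form_eq (h : IsNullFrame C T N) (y z : Mink n) :
    form n y z = -(form n C y * form n N z) - form n N y * form n C z + form n T y * form n T z +
      form n (normalPart C T N y) (normalPart C T N z) := by
  obtain ⟨h1, h2, h3⟩ := h.form_normalPart z
  have e : form n (normalPart C T N y) (normalPart C T N z) = form n y (normalPart C T N z) := by
    rw [normalPart]
    simp [h1, h2, h3]
  rw [e, normalPart]
  simp only [map_add, map_sub, map_smul, smul_eq_mul, form_comm y C, form_comm y T, form_comm y N]
  ring

end IsNullFrame

/-! ### Asymptotics of the Darboux equation -/

/-- A moving null frame along a curve `C`, with the coefficient `μ(t) / t²` of the Darboux equation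
of that curve and bounds near `0`. -/
structure CurveFrame (n : ℕ) where
  /-- the curve, parametrized by arc length -/
  C : ℝ → Mink n
  /-- the tangent field -/
  T : ℝ → Mink n
  /-- the null field complementing `C`, `T` to a frame of the osculating space -/
  N : ℝ → Mink n
  /-- the normal derivative of `N` -/
  K : ℝ → Mink n
  /-- half the square of the curvature -/
  q : ℝ → ℝ
  /-- the coefficient `μ` of the Darboux equation -/
  μ : ℝ → ℝ
  /-- the value of `μ` at `0` -/
  μ₀ : ℝ
  /-- the length of the interval -/
  d : ℝ
  /-- a bound for all data -/
  M : ℝ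
  d_pos : 0 < d
  d_le : d ≤ 1
  M_nonneg : 0 ≤ M
  one_lt : 1 < 2 * μ₀
  frame : ∀ t ∈ Icc 0 d, IsNullFrame (C t) (T t) (N t)
  deriv_C : ∀ t ∈ Ioc 0 d, HasDerivAt C (T t) t
  deriv_T : ∀ t ∈ Ioc 0 d, HasDerivAt T (N t - q t • C t) t
  deriv_N : ∀ t ∈ Ioc 0 d, HasDerivAt N (K t - q t • T t) t
  form_K : ∀ t ∈ Ioc 0 d, form n (K t) (C t) = 0 ∧ form n (K t) (T t) = 0 ∧ form n (K t) (N t) = 0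
  continuousOn_μ : ContinuousOn μ (Ioc 0 d)
  abs_q_le : ∀ t ∈ Ioc 0 d, |q t| ≤ M
  norm_K_le : ∀ t ∈ Ioc 0 d, ‖K t‖ ≤ M
  norm_C_le : ∀ t ∈ Icc 0 d, ‖C t‖ ≤ M
  norm_T_le : ∀ t ∈ Icc 0 d, ‖T t‖ ≤ M
  norm_N_le : ∀ t ∈ Icc 0 d, ‖N t‖ ≤ M
  abs_μ_sub_le : ∀ t ∈ Ioc 0 d, |μ t - μ₀| ≤ M * t
  norm_C_sub_le : ∀ t ∈ Ioc 0 d, ‖C t - C 0‖ ≤ M * t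
  norm_T_sub_le : ∀ t ∈ Ioc 0 d, ‖T t - T 0‖ ≤ M * t
  norm_N_sub_le : ∀ t ∈ Ioc 0 d, ‖N t - N 0‖ ≤ M * t

namespace CurveFrame

variable (F : CurveFrame n)

/-- Solutions of the Darboux equation. -/
def IsSol (y : ℝ → Mink n) : Prop := ∀ t ∈ Ioc 0 F.d,
  HasDerivAt y (-((F.μ t / t ^ 2) • wedge (F.C t) (F.T t) (y t))) t

/-- The rotation speed in the logarithmic scale. -/
def freq : ℝ := √(2 * F.μ₀ - 1)

lemma freq_pos : 0 < F.freq := Real.sqrt_pos.2 (by linarith [F.one_lt])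

lemma freq_sq : F.freq ^ 2 = 2 * F.μ₀ - 1 := Real.sq_sqrt (by linarith [F.one_lt])

/-- The component of `y` normal to the osculating space. -/
def ν (y : ℝ → Mink n) (t : ℝ) : Mink n := normalPart (F.C t) (F.T t) (F.N t) (y t)

variable {F} {y : ℝ → Mink n}

lemma form_eq {t : ℝ} (ht : t ∈ Icc 0 F.d) (y z : ℝ → Mink n) : form n (y t) (z t) =
    -(form n (F.C t) (y t) * form n (F.N t) (z t)) - form n (F.N t) (y t) * form n (F.C t) (z t) +
    form n (F.T t) (y t) * form n (F.T t) (z t) + form n (F.ν y t) (F.ν z t) :=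
  (F.frame t ht).form_eq (y t) (z t)

lemma eq_add_ν (t : ℝ) : y t = -(form n (F.N t) (y t)) • F.C t + form n (F.T t) (y t) • F.T t -
    form n (F.C t) (y t) • F.N t + F.ν y t := by
  rw [ν, normalPart]; module

lemma form_K_ν {t : ℝ} (ht : t ∈ Ioc 0 F.d) : form n (F.K t) (F.ν y t) = form n (F.K t) (y t) := by
  obtain ⟨h1, h2, h3⟩ := F.form_K t ht
  simp [ν, normalPart, h1, h2, h3]

/-- The singular term (C ∧ T)y = ⟨C,y⟩T - ⟨T,y⟩C is orthogonal to C, so only C' = T contributes. -/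
lemma IsSol.hasDerivAt_C (hy : F.IsSol y) {t : ℝ} (ht : t ∈ Ioc 0 F.d) :
    HasDerivAt (fun s => form n (F.C s) (y s)) (form n (F.T t) (y t)) t := by
  have hf := F.frame t (Ioc_subset_Icc_self ht)
  have h := (F.deriv_C t ht).form (hy t ht)
  convert h using 1
  simp [wedge_apply, hf.CC, hf.CT]

lemma IsSol.hasDerivAt_T (hy : F.IsSol y) {t : ℝ} (ht : t ∈ Ioc 0 F.d) :
    HasDerivAt (fun s => form n (F.T s) (y s)) (form n (F.N t) (y t) -
      F.q t * form n (F.C t) (y t) - F.μ t / t ^ 2 * form n (F.C t) (y t)) t := by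
  have hf := F.frame t (Ioc_subset_Icc_self ht)
  have h := (F.deriv_T t ht).form (hy t ht)
  convert h using 1
  simp [wedge_apply, hf.TT, hf.CT, form_comm (F.T t) (F.C t)]
  ring

lemma IsSol.hasDerivAt_N (hy : F.IsSol y) {t : ℝ} (ht : t ∈ Ioc 0 F.d) :
    HasDerivAt (fun s => form n (F.N s) (y s)) (form n (F.K t) (F.ν y t) -
      F.q t * form n (F.T t) (y t) - F.μ t / t ^ 2 * form n (F.T t) (y t)) t := by
  have hf := F.frame t (Ioc_subset_Icc_self ht)
  have h := (F.deriv_N t ht).form (hy t ht)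
  rw [form_K_ν ht]
  convert h using 1
  simp [wedge_apply, hf.TN, hf.CN, form_comm (F.N t) (F.C t), form_comm (F.N t) (F.T t)]
  ring

/-- The singular term lies in the span of C and T and is invisible to the normal part, whose
equation therefore has no pole. -/
lemma IsSol.hasDerivAt_ν (hy : F.IsSol y) {t : ℝ} (ht : t ∈ Ioc 0 F.d) :
    HasDerivAt (F.ν y) (form n (F.K t) (F.ν y t) • F.C t + form n (F.C t) (y t) • F.K t) t := by
  have h : HasDerivAt (F.ν y) _ t := (((hy t ht).add ((hy.hasDerivAt_N ht).smul (F.deriv_C t ht))).sub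
    ((hy.hasDerivAt_T ht).smul (F.deriv_T t ht))).add ((hy.hasDerivAt_C ht).smul (F.deriv_N t ht))
  refine h.congr_deriv ?_
  rw [wedge_apply]
  module

/-- The oscillating terms of a solution. -/
def osc (F : CurveFrame n) (k₁ k₂ t : ℝ) : ℝ :=
  k₁ * Real.cos (F.freq * Real.log t) + k₂ * Real.sin (F.freq * Real.log t)

lemma hasDerivAt_angle {t : ℝ} (ht : 0 < t) :
    HasDerivAt (fun s => F.freq * Real.log s) (F.freq / t) t := by
  simpa [div_eq_mul_inv] using (Real.hasDerivAt_log ht.ne').const_mul F.freq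

lemma osc_sub (k₁ k₂ l₁ l₂ t : ℝ) :
    F.osc k₁ k₂ t - F.osc l₁ l₂ t = F.osc (k₁ - l₁) (k₂ - l₂) t := by
  simp only [osc]; ring

lemma abs_osc_le (k₁ k₂ t : ℝ) : |F.osc k₁ k₂ t| ≤ |k₁| + |k₂| := by
  refine (abs_add_le _ _).trans ?_
  rw [abs_mul, abs_mul]
  have h1 := Real.abs_cos_le_one (F.freq * Real.log t)
  have h2 := Real.abs_sin_le_one (F.freq * Real.log t)
  nlinarith [abs_nonneg k₁, abs_nonneg k₂]

end CurveFrame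

/-! ### Separating the rotation from the slow variables -/

namespace CurveFrame

variable {F : CurveFrame n} {y : ℝ → Mink n}

/-- The first integral of the model equation along `y`. -/
def axial (F : CurveFrame n) (y : ℝ → Mink n) (t : ℝ) : ℝ :=
  (F.μ₀ * (form n (F.C t) (y t) / t) + t * form n (F.N t) (y t) - form n (F.T t) (y t)) / F.freq ^ 2

/-- The rate of change of `axial`. -/
def axialRate (F : CurveFrame n) (y : ℝ → Mink n) (t : ℝ) : ℝ :=
  ((F.μ t - F.μ₀) / t * (form n (F.C t) (y t) / t - form n (F.T t) (y t)) +
    t * (form n (F.K t) (F.ν y t) - F.q t * form n (F.T t) (y t)) +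
    F.q t * form n (F.C t) (y t)) / F.freq ^ 2

/-- `axial` is a left null vector of the model matrix, so the terms of order 1/t cancel up to the
factor μ - μ₀ = O(t). -/
lemma IsSol.hasDerivAt_axial (hy : F.IsSol y) {t : ℝ} (ht : t ∈ Ioc 0 F.d) :
    HasDerivAt (F.axial y) (F.axialRate y t) t := by
  have ht0 : t ≠ 0 := ht.1.ne'
  have h : HasDerivAt (F.axial y) _ t :=
    ((((((hy.hasDerivAt_C ht).div (hasDerivAt_id t) ht0).const_mul F.μ₀).add
      ((hasDerivAt_id t).mul (hy.hasDerivAt_N ht))).sub (hy.hasDerivAt_T ht)).div_const (F.freq ^ 2))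
  refine h.congr_deriv ?_
  rw [axialRate]
  have := F.freq_pos.ne'
  simp only [id]
  field_simp
  ring

/-- The first component of `y` in the rotation plane of the model equation. -/
def planar₁ (F : CurveFrame n) (y : ℝ → Mink n) (t : ℝ) : ℝ :=
  form n (F.C t) (y t) / t - F.axial y t

/-- The second component of `y` in the rotation plane of the model equation. -/
def planar₂ (F : CurveFrame n) (y : ℝ → Mink n) (t : ℝ) : ℝ :=
  (form n (F.T t) (y t) - form n (F.C t) (y t) / t) / F.freq

/-- The rate of change of the radial motion in the rotation plane. -/
def planarRate (F : CurveFrame n) (y : ℝ → Mink n) (t : ℝ) : ℝ :=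
  (F.q t * form n (F.C t) (y t) + (F.μ t - F.μ₀) / t * (form n (F.C t) (y t) / t)) / F.freq

lemma IsSol.hasDerivAt_planar₁ (hy : F.IsSol y) {t : ℝ} (ht : t ∈ Ioc 0 F.d) :
    HasDerivAt (F.planar₁ y) (F.freq / t * F.planar₂ y t - F.axialRate y t) t := by
  have ht0 : t ≠ 0 := ht.1.ne'
  have h : HasDerivAt (F.planar₁ y) _ t :=
    ((hy.hasDerivAt_C ht).div (hasDerivAt_id t) ht0).sub (hy.hasDerivAt_axial ht)
  refine h.congr_deriv ?_
  rw [planar₂]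
  have := F.freq_pos.ne'
  simp only [id]
  field_simp

/-- Together with `planar₁` this is a rotation with constant angular velocity `freq` in the time log
t, plus terms without a pole. The identity `freq`² = 2μ₀ - 1 enters here. -/
lemma IsSol.hasDerivAt_planar₂ (hy : F.IsSol y) {t : ℝ} (ht : t ∈ Ioc 0 F.d) :
    HasDerivAt (F.planar₂ y) (-(F.freq / t * F.planar₁ y t) - F.planarRate y t) t := by
  have ht0 : t ≠ 0 := ht.1.ne'
  have h : HasDerivAt (F.planar₂ y) _ t :=
    ((hy.hasDerivAt_T ht).sub ((hy.hasDerivAt_C ht).div (hasDerivAt_id t) ht0)).div_const F.freq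
  refine h.congr_deriv ?_
  rw [planar₁, planarRate, axial]
  have := F.freq_pos.ne'
  have hsq := F.freq_sq
  simp only [id]
  field_simp
  rw [hsq]
  ring

/-- The first component of `y` in the rotating plane. -/
def rot₁ (F : CurveFrame n) (y : ℝ → Mink n) (t : ℝ) : ℝ :=
  F.osc (F.planar₁ y t) (-F.planar₂ y t) t

/-- The second component of `y` in the rotating plane. -/
def rot₂ (F : CurveFrame n) (y : ℝ → Mink n) (t : ℝ) : ℝ :=
  F.osc (F.planar₂ y t) (F.planar₁ y t) t

lemma osc_rot₁ (t : ℝ) : F.osc (F.rot₁ y t) (F.rot₂ y t) t = F.planar₁ y t := by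
  simp only [rot₁, rot₂, osc]
  linear_combination F.planar₁ y t * Real.cos_sq_add_sin_sq (F.freq * Real.log t)

lemma osc_rot₂ (t : ℝ) : F.osc (F.rot₂ y t) (-F.rot₁ y t) t = F.planar₂ y t := by
  simp only [rot₁, rot₂, osc]
  linear_combination F.planar₂ y t * Real.cos_sq_add_sin_sq (F.freq * Real.log t)

/-- Rotating the plane back by the angle `freq` · log t cancels the terms with `freq`/t. -/
lemma IsSol.hasDerivAt_rot₁ (hy : F.IsSol y) {t : ℝ} (ht : t ∈ Ioc 0 F.d) :
    HasDerivAt (F.rot₁ y) (F.osc (-F.axialRate y t) (F.planarRate y t) t) t := by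
  have hθ := hasDerivAt_angle (F := F) ht.1
  have h : HasDerivAt (F.rot₁ y) _ t := ((hy.hasDerivAt_planar₁ ht).mul hθ.cos).add
    ((hy.hasDerivAt_planar₂ ht).neg.mul hθ.sin)
  refine h.congr_deriv ?_
  simp only [osc, Pi.neg_apply]
  ring

lemma IsSol.hasDerivAt_rot₂ (hy : F.IsSol y) {t : ℝ} (ht : t ∈ Ioc 0 F.d) :
    HasDerivAt (F.rot₂ y) (F.osc (-F.planarRate y t) (-F.axialRate y t) t) t := by
  have hθ := hasDerivAt_angle (F := F) ht.1
  have h : HasDerivAt (F.rot₂ y) _ t := ((hy.hasDerivAt_planar₂ ht).mul hθ.cos).add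
    ((hy.hasDerivAt_planar₁ ht).mul hθ.sin)
  refine h.congr_deriv ?_
  simp only [osc]
  ring

lemma form_C_div (t : ℝ) : form n (F.C t) (y t) / t =
    F.axial y t + F.osc (F.rot₁ y t) (F.rot₂ y t) t := by
  rw [osc_rot₁, planar₁]; ring

lemma form_T_eq (t : ℝ) : form n (F.T t) (y t) =
    F.axial y t + F.osc (F.rot₁ y t) (F.rot₂ y t) t +
      F.freq * F.osc (F.rot₂ y t) (-F.rot₁ y t) t := by
  rw [osc_rot₁, osc_rot₂, planar₁, planar₂]
  have := F.freq_pos.ne'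
  field_simp
  ring

lemma mul_form_N (t : ℝ) : t * form n (F.N t) (y t) = F.freq ^ 2 * F.axial y t -
    F.μ₀ * (form n (F.C t) (y t) / t) + form n (F.T t) (y t) := by
  rw [axial, mul_div_cancel₀ _ (pow_ne_zero 2 F.freq_pos.ne')]
  ring

/-- The slowly varying components of `y`. -/
def slow (F : CurveFrame n) (y : ℝ → Mink n) (t : ℝ) : ℝ × ℝ × ℝ × Mink n :=
  (F.axial y t, F.rot₁ y t, F.rot₂ y t, F.ν y t)

lemma abs_le_of_norm_prod_le {E : Type*} [NormedAddCommGroup E] {a b c B : ℝ} {v : E}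
    (h : ‖(a, b, c, v)‖ ≤ B) : |a| ≤ B ∧ |b| ≤ B ∧ |c| ≤ B ∧ ‖v‖ ≤ B := by
  simpa only [Prod.norm_mk, sup_le_iff, Real.norm_eq_abs] using h

/-- All remaining rates are linear in the slow variables with bounded coefficients: the only
quotient by t left is (μ - μ₀)/t, bounded by M. Hence `exists_limit_of_norm_deriv_le` applies. -/
lemma IsSol.exists_slow_limit (hy : F.IsSol y) : ∃ X₀ : ℝ × ℝ × ℝ × Mink n, ∃ B ≥ 0,
    ∀ t ∈ Ioc 0 F.d, ‖F.slow y t - X₀‖ ≤ B * t := by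
  have hω := F.freq_pos
  have hM := F.M_nonneg
  set w := F.freq with hw
  set M := F.M with hMdef
  -- A and R bound `axialRate` and `planarRate` relative to the size S of the slow variables. The
  -- numbers come from |⟨C,y⟩/t| ≤ 3S, |⟨C,y⟩/t - ⟨T,y⟩| ≤ 2wS and |⟨T,y⟩| ≤ (3 + 2w)S.
  set A := (M * (2 * w) + (3 * M + M * (3 + 2 * w)) + 3 * M) / w ^ 2 with hA
  set R := (3 * M + 3 * M) / w with hR
  have hA0 : 0 ≤ A := by positivity
  have hR0 : 0 ≤ R := by positivity
  refine exists_limit_of_norm_deriv_le (L := A + R + 3 * M * M + 3 * M) F.d_pos (by positivity)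
    (fun t ht => (hy.hasDerivAt_axial ht).prodMk
      ((hy.hasDerivAt_rot₁ ht).prodMk ((hy.hasDerivAt_rot₂ ht).prodMk (hy.hasDerivAt_ν ht))))
    (fun t ht => ?_)
  set S := ‖F.slow y t‖ with hS
  have hS0 : 0 ≤ S := norm_nonneg _
  obtain ⟨hx0, hx1, hx2, hx3⟩ := abs_le_of_norm_prod_le (le_of_eq hS.symm)
  have ht0 := ht.1
  have ht1 : t ≤ 1 := ht.2.trans F.d_le
  have hp1 : |F.osc (F.rot₁ y t) (F.rot₂ y t) t| ≤ 2 * S :=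
    (abs_osc_le _ _ _).trans (by linarith)
  have hp2 : |F.osc (F.rot₂ y t) (-F.rot₁ y t) t| ≤ 2 * S :=
    (abs_osc_le _ _ _).trans (by rw [abs_neg]; linarith)
  have hα : |form n (F.C t) (y t) / t| ≤ 3 * S := by
    rw [form_C_div]
    exact (abs_add_le _ _).trans (by linarith)
  have hβα : |form n (F.C t) (y t) / t - form n (F.T t) (y t)| ≤ 2 * w * S := by
    rw [form_C_div, form_T_eq, sub_add_cancel_left, abs_neg, abs_mul, abs_of_pos hω]
    nlinarith
  have hβ : |form n (F.T t) (y t)| ≤ (3 + 2 * w) * S := by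
    rw [form_T_eq]
    refine (abs_add_le _ _).trans ?_
    rw [← form_C_div, abs_mul, abs_of_pos hω]
    nlinarith
  have ha : |form n (F.C t) (y t)| ≤ 3 * S := by
    rw [abs_div, abs_of_pos ht0, div_le_iff₀ ht0] at hα
    exact hα.trans (by nlinarith)
  have hKν : |form n (F.K t) (F.ν y t)| ≤ 3 * M * S := by
    refine (abs_form_le _ _).trans ?_
    have := F.norm_K_le t ht
    gcongr
  have hμ : |(F.μ t - F.μ₀) / t| ≤ M := by
    rw [abs_div, abs_of_pos ht0, div_le_iff₀ ht0]
    exact F.abs_μ_sub_le t ht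
  have hq := F.abs_q_le t ht
  have hqa : |F.q t * form n (F.C t) (y t)| ≤ M * (3 * S) := by
    rw [abs_mul]; exact mul_le_mul hq ha (abs_nonneg _) hM
  have hAS : A * S = (M * (2 * w) + (3 * M + M * (3 + 2 * w)) + 3 * M) * S / w ^ 2 := by
    rw [hA]; ring
  have hRS : R * S = (3 * M + 3 * M) * S / w := by rw [hR]; ring
  have hax : |F.axialRate y t| ≤ A * S := by
    rw [axialRate, abs_div, abs_of_pos (by positivity : 0 < F.freq ^ 2), hAS]
    refine div_le_div_of_nonneg_right ?_ (sq_nonneg w)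
    have e1 : |(F.μ t - F.μ₀) / t * (form n (F.C t) (y t) / t - form n (F.T t) (y t))| ≤
        M * (2 * w * S) := by
      rw [abs_mul]; exact mul_le_mul hμ hβα (abs_nonneg _) hM
    have e2 : |t * (form n (F.K t) (F.ν y t) - F.q t * form n (F.T t) (y t))| ≤
        3 * M * S + M * ((3 + 2 * w) * S) := by
      rw [abs_mul, abs_of_pos ht0]
      have : |form n (F.K t) (F.ν y t) - F.q t * form n (F.T t) (y t)| ≤
          3 * M * S + M * ((3 + 2 * w) * S) := by
        refine (abs_sub _ _).trans (add_le_add hKν ?_)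
        rw [abs_mul]; exact mul_le_mul hq hβ (abs_nonneg _) hM
      exact (mul_le_of_le_one_left (abs_nonneg _) ht1).trans this
    refine (abs_add_le _ _).trans ((add_le_add_left (abs_add_le _ _) _).trans ?_)
    linarith
  have hpl : |F.planarRate y t| ≤ R * S := by
    rw [planarRate, abs_div, abs_of_pos (hω : 0 < F.freq), hRS]
    refine div_le_div_of_nonneg_right ?_ hω.le
    have e1 : |(F.μ t - F.μ₀) / t * (form n (F.C t) (y t) / t)| ≤ M * (3 * S) := by
      rw [abs_mul]; exact mul_le_mul hμ hα (abs_nonneg _) hM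
    exact (abs_add_le _ _).trans (by linarith)
  have hMS : 0 ≤ M * S := mul_nonneg hM hS0
  have hMMS : 0 ≤ M * M * S := by positivity
  have hAS0 : 0 ≤ A * S := mul_nonneg hA0 hS0
  have hRS0 : 0 ≤ R * S := mul_nonneg hR0 hS0
  change _ ≤ (A + R + 3 * M * M + 3 * M) * S
  rw [show (A + R + 3 * M * M + 3 * M) * S = A * S + R * S + 3 * (M * M * S) + 3 * (M * S) by ring]
  simp only [Prod.norm_mk, sup_le_iff, Real.norm_eq_abs]
  refine ⟨by linarith, (abs_osc_le _ _ _).trans ?_, (abs_osc_le _ _ _).trans ?_,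
    (norm_add_le _ _).trans ?_⟩
  · rw [abs_neg]; linarith
  · rw [abs_neg, abs_neg]; linarith
  · rw [norm_smul, norm_smul, Real.norm_eq_abs, Real.norm_eq_abs]
    have e1 : |form n (F.K t) (F.ν y t)| * ‖F.C t‖ ≤ 3 * M * S * M :=
      mul_le_mul hKν (F.norm_C_le t (Ioc_subset_Icc_self ht)) (norm_nonneg _) (by positivity)
    have e2 : |form n (F.C t) (y t)| * ‖F.K t‖ ≤ 3 * S * M :=
      mul_le_mul ha (F.norm_K_le t ht) (norm_nonneg _) (by positivity)
    linarith

end CurveFrame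

/-! ### The Minkowski form in the slow variables and the limit map -/

namespace CurveFrame

variable {F : CurveFrame n} {y z : ℝ → Mink n}

/-- The form pairs ⟨C,·⟩ with ⟨N,·⟩, so the weights 1/t and t cancel and the identity is exact. The
passage to slow variables diagonalizes the form and the back rotation is orthogonal. -/
lemma form_eq_slow {t : ℝ} (ht : t ∈ Ioc 0 F.d) (y z : ℝ → Mink n) : form n (y t) (z t) =
    F.freq ^ 2 * (-(F.axial y t * F.axial z t) + F.rot₁ y t * F.rot₁ z t +
      F.rot₂ y t * F.rot₂ z t) + form n (F.ν y t) (F.ν z t) := by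
  rw [form_eq (Ioc_subset_Icc_self ht) y z]
  have e (x : ℝ → Mink n) : form n (F.C t) (x t) = t * (form n (F.C t) (x t) / t) := by
    rw [mul_div_cancel₀ _ ht.1.ne']
  have h1 : form n (F.C t) (y t) * form n (F.N t) (z t) =
      form n (F.C t) (y t) / t * (t * form n (F.N t) (z t)) := by
    rw [e y]; field_simp
  have h2 : form n (F.N t) (y t) * form n (F.C t) (z t) =
      form n (F.C t) (z t) / t * (t * form n (F.N t) (y t)) := by
    rw [e z]; field_simp
  have h3 : F.rot₁ y t * F.rot₁ z t + F.rot₂ y t * F.rot₂ z t =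
      F.osc (F.rot₁ y t) (F.rot₂ y t) t * F.osc (F.rot₁ z t) (F.rot₂ z t) t +
      F.osc (F.rot₂ y t) (-F.rot₁ y t) t * F.osc (F.rot₂ z t) (-F.rot₁ z t) t := by
    simp only [osc]
    linear_combination (-(F.rot₁ y t * F.rot₁ z t + F.rot₂ y t * F.rot₂ z t)) *
      Real.cos_sq_add_sin_sq (F.freq * Real.log t)
  rw [h1, h2, add_assoc (-(F.axial y t * F.axial z t)), h3, mul_form_N, mul_form_N, form_T_eq,
    form_T_eq, form_C_div, form_C_div]
  have := F.freq_sq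
  generalize F.osc (F.rot₁ y t) (F.rot₂ y t) t = p₁
  generalize F.osc (F.rot₁ z t) (F.rot₂ z t) t = p₂
  generalize F.osc (F.rot₂ y t) (-F.rot₁ y t) t = r₁
  generalize F.osc (F.rot₂ z t) (-F.rot₁ z t) t = r₂
  rw [show F.μ₀ = (F.freq ^ 2 + 1) / 2 by linarith]
  ring

lemma slow_add (t : ℝ) : F.slow (fun s => y s + z s) t = F.slow y t + F.slow z t := by
  simp only [slow, rot₁, rot₂, planar₁, planar₂, axial, ν, normalPart, osc, map_add, Prod.mk_add_mk,
    Prod.mk.injEq]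
  refine ⟨by ring, by ring, by ring, by module⟩

lemma slow_smul (a t : ℝ) : F.slow (fun s => a • y s) t = a • F.slow y t := by
  simp only [slow, rot₁, rot₂, planar₁, planar₂, axial, ν, normalPart, osc, map_smul, Prod.smul_mk,
    smul_eq_mul, Prod.mk.injEq]
  refine ⟨by ring, by ring, by ring, by module⟩

/-- The slow components of `y` converge to `X₀` at a linear rate. -/
def HasLimit (F : CurveFrame n) (y : ℝ → Mink n) (X₀ : ℝ × ℝ × ℝ × Mink n) : Prop :=
  ∃ B ≥ 0, ∀ t ∈ Ioc 0 F.d, ‖F.slow y t - X₀‖ ≤ B * t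

lemma eventually_mem (F : CurveFrame n) : ∀ᶠ t in 𝓝[>] (0 : ℝ), t ∈ Ioc 0 F.d :=
  Ioc_mem_nhdsGT F.d_pos

lemma tendsto_mul_id {l : Filter ℝ} (hl : l ≤ 𝓝[>] 0) (B : ℝ) :
    Tendsto (fun t => B * t) l (𝓝 0) := by
  have : Tendsto (fun t : ℝ => B * t) (𝓝 0) (𝓝 (B * 0)) := tendsto_id.const_mul _
  rw [mul_zero] at this
  exact this.mono_left (hl.trans nhdsWithin_le_nhds)

lemma tendsto_frame (F : CurveFrame n) : Tendsto F.C (𝓝[>] 0) (𝓝 (F.C 0)) ∧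
    Tendsto F.T (𝓝[>] 0) (𝓝 (F.T 0)) ∧ Tendsto F.N (𝓝[>] 0) (𝓝 (F.N 0)) := by
  have key : ∀ {V : ℝ → Mink n}, (∀ t ∈ Ioc 0 F.d, ‖V t - V 0‖ ≤ F.M * t) →
      Tendsto V (𝓝[>] 0) (𝓝 (V 0)) := fun {V} hV => by
    rw [tendsto_iff_norm_sub_tendsto_zero]
    refine squeeze_zero' (Eventually.of_forall fun _ => norm_nonneg _)
      (F.eventually_mem.mono hV) (tendsto_mul_id le_rfl F.M)
  exact ⟨key F.norm_C_sub_le, key F.norm_T_sub_le, key F.norm_N_sub_le⟩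

lemma HasLimit.tendsto {X₀ : ℝ × ℝ × ℝ × Mink n} (h : F.HasLimit y X₀) :
    Tendsto (F.slow y) (𝓝[>] 0) (𝓝 X₀) := by
  obtain ⟨B, -, hB⟩ := h
  rw [tendsto_iff_norm_sub_tendsto_zero]
  refine squeeze_zero' (Eventually.of_forall fun _ => norm_nonneg _)
    (F.eventually_mem.mono fun t ht => hB t ht) (tendsto_mul_id le_rfl B)

variable {G : ℝ → lorentz n}

/-- The slow variables are linear in the solution and solutions are linear in x; uniqueness of
limits transfers this to the limit. -/
lemma exists_linear_limit (hG : ∀ x, F.IsSol (fun t => ((G t)⁻¹).1 x)) :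
    ∃ Λ : Mink n →ₗ[ℝ] ℝ × ℝ × ℝ × Mink n, ∀ x, F.HasLimit (fun t => ((G t)⁻¹).1 x) (Λ x) := by
  have h : ∀ x, ∃ X₀, F.HasLimit (fun t => ((G t)⁻¹).1 x) X₀ := fun x => (hG x).exists_slow_limit
  choose Λ hΛ using h
  refine ⟨⟨⟨Λ, fun x z => ?_⟩, fun a x => ?_⟩, hΛ⟩
  · refine tendsto_nhds_unique (hΛ (x + z)).tendsto ?_
    refine ((hΛ x).tendsto.add (hΛ z).tendsto).congr fun t => ?_
    simp only [map_add, slow_add]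
  · refine tendsto_nhds_unique (hΛ (a • x)).tendsto ?_
    refine ((hΛ x).tendsto.const_smul a).congr fun t => ?_
    simp only [map_smul, slow_smul]

end CurveFrame

/-- The linear algebra of the limit circle: the vectors `X i` dual to the limit functionals span a
Minkowski space, which is the kernel of the normal part. -/
lemma gram_of_form_eq {w : ℝ} {X₀ X₁ X₂ : Mink n} {ν : Mink n →ₗ[ℝ] Mink n}
    (hform : ∀ x z, form n x z = w ^ 2 * (-(form n X₀ x * form n X₀ z) + form n X₁ x * form n X₁ z +
      form n X₂ x * form n X₂ z) + form n (ν x) (ν z))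
    (hν : ∀ x, 0 ≤ form n (ν x) (ν x) ∧ (form n (ν x) (ν x) = 0 → ν x = 0))
    (hnull : ∀ θ : ℝ, form n (X₀ + Real.cos θ • X₁ + Real.sin θ • X₂)
      (X₀ + Real.cos θ • X₁ + Real.sin θ • X₂) = 0) :
    w ^ 2 * form n X₀ X₀ = -1 ∧ w ^ 2 * form n X₁ X₁ = 1 ∧ w ^ 2 * form n X₂ X₂ = 1 ∧
      form n X₀ X₁ = 0 ∧ form n X₀ X₂ = 0 ∧ form n X₁ X₂ = 0 ∧ ν X₀ = 0 ∧ ν X₁ = 0 ∧ ν X₂ = 0 := by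
  have c10 := form_comm X₁ X₀
  have c20 := form_comm X₂ X₀
  have c21 := form_comm X₂ X₁
  have E : ∀ θ : ℝ, form n X₀ X₀ + 2 * Real.cos θ * form n X₀ X₁ + 2 * Real.sin θ * form n X₀ X₂ +
      Real.cos θ ^ 2 * form n X₁ X₁ + Real.sin θ ^ 2 * form n X₂ X₂ +
      2 * Real.cos θ * Real.sin θ * form n X₁ X₂ = 0 := fun θ => by
    have := hnull θ
    simp only [map_add, map_smul, LinearMap.add_apply, LinearMap.smul_apply, smul_eq_mul, c10, c20,
      c21] at this
    linear_combination this
  -- A trigonometric polynomial vanishing at these five angles has coefficients making the Gram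
  -- matrix equal to diag(m, -m, -m).
  have E0 := E 0
  have E1 := E Real.pi
  have E2 := E (Real.pi / 2)
  have E3 := E (-(Real.pi / 2))
  have E4 := E (Real.pi / 4)
  simp only [Real.cos_zero, Real.sin_zero, Real.cos_pi, Real.sin_pi, Real.cos_pi_div_two,
    Real.sin_pi_div_two, Real.cos_neg, Real.sin_neg, Real.cos_pi_div_four,
    Real.sin_pi_div_four] at E0 E1 E2 E3 E4
  have h01 : form n X₀ X₁ = 0 := by linarith
  have h02 : form n X₀ X₂ = 0 := by linarith
  have h11 : form n X₁ X₁ = -form n X₀ X₀ := by linarith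
  have h22 : form n X₂ X₂ = -form n X₀ X₀ := by linarith
  have hs : (√2 / 2 : ℝ) ^ 2 = 1 / 2 := by
    rw [div_pow, Real.sq_sqrt (by norm_num)]; norm_num
  have h12 : form n X₁ X₂ = 0 := by
    rw [h01, h02, h11, h22] at E4
    have e : 2 * (√2 / 2) * (√2 / 2) * form n X₁ X₂ = 2 * (√2 / 2 : ℝ) ^ 2 * form n X₁ X₂ := by ring
    rw [e, hs] at E4
    linarith
  have n0 := hform X₀ X₀
  have n1 := hform X₁ X₁
  have n2 := hform X₂ X₂
  rw [c10, c20, h01, h02] at n0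
  rw [h01, c21, h12, h11] at n1
  rw [h02, h12, h22] at n2
  set m := form n X₀ X₀
  have p0 := hν X₀
  have p1 := hν X₁
  have p2 := hν X₂
  -- `hform` at X₀ and X₁ gives m + w²m² = ⟨νX₀,νX₀⟩ ≥ 0 and -(m + w²m²) = ⟨νX₁,νX₁⟩ ≥ 0. Both
  -- vanish, and with them νX₀, νX₁ and likewise νX₂.
  have hm : m = -(w ^ 2 * m ^ 2) := by linarith [p0.1, p1.1]
  have z0 := p0.2 (by linear_combination hm - n0)
  have z1 := p1.2 (by linear_combination -hm - n1)
  have z2 := p2.2 (by linear_combination -hm - n2)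
  -- If m = 0 then `hform` makes every Xᵢ orthogonal to everything, hence zero. The form would
  -- reduce to ⟨νx, νx⟩ ≥ 0, contradicting the existence of a timelike vector.
  have hm0 : m ≠ 0 := by
    intro hm0
    have v0 : X₀ = 0 := eq_of_forall_form_eq fun x => by
      rw [hform X₀ x, c10, c20, h01, h02, z0]
      simp [show form n X₀ X₀ = 0 from hm0]
    have v1 : X₁ = 0 := eq_of_forall_form_eq fun x => by
      rw [hform X₁ x, c21, h01, h12, h11, z1]
      simp [hm0]
    have v2 : X₂ = 0 := eq_of_forall_form_eq fun x => by
      rw [hform X₂ x, h02, h12, h22, z2]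
      simp [hm0]
    have := hform (EuclideanSpace.single 0 1) (EuclideanSpace.single 0 1)
    rw [v0, v1, v2] at this
    have h1 : form n (EuclideanSpace.single 0 1) (EuclideanSpace.single 0 1) = -1 := by
      rw [form_eq_inner]; simp; norm_num
    simp only [map_zero, LinearMap.zero_apply] at this
    have := (hν (EuclideanSpace.single 0 1)).1
    linarith
  have hm1 : w ^ 2 * m = -1 := by
    have : m * (w ^ 2 * m + 1) = 0 := by linear_combination hm
    rcases mul_eq_zero.1 this with h | h
    · exact absurd h hm0
    · linarith
  exact ⟨hm1, by rw [h11]; linarith, by rw [h22]; linarith, h01, h02, h12, z0, z1, z2⟩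

/-! ### Limit points of the Calapso transform -/

namespace CurveFrame

variable {F : CurveFrame n} {G : ℝ → lorentz n}

/-- Parameters tending to `0` at which the angle `freq * log t` is a given one modulo `2π`. -/
def angleSeq (F : CurveFrame n) (θ : ℝ) (j : ℕ) : ℝ := Real.exp ((θ - j * (2 * Real.pi)) / F.freq)

lemma freq_mul_log_angleSeq (θ : ℝ) (j : ℕ) :
    F.freq * Real.log (F.angleSeq θ j) = θ - j * (2 * Real.pi) := by
  rw [angleSeq, Real.log_exp, mul_div_cancel₀ _ F.freq_pos.ne']

lemma osc_angleSeq (k₁ k₂ θ : ℝ) (j : ℕ) :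
    F.osc k₁ k₂ (F.angleSeq θ j) = k₁ * Real.cos θ + k₂ * Real.sin θ := by
  rw [osc, freq_mul_log_angleSeq, Real.cos_sub_nat_mul_two_pi, Real.sin_sub_nat_mul_two_pi]

lemma tendsto_angleSeq (θ : ℝ) : Tendsto (F.angleSeq θ) atTop (𝓝[>] 0) := by
  refine tendsto_nhdsWithin_iff.2 ⟨?_, Eventually.of_forall fun j => Real.exp_pos _⟩
  refine Real.tendsto_exp_atBot.comp ?_
  refine Tendsto.atBot_div_const F.freq_pos ?_
  have h : Tendsto (fun j : ℕ => (j : ℝ) * (2 * Real.pi)) atTop atTop :=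
    tendsto_natCast_atTop_atTop.atTop_mul_const (by positivity)
  simpa [sub_eq_add_neg] using
    tendsto_atBot_add_const_left _ θ (tendsto_neg_atTop_atBot.comp h)

variable {Λ : Mink n →ₗ[ℝ] ℝ × ℝ × ℝ × Mink n}

/-- Along the sequence the oscillating angle is fixed modulo 2π, so ⟨Γ C/t, x⟩ = ⟨C, Γ⁻¹x⟩/t
converges for every x. This shows that every point of the circle is a limit point. -/
lemma tendsto_calapso_angleSeq (hΛ : ∀ x, F.HasLimit (fun t => ((G t)⁻¹).1 x) (Λ x))
    {X₀ X₁ X₂ : Mink n} (h₀ : ∀ x, (Λ x).1 = form n X₀ x)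
    (h₁ : ∀ x, (Λ x).2.1 = form n X₁ x) (h₂ : ∀ x, (Λ x).2.2.1 = form n X₂ x) (θ : ℝ) :
    Tendsto (fun j => (F.angleSeq θ j)⁻¹ • (G (F.angleSeq θ j)).1 (F.C (F.angleSeq θ j))) atTop
      (𝓝 (X₀ + Real.cos θ • X₁ + Real.sin θ • X₂)) := by
  refine tendsto_of_forall_form fun x => ?_
  have h := (hΛ x).tendsto.comp (tendsto_angleSeq (F := F) θ)
  have l := (h.fst_nhds).add (((h.snd_nhds.fst_nhds).mul_const (Real.cos θ)).add
    ((h.snd_nhds.snd_nhds.fst_nhds).mul_const (Real.sin θ)))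
  have e : form n (X₀ + Real.cos θ • X₁ + Real.sin θ • X₂) x =
      (Λ x).1 + ((Λ x).2.1 * Real.cos θ + (Λ x).2.2.1 * Real.sin θ) := by
    rw [h₀, h₁, h₂]
    simp only [map_add, map_smul, LinearMap.add_apply, LinearMap.smul_apply, smul_eq_mul]
    ring
  rw [e]
  refine l.congr fun j => ?_
  simp only [Function.comp, slow]
  rw [← osc_angleSeq (F := F) _ _ θ j, ← form_C_div, map_smul, LinearMap.smul_apply, smul_eq_mul,
    form_apply_left, div_eq_inv_mul]

/-- The full asymptotics, not only along sequences of fixed angle: it excludes limit points off the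
circle. -/
lemma tendsto_calapso_sub (hΛ : ∀ x, F.HasLimit (fun t => ((G t)⁻¹).1 x) (Λ x))
    {X₀ X₁ X₂ : Mink n} (h₀ : ∀ x, (Λ x).1 = form n X₀ x)
    (h₁ : ∀ x, (Λ x).2.1 = form n X₁ x) (h₂ : ∀ x, (Λ x).2.2.1 = form n X₂ x) :
    Tendsto (fun t => t⁻¹ • (G t).1 (F.C t) - (X₀ + Real.cos (F.freq * Real.log t) • X₁ +
      Real.sin (F.freq * Real.log t) • X₂)) (𝓝[>] 0) (𝓝 0) := by
  refine tendsto_of_forall_form fun x => ?_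
  have h := (hΛ x).tendsto
  have l0 : Tendsto (fun t => F.axial (fun t => ((G t)⁻¹).1 x) t - (Λ x).1) (𝓝[>] 0) (𝓝 0) := by
    simpa [slow] using h.fst_nhds.sub_const (Λ x).1
  have l1 : Tendsto (fun t => F.rot₁ (fun t => ((G t)⁻¹).1 x) t - (Λ x).2.1) (𝓝[>] 0) (𝓝 0) := by
    simpa [slow] using h.snd_nhds.fst_nhds.sub_const (Λ x).2.1
  have l2 : Tendsto (fun t => F.rot₂ (fun t => ((G t)⁻¹).1 x) t - (Λ x).2.2.1) (𝓝[>] 0) (𝓝 0) := by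
    simpa [slow] using h.snd_nhds.snd_nhds.fst_nhds.sub_const (Λ x).2.2.1
  have l3 : Tendsto (fun t => F.osc (F.rot₁ (fun t => ((G t)⁻¹).1 x) t - (Λ x).2.1)
      (F.rot₂ (fun t => ((G t)⁻¹).1 x) t - (Λ x).2.2.1) t) (𝓝[>] 0) (𝓝 0) := by
    refine squeeze_zero_norm (fun t => abs_osc_le _ _ t) ?_
    simpa using l1.abs.add l2.abs
  have l4 := l0.add l3
  rw [add_zero] at l4
  rw [map_zero, LinearMap.zero_apply]
  refine l4.congr fun t => ?_
  rw [← osc_sub]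
  have e : form n (t⁻¹ • (G t).1 (F.C t)) x = F.axial (fun t => ((G t)⁻¹).1 x) t +
      F.osc (F.rot₁ (fun t => ((G t)⁻¹).1 x) t) (F.rot₂ (fun t => ((G t)⁻¹).1 x) t) t := by
    rw [← form_C_div, map_smul, LinearMap.smul_apply, smul_eq_mul, form_apply_left,
      div_eq_inv_mul]
  rw [map_sub, LinearMap.sub_apply, e, h₀, h₁, h₂, osc]
  simp only [map_add, map_smul, LinearMap.add_apply, LinearMap.smul_apply, smul_eq_mul, osc]
  ring

/-- Γ⁻¹ preserves the form, so the form of two solutions is constant in t, and `form_eq_slow` passes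
to the limit. -/
lemma form_limit_eq (hΛ : ∀ x, F.HasLimit (fun t => ((G t)⁻¹).1 x) (Λ x)) (x z : Mink n) :
    form n x z = F.freq ^ 2 * (-((Λ x).1 * (Λ z).1) + (Λ x).2.1 * (Λ z).2.1 +
      (Λ x).2.2.1 * (Λ z).2.2.1) + form n (Λ x).2.2.2 (Λ z).2.2.2 := by
  have hx := (hΛ x).tendsto
  have hz := (hΛ z).tendsto
  have l := ((((hx.fst_nhds.mul hz.fst_nhds).neg.add
    (hx.snd_nhds.fst_nhds.mul hz.snd_nhds.fst_nhds)).add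
    (hx.snd_nhds.snd_nhds.fst_nhds.mul hz.snd_nhds.snd_nhds.fst_nhds)).const_mul (F.freq ^ 2)).add
    (hx.snd_nhds.snd_nhds.snd_nhds.form hz.snd_nhds.snd_nhds.snd_nhds)
  refine tendsto_nhds_unique (tendsto_const_nhds.congr' ?_) l
  filter_upwards [F.eventually_mem] with t ht
  simp only [slow]
  have := form_eq_slow ht (fun t => ((G t)⁻¹).1 x) (fun t => ((G t)⁻¹).1 z)
  rw [← this]
  exact ((G t)⁻¹.2 x z).symm

lemma form_limit_normal (hΛ : ∀ x, F.HasLimit (fun t => ((G t)⁻¹).1 x) (Λ x))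
    (x : Mink n) : form n (F.C 0) (Λ x).2.2.2 = 0 ∧
    form n (F.T 0) (Λ x).2.2.2 = 0 ∧ form n (F.N 0) (Λ x).2.2.2 = 0 := by
  have hν : Tendsto (F.ν (fun t => ((G t)⁻¹).1 x)) (𝓝[>] 0) (𝓝 (Λ x).2.2.2) :=
    (hΛ x).tendsto.snd_nhds.snd_nhds.snd_nhds
  obtain ⟨hC, hT, hN⟩ := F.tendsto_frame
  have hp : ∀ t ∈ Ioc 0 F.d, _ := fun t ht =>
    (F.frame t (Ioc_subset_Icc_self ht)).form_normalPart (((G t)⁻¹).1 x)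
  refine ⟨?_, ?_, ?_⟩
  · refine tendsto_nhds_unique (hC.form hν) (tendsto_const_nhds.congr' ?_)
    exact F.eventually_mem.mono fun t ht => (hp t ht).1.symm
  · refine tendsto_nhds_unique (hT.form hν) (tendsto_const_nhds.congr' ?_)
    exact F.eventually_mem.mono fun t ht => (hp t ht).2.1.symm
  · refine tendsto_nhds_unique (hN.form hν) (tendsto_const_nhds.congr' ?_)
    exact F.eventually_mem.mono fun t ht => (hp t ht).2.2.symm

/-- The limit of the normal part is orthogonal to C(0) + N(0), which is timelike of square -2. -/
lemma form_limit_normal_self (hΛ : ∀ x, F.HasLimit (fun t => ((G t)⁻¹).1 x) (Λ x))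
    (x : Mink n) : 0 ≤ form n (Λ x).2.2.2 (Λ x).2.2.2 ∧
    (form n (Λ x).2.2.2 (Λ x).2.2.2 = 0 → (Λ x).2.2.2 = 0) := by
  obtain ⟨h1, -, h3⟩ := form_limit_normal hΛ x
  have h := F.frame 0 (left_mem_Icc.2 F.d_pos.le)
  refine form_self_of_orthogonal_timelike (τ := F.C 0 + F.N 0) ?_ ?_
  · simp [h.CC, h.CN, h.NN, form_comm (F.N 0) (F.C 0)]
  · simp [h1, h3]

end CurveFrame

end Mink

lemma exists_cos_sin_eq {a b : ℝ} (h : a ^ 2 + b ^ 2 = 1) :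
    ∃ θ : ℝ, Real.cos θ = a ∧ Real.sin θ = b := by
  have hn : ‖(⟨a, b⟩ : ℂ)‖ = 1 := by
    rw [← sq_eq_sq₀ (norm_nonneg _) zero_le_one, Complex.sq_norm, Complex.normSq_mk]
    linarith
  have h0 : (⟨a, b⟩ : ℂ) ≠ 0 := by
    rw [← norm_ne_zero_iff, hn]; exact one_ne_zero
  refine ⟨Complex.arg ⟨a, b⟩, ?_, ?_⟩
  · rw [Complex.cos_arg h0, hn]; simp
  · rw [Complex.sin_arg, hn]; simp

namespace Mink

variable {n : ℕ}

namespace CurveFrame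

variable {F : CurveFrame n} {G : ℝ → lorentz n}

/-- The Calapso transform has a limit circle, given by the initial values for which the normal part
of the solution of the Darboux equation tends to `0`. -/
theorem exists_limitCircle (hG : ∀ x, F.IsSol (fun t => ((G t)⁻¹).1 x)) {L : ℝ → LightCone n}
    (hL : ∀ t ∈ Ioc 0 F.d, ∃ a : ℝ, a ≠ 0 ∧ (L t).1 = a • (G t).1 (F.C t)) :
    ∃ W : Submodule ℝ (Mink n), Module.finrank ℝ W = 3 ∧ (∃ τ ∈ W, form n τ τ < 0) ∧
      limitSet (fun t => span (L t)) = pointsOf W ∧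
      ∃ Λ : Mink n →ₗ[ℝ] ℝ × ℝ × ℝ × Mink n,
        (∀ x, F.HasLimit (fun t => ((G t)⁻¹).1 x) (Λ x)) ∧ ∀ x, x ∈ W ↔ (Λ x).2.2.2 = 0 := by
  obtain ⟨Λ, hΛ⟩ := exists_linear_limit hG
  obtain ⟨X₀, h₀⟩ := exists_form_eq ((LinearMap.fst ℝ _ _).comp Λ)
  obtain ⟨X₁, h₁⟩ := exists_form_eq ((LinearMap.fst ℝ _ _).comp ((LinearMap.snd ℝ _ _).comp Λ))
  obtain ⟨X₂, h₂⟩ := exists_form_eq ((LinearMap.fst ℝ _ _).comp ((LinearMap.snd ℝ _ _).comp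
    ((LinearMap.snd ℝ _ _).comp Λ)))
  set ν : Mink n →ₗ[ℝ] Mink n := (LinearMap.snd ℝ _ _).comp ((LinearMap.snd ℝ _ _).comp
    ((LinearMap.snd ℝ _ _).comp Λ)) with hν
  replace h₀ : ∀ x, (Λ x).1 = form n X₀ x := h₀
  replace h₁ : ∀ x, (Λ x).2.1 = form n X₁ x := h₁
  replace h₂ : ∀ x, (Λ x).2.2.1 = form n X₂ x := h₂
  have hform : ∀ x z, form n x z = F.freq ^ 2 * (-(form n X₀ x * form n X₀ z) +
      form n X₁ x * form n X₁ z + form n X₂ x * form n X₂ z) + form n (ν x) (ν z) := fun x z => by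
    have := form_limit_eq hΛ x z
    rwa [h₀, h₁, h₂, h₀, h₁, h₂] at this
  have hseq := tendsto_calapso_angleSeq hΛ h₀ h₁ h₂
  have hmem : ∀ θ, ∀ᶠ j in atTop, F.angleSeq θ j ∈ Ioc 0 F.d := fun θ =>
    (tendsto_angleSeq θ).eventually F.eventually_mem
  have hnull : ∀ θ : ℝ, form n (X₀ + Real.cos θ • X₁ + Real.sin θ • X₂)
      (X₀ + Real.cos θ • X₁ + Real.sin θ • X₂) = 0 := fun θ => by
    refine tendsto_nhds_unique ((hseq θ).form (hseq θ)) (tendsto_const_nhds.congr' ?_)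
    filter_upwards [hmem θ] with j hj
    have h := (G (F.angleSeq θ j)).2 (F.C (F.angleSeq θ j)) (F.C (F.angleSeq θ j))
    rw [(F.frame _ (Ioc_subset_Icc_self hj)).CC] at h
    simp [h]
  obtain ⟨g00, g11, g22, g01, g02, g12, z0, z1, z2⟩ :=
    gram_of_form_eq hform (form_limit_normal_self hΛ) hnull
  have g10 := (form_comm X₁ X₀).trans g01
  have g20 := (form_comm X₂ X₀).trans g02
  have g21 := (form_comm X₂ X₁).trans g12
  have hf2 : 0 < F.freq ^ 2 := pow_pos F.freq_pos 2
  have hg00 : form n X₀ X₀ < 0 := by nlinarith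
  set W := Submodule.span ℝ {X₀, X₁, X₂} with hW
  have m0 : X₀ ∈ W := Submodule.subset_span (by simp)
  have m1 : X₁ ∈ W := Submodule.subset_span (by simp)
  have m2 : X₂ ∈ W := Submodule.subset_span (by simp)
  -- The orthogonal projection along W: the vectors `freq` · Xᵢ are pseudo-orthonormal in W.
  let π : Mink n →L[ℝ] Mink n := LinearMap.toContinuousLinearMap (LinearMap.id + F.freq ^ 2 •
    ((form n X₀).smulRight X₀ - (form n X₁).smulRight X₁ - (form n X₂).smulRight X₂))
  have hπ : ∀ x, π x = x + F.freq ^ 2 •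
    (form n X₀ x • X₀ - form n X₁ x • X₁ - form n X₂ x • X₂) := fun x => rfl
  have hπ0 : ∀ x, π x = 0 ↔ x ∈ W := by
    refine fun x => ⟨fun h => ?_, fun h => ?_⟩
    · rw [hπ] at h
      rw [eq_neg_of_add_eq_zero_left h]
      exact W.neg_mem (W.smul_mem _ (W.sub_mem (W.sub_mem (W.smul_mem _ m0) (W.smul_mem _ m1))
        (W.smul_mem _ m2)))
    · obtain ⟨a, b, c, rfl⟩ := Submodule.mem_span_triple.1 h
      rw [hπ]
      simp only [map_add, map_smul, smul_eq_mul, g01, g02, g12, g10, g20, g21, mul_zero, add_zero,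
        zero_add]
      have e0 : F.freq ^ 2 * (a * form n X₀ X₀) = -a := by linear_combination a * g00
      have e1 : F.freq ^ 2 * (b * form n X₁ X₁) = b := by linear_combination b * g11
      have e2 : F.freq ^ 2 * (c * form n X₂ X₂) = c := by linear_combination c * g22
      rw [smul_sub, smul_sub, smul_smul, smul_smul, smul_smul, e0, e1, e2]
      module
  have hν0 : ∀ x, x ∈ W ↔ ν x = 0 := by
    refine fun x => ⟨fun h => ?_, fun h => (hπ0 x).1 ?_⟩
    · obtain ⟨a, b, c, rfl⟩ := Submodule.mem_span_triple.1 h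
      simp [z0, z1, z2]
    -- Here π x is killed by ν and by all three functionals ⟨Xᵢ, ·⟩, so `hform` makes it orthogonal
    -- to every vector.
    · have e : ν (π x) = 0 := by rw [hπ]; simp [z0, z1, z2, h]
      have e0 : form n X₀ (π x) = 0 := by
        rw [hπ]
        simp only [map_add, map_sub, map_smul, smul_eq_mul, g01, g02]
        linear_combination form n X₀ x * g00
      have e1 : form n X₁ (π x) = 0 := by
        rw [hπ]
        simp only [map_add, map_sub, map_smul, smul_eq_mul, g10, g12]
        linear_combination -form n X₁ x * g11
      have e2 : form n X₂ (π x) = 0 := by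
        rw [hπ]
        simp only [map_add, map_sub, map_smul, smul_eq_mul, g20, g21]
        linear_combination -form n X₂ x * g22
      refine eq_of_forall_form_eq fun z => ?_
      rw [hform, e, e0, e1, e2]
      simp
  refine ⟨W, ?_, ⟨X₀, m0, hg00⟩, ?_, Λ, hΛ, hν0⟩
  · have hli : LinearIndependent ℝ ![X₀, X₁, X₂] := by
      rw [Fintype.linearIndependent_iff]
      intro g hg
      simp only [Fin.sum_univ_three, Matrix.cons_val_zero, Matrix.cons_val_one,
        Matrix.cons_val_two, Matrix.head_cons, Matrix.tail_cons] at hg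
      have k0 := congrArg (fun v => F.freq ^ 2 * form n X₀ v) hg
      have k1 := congrArg (fun v => F.freq ^ 2 * form n X₁ v) hg
      have k2 := congrArg (fun v => F.freq ^ 2 * form n X₂ v) hg
      simp only [map_add, map_smul, smul_eq_mul, g01, g02, g12, g10, g20, g21, map_zero, mul_zero,
        add_zero, zero_add] at k0 k1 k2
      intro i
      fin_cases i
      · change g 0 = 0; linear_combination g 0 * g00 - k0
      · change g 1 = 0; linear_combination k1 - g 1 * g11
      · change g 2 = 0; linear_combination k2 - g 2 * g22
    have := finrank_span_eq_card hli
    rw [show range ![X₀, X₁, X₂] = {X₀, X₁, X₂} by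
      ext v; simp [eq_comm]; tauto] at this
    simpa using this
  · ext P
    refine ⟨fun hP => mem_pointsOf_of_mapClusterPt hπ0 ?_ hP, fun hP => ?_⟩
    · have hsub := tendsto_calapso_sub hΛ h₀ h₁ h₂
      have hπX : ∀ θ : ℝ, π (X₀ + Real.cos θ • X₁ + Real.sin θ • X₂) = 0 := fun θ => (hπ0 _).2
        (W.add_mem (W.add_mem m0 (W.smul_mem _ m1)) (W.smul_mem _ m2))
      have t1 : Tendsto (fun t => ‖π (t⁻¹ • (G t).1 (F.C t))‖) (𝓝[>] 0) (𝓝 0) := by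
        have := ((π.continuous.tendsto 0).comp hsub).norm
        rw [map_zero, norm_zero] at this
        refine this.congr fun t => ?_
        rw [Function.comp_apply, map_sub, hπX, sub_zero]
      have t2 : Tendsto (fun t => form n X₀ (t⁻¹ • (G t).1 (F.C t))) (𝓝[>] 0)
          (𝓝 (form n X₀ X₀)) := by
        have := ((tendsto_const_nhds (x := X₀)).form hsub).add_const (form n X₀ X₀)
        rw [map_zero, zero_add] at this
        refine this.congr fun t => ?_
        simp only [map_sub, map_add, map_smul, g01, g02, smul_eq_mul]
        ring
      -- The factor bounds 1/‖V‖ for V = Γ C/t: eventually ⟨X₀,V⟩ < ⟨X₀,X₀⟩/2 < 0, while |⟨X₀,V⟩| ≤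
      -- 3‖X₀‖‖V‖.
      have t3 := t1.mul_const (3 * ‖X₀‖ / (-form n X₀ X₀ / 2))
      rw [zero_mul] at t3
      refine squeeze_zero' (Eventually.of_forall fun _ => ratio_nonneg _ _) ?_ t3
      filter_upwards [F.eventually_mem,
        t2.eventually_lt_const (show form n X₀ X₀ < form n X₀ X₀ / 2 by linarith)] with t ht hlt
      obtain ⟨a, ha, hLt⟩ := hL t ht
      have hLt' : (L t).1 = (a * t) • (t⁻¹ • (G t).1 (F.C t)) := by
        rw [hLt, smul_smul, mul_assoc, mul_inv_cancel₀ ht.1.ne', mul_one]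
      rw [ratio_span, hLt', map_smul, norm_smul, norm_smul,
        mul_div_mul_left _ _ (norm_ne_zero_iff.2 (mul_ne_zero ha ht.1.ne'))]
      set V := t⁻¹ • (G t).1 (F.C t)
      have hb := (abs_le.1 (abs_form_le X₀ V)).1
      have hV0 : 0 < ‖V‖ := by
        rw [norm_pos_iff]
        rintro hV
        rw [hV, map_zero] at hlt
        linarith
      rw [div_eq_mul_inv]
      refine mul_le_mul_of_nonneg_left ?_ (norm_nonneg _)
      rw [inv_eq_one_div, div_le_div_iff₀ hV0 (by linarith)]
      linarith
    · obtain ⟨z, rfl, hz⟩ := hP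
      obtain ⟨a, b, c, habc⟩ := Submodule.mem_span_triple.1 hz
      have hnz := z.2.2
      rw [← habc] at hnz
      simp only [map_add, map_smul, LinearMap.add_apply, LinearMap.smul_apply, smul_eq_mul, g01,
        g02, g12, g10, g20, g21, mul_zero, add_zero, zero_add] at hnz
      -- A null vector of W is a nonzero multiple of X₀ + cos θ X₁ + sin θ X₂ for some θ, which is
      -- the limit along the corresponding `angleSeq`.
      have hq : b ^ 2 + c ^ 2 = a ^ 2 := by
        linear_combination F.freq ^ 2 * hnz - a ^ 2 * g00 - b ^ 2 * g11 - c ^ 2 * g22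
      have ha : a ≠ 0 := by
        rintro rfl
        have hb : b = 0 := by nlinarith
        have hc : c = 0 := by nlinarith
        refine z.2.1 ?_
        rw [← habc, hb, hc]; simp
      obtain ⟨θ, hcos, hsin⟩ := exists_cos_sin_eq (a := b / a) (b := c / a) (by
        field_simp; exact hq)
      have hzθ : z.1 = a • (X₀ + Real.cos θ • X₁ + Real.sin θ • X₂) := by
        rw [← habc, hcos, hsin, smul_add, smul_add, smul_smul, smul_smul, mul_div_cancel₀ _ ha,
          mul_div_cancel₀ _ ha]
      choose! r hr0 hr using hL
      refine MapClusterPt.of_comp (tendsto_angleSeq (F := F) θ) (Tendsto.mapClusterPt ?_)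
      refine tendsto_span (s := fun j => a * ((F.angleSeq θ j)⁻¹ * (r (F.angleSeq θ j))⁻¹)) ?_ ?_
      · filter_upwards [hmem θ] with j hj
        exact mul_ne_zero ha (mul_ne_zero (inv_ne_zero hj.1.ne') (inv_ne_zero (hr0 _ hj)))
      · rw [hzθ]
        refine ((hseq θ).const_smul a).congr' ?_
        filter_upwards [hmem θ] with j hj
        rw [hr _ hj, smul_smul, smul_smul, mul_assoc, mul_assoc, inv_mul_cancel₀ (hr0 _ hj),
          mul_one]

end CurveFrame

/-! ### Convergence to the base point and to the osculating space -/

namespace CurveFrame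

variable {F : CurveFrame n} {y : ℝ → Mink n} {X₀ : ℝ × ℝ × ℝ × Mink n}

lemma μ₀_pos (F : CurveFrame n) : 0 < F.μ₀ := by linarith [F.one_lt]

lemma HasLimit.exists_bound (h : F.HasLimit y X₀) : ∃ B ≥ 0, ∀ t ∈ Ioc 0 F.d,
    |form n (F.C t) (y t)| ≤ B * t ∧ |form n (F.T t) (y t)| ≤ B ∧
      |t * form n (F.N t) (y t)| ≤ B ∧ ‖F.ν y t‖ ≤ B := by
  obtain ⟨B, hB0, hB⟩ := h
  have hω := F.freq_pos
  have hμ := F.μ₀_pos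
  set S := ‖X₀‖ + B with hS
  have hS0 : 0 ≤ S := by positivity
  refine ⟨F.freq ^ 2 * S + F.μ₀ * (3 * S) + (3 + 2 * F.freq) * S, by positivity, fun t ht => ?_⟩
  have ht0 := ht.1
  have ht1 : t ≤ 1 := ht.2.trans F.d_le
  have hs : ‖F.slow y t‖ ≤ S := by
    have := norm_le_norm_add_norm_sub' (F.slow y t) X₀
    have := hB t ht
    nlinarith
  obtain ⟨hx0, hx1, hx2, hx3⟩ := abs_le_of_norm_prod_le hs
  have hp1 : |F.osc (F.rot₁ y t) (F.rot₂ y t) t| ≤ 2 * S :=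
    (abs_osc_le _ _ _).trans (by linarith)
  have hp2 : |F.osc (F.rot₂ y t) (-F.rot₁ y t) t| ≤ 2 * S :=
    (abs_osc_le _ _ _).trans (by rw [abs_neg]; linarith)
  have hα : |form n (F.C t) (y t) / t| ≤ 3 * S := by
    rw [form_C_div]
    exact (abs_add_le _ _).trans (by linarith)
  have hβ : |form n (F.T t) (y t)| ≤ (3 + 2 * F.freq) * S := by
    rw [form_T_eq]
    refine (abs_add_le _ _).trans ?_
    rw [← form_C_div, abs_mul, abs_of_pos hω]
    nlinarith
  have hγ : |t * form n (F.N t) (y t)| ≤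
      F.freq ^ 2 * S + F.μ₀ * (3 * S) + (3 + 2 * F.freq) * S := by
    rw [mul_form_N]
    refine (abs_add_le _ _).trans (add_le_add ((abs_sub _ _).trans (add_le_add ?_ ?_)) hβ)
    · rw [abs_mul, abs_of_pos (by positivity : 0 < F.freq ^ 2)]; gcongr
    · rw [abs_mul, abs_of_pos hμ]; gcongr
  have h1 : 0 ≤ F.freq ^ 2 * S := by positivity
  have h2 : 0 ≤ F.μ₀ * (3 * S) := by positivity
  have h3 : 0 ≤ F.freq * S := by positivity
  refine ⟨?_, by linarith, hγ, by linarith⟩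
  rw [abs_div, abs_of_pos ht0, div_le_iff₀ ht0] at hα
  exact hα.trans (mul_le_mul_of_nonneg_right (by linarith) ht0.le)

/-- A solution is close to the initial point of the curve where the component along the curve
dominates. -/
lemma HasLimit.tendsto_C (h : F.HasLimit y X₀) {l : Filter ℝ} (hl : l ≤ 𝓝[>] 0) {g : ℝ}
    (hg : 0 < g) (hw : ∀ᶠ t in l, g ≤ |t * form n (F.N t) (y t)|) :
    Tendsto (fun t => (-(form n (F.N t) (y t))⁻¹) • y t) l (𝓝 (F.C 0)) ∧
      ∀ᶠ t in l, form n (F.N t) (y t) ≠ 0 := by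
  obtain ⟨B, hB0, hB⟩ := h.exists_bound
  have hne : ∀ᶠ t in l, form n (F.N t) (y t) ≠ 0 := hw.mono fun t ht h0 => by
    rw [h0, mul_zero, abs_zero] at ht
    linarith
  refine ⟨?_, hne⟩
  have key : Tendsto (fun t => (-(form n (F.N t) (y t))⁻¹) • y t - F.C t) l (𝓝 0) := by
    refine squeeze_zero_norm' ?_ (tendsto_mul_id hl (1 / g * (B * F.M + B * F.M + B)))
    filter_upwards [hw, hne, hl F.eventually_mem] with t hgt hne ht
    obtain ⟨ha, hu, -, hν⟩ := hB t ht
    have hicc := Ioc_subset_Icc_self ht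
    have ht1 : t ≤ 1 := ht.2.trans F.d_le
    -- Apart from its C-component, y stays bounded, while the hypothesis makes |⟨N,y⟩| at least g/t;
    -- division leaves an error O(t).
    have e : (-(form n (F.N t) (y t))⁻¹) • y t - F.C t = (-(form n (F.N t) (y t))⁻¹) •
        (form n (F.T t) (y t) • F.T t - form n (F.C t) (y t) • F.N t + F.ν y t) := by
      have e' : form n (F.T t) (y t) • F.T t - form n (F.C t) (y t) • F.N t + F.ν y t =
          y t + form n (F.N t) (y t) • F.C t := by rw [ν, normalPart]; module
      rw [e', smul_add, smul_smul, neg_mul, inv_mul_cancel₀ hne]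
      module
    rw [e, norm_smul, norm_neg, norm_inv, Real.norm_eq_abs]
    have h1 : |form n (F.N t) (y t)|⁻¹ ≤ 1 / g * t := by
      rw [abs_mul, abs_of_pos ht.1] at hgt
      rw [inv_le_comm₀ (abs_pos.2 hne) (by have := ht.1; positivity)]
      rw [one_div, mul_inv, inv_inv, ← div_eq_mul_inv, div_le_iff₀ ht.1]
      linarith
    have h2 : ‖form n (F.T t) (y t) • F.T t - form n (F.C t) (y t) • F.N t + F.ν y t‖ ≤
        B * F.M + B * F.M + B := by
      refine (norm_add_le _ _).trans (add_le_add ((norm_sub_le _ _).trans (add_le_add ?_ ?_)) hν)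
      · rw [norm_smul, Real.norm_eq_abs]
        exact mul_le_mul hu (F.norm_T_le t hicc) (norm_nonneg _) hB0
      · rw [norm_smul, Real.norm_eq_abs]
        exact mul_le_mul (ha.trans (mul_le_of_le_one_right hB0 ht1)) (F.norm_N_le t hicc)
          (norm_nonneg _) hB0
    calc |form n (F.N t) (y t)|⁻¹ * _ ≤ (1 / g * t) * (B * F.M + B * F.M + B) :=
          mul_le_mul h1 h2 (norm_nonneg _) (by have := ht.1; positivity)
      _ = _ := by ring
  simpa using key.add (F.tendsto_frame.1.mono_left hl)

lemma two_mul_eq {t : ℝ} (ht : t ∈ Ioc 0 F.d) (hnull : form n (y t) (y t) = 0) :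
    2 * (form n (F.C t) (y t) * form n (F.N t) (y t)) =
      form n (F.T t) (y t) ^ 2 + form n (F.ν y t) (F.ν y t) := by
  have := form_eq (Ioc_subset_Icc_self ht) y y
  rw [hnull] at this
  linear_combination this

/-- A null solution with nonvanishing normal part tends to the initial point of the curve. -/
lemma HasLimit.tendsto_C_of_normal_pos (h : F.HasLimit y X₀)
    (hnull : ∀ t ∈ Ioc 0 F.d, form n (y t) (y t) = 0) (hν : 0 < form n X₀.2.2.2 X₀.2.2.2) :
    Tendsto (fun t => (-(form n (F.N t) (y t))⁻¹) • y t) (𝓝[>] 0) (𝓝 (F.C 0)) ∧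
      ∀ᶠ t in 𝓝[>] 0, form n (F.N t) (y t) ≠ 0 := by
  obtain ⟨B, hB0, hB⟩ := h.exists_bound
  set η := form n X₀.2.2.2 X₀.2.2.2
  have hν' : Tendsto (F.ν y) (𝓝[>] 0) (𝓝 X₀.2.2.2) := h.tendsto.snd_nhds.snd_nhds.snd_nhds
  -- By nullity 2⟨C,y⟩⟨N,y⟩ ≥ ⟨ν,ν⟩ > η/2, and |⟨C,y⟩| ≤ Bt, so Bt|⟨N,y⟩| > η/4. The summand 1
  -- avoids dividing by B = 0.
  refine h.tendsto_C le_rfl (g := η / 4 / (B + 1)) (by positivity) ?_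
  filter_upwards [(hν'.form hν').eventually_const_lt (show η / 2 < η by linarith),
    F.eventually_mem] with t h1 ht
  obtain ⟨ha, -⟩ := hB t ht
  have h2 := two_mul_eq ht (hnull t ht)
  have ht0 := ht.1
  rw [div_le_iff₀ (by positivity), abs_mul, abs_of_pos ht0]
  have h3 : form n (F.C t) (y t) * form n (F.N t) (y t) ≤ B * t * |form n (F.N t) (y t)| := by
    refine (le_abs_self _).trans ?_
    rw [abs_mul]
    exact mul_le_mul_of_nonneg_right ha (abs_nonneg _)
  have h4 : 0 ≤ t * |form n (F.N t) (y t)| := by positivity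
  nlinarith [sq_nonneg (form n (F.T t) (y t))]

end CurveFrame

lemma abs_form_le_of_norm_le {x z : Mink n} {M : ℝ} (h : ‖x‖ ≤ M) :
    |form n x z| ≤ 3 * M * ‖z‖ :=
  (abs_form_le x z).trans (by gcongr)

namespace CurveFrame

variable {F : CurveFrame n} {y : ℝ → Mink n} {X₀ : ℝ × ℝ × ℝ × Mink n}

/-- Since ν = O(t) and ⟨C,y⟩ = O(t), the equation gives ν' = O(t). Integrating from 0, where ν tends
to 0, gains another power of t. -/
lemma HasLimit.norm_ν_le (h : F.HasLimit y X₀) (hy : F.IsSol y) (h0 : X₀.2.2.2 = 0) :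
    ∃ B ≥ 0, ∀ t ∈ Ioc 0 F.d, ‖F.ν y t‖ ≤ B * t ^ 2 := by
  obtain ⟨B, hB0, hB⟩ := h.exists_bound
  obtain ⟨D, hD0, hD⟩ := h
  have hM := F.M_nonneg
  have hν : ∀ t ∈ Ioc 0 F.d, ‖F.ν y t‖ ≤ D * t := fun t ht => by
    have := (abs_le_of_norm_prod_le (hD t ht)).2.2.2
    simpa [slow, h0] using this
  have hlim : Tendsto (F.ν y) (𝓝[>] 0) (𝓝 0) :=
    squeeze_zero_norm' (F.eventually_mem.mono hν) (tendsto_mul_id le_rfl D)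
  set L := 3 * F.M * D * F.M + B * F.M with hL
  have hL0 : 0 ≤ L := by positivity
  refine ⟨L, hL0, fun t ht => ?_⟩
  have h1 : Tendsto (fun s => ‖F.ν y t - F.ν y s‖) (𝓝[>] 0) (𝓝 ‖F.ν y t‖) := by
    simpa using ((tendsto_const_nhds (x := F.ν y t)).sub hlim).norm
  refine le_of_tendsto h1 ?_
  filter_upwards [Ioo_mem_nhdsGT ht.1] with s hs
  have hsub : ∀ r ∈ Icc s t, r ∈ Ioc 0 F.d := fun r hr =>
    ⟨hs.1.trans_le hr.1, hr.2.trans ht.2⟩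
  have := (convex_Icc s t).norm_image_sub_le_of_norm_hasDerivWithin_le (C := L * t)
    (fun r hr => (hy.hasDerivAt_ν (hsub r hr)).hasDerivWithinAt) (fun r hr => ?_)
    (left_mem_Icc.2 hs.2.le) (right_mem_Icc.2 hs.2.le)
  · refine this.trans ?_
    rw [Real.norm_eq_abs, abs_of_pos (by linarith [hs.2]), pow_two, ← mul_assoc]
    exact mul_le_mul_of_nonneg_left (by linarith [hs.1]) (mul_nonneg hL0 ht.1.le)
  · have hr' := hsub r hr
    obtain ⟨ha, -⟩ := hB r hr'
    refine (norm_add_le _ _).trans ?_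
    rw [norm_smul, norm_smul, Real.norm_eq_abs, Real.norm_eq_abs]
    have e1 : |form n (F.K r) (F.ν y r)| * ‖F.C r‖ ≤ 3 * F.M * (D * r) * F.M := by
      refine mul_le_mul ((abs_form_le_of_norm_le (F.norm_K_le r hr')).trans ?_)
        (F.norm_C_le r (Ioc_subset_Icc_self hr')) (norm_nonneg _) ?_
      · have := hν r hr'
        gcongr
      · have := hr'.1
        positivity
    have e2 : |form n (F.C r) (y r)| * ‖F.K r‖ ≤ B * r * F.M :=
      mul_le_mul ha (F.norm_K_le r hr') (norm_nonneg _) (mul_nonneg hB0 hr'.1.le)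
    calc _ ≤ 3 * F.M * (D * r) * F.M + B * r * F.M := add_le_add e1 e2
      _ = L * r := by rw [hL]; ring
      _ ≤ L * t := mul_le_mul_of_nonneg_left hr.2 hL0

/-- t · `axial` is a combination of components of y with bounded coefficients, and `axial` has a
nonzero limit. So y cannot decay faster than t, and O(t²) is small relative to ‖y‖. -/
lemma HasLimit.le_norm (h : F.HasLimit y X₀) (hk : X₀.1 ≠ 0) :
    ∃ B ≥ 0, ∀ᶠ t in 𝓝[>] 0, t ≤ B * ‖y t‖ := by
  have hM := F.M_nonneg
  have hμ := F.μ₀_pos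
  have hω : 0 < F.freq ^ 2 := pow_pos F.freq_pos 2
  have hax : Tendsto (F.axial y) (𝓝[>] 0) (𝓝 X₀.1) := h.tendsto.fst_nhds
  have hk' : 0 < |X₀.1| := abs_pos.2 hk
  refine ⟨(F.μ₀ + 2) * (3 * F.M) / F.freq ^ 2 / (|X₀.1| / 2), by positivity, ?_⟩
  filter_upwards [hax.abs.eventually_const_lt (show |X₀.1| / 2 < |X₀.1| by linarith),
    F.eventually_mem] with t h1 ht
  have hicc := Ioc_subset_Icc_self ht
  have ht0 := ht.1
  have ht1 : t ≤ 1 := ht.2.trans F.d_le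
  have ha := abs_form_le_of_norm_le (z := y t) (F.norm_C_le t hicc)
  have hu := abs_form_le_of_norm_le (z := y t) (F.norm_T_le t hicc)
  have hw := abs_form_le_of_norm_le (z := y t) (F.norm_N_le t hicc)
  set S := 3 * F.M * ‖y t‖ with hS
  have hS0 : 0 ≤ S := by positivity
  have e : t * F.axial y t = (F.μ₀ * form n (F.C t) (y t) + t ^ 2 * form n (F.N t) (y t) -
      t * form n (F.T t) (y t)) / F.freq ^ 2 := by
    rw [axial]; field_simp
  have h2 : |F.μ₀ * form n (F.C t) (y t) + t ^ 2 * form n (F.N t) (y t) -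
      t * form n (F.T t) (y t)| ≤ (F.μ₀ + 2) * S := by
    have e1 : |F.μ₀ * form n (F.C t) (y t)| ≤ F.μ₀ * S := by
      rw [abs_mul, abs_of_pos hμ]; gcongr
    have e2 : |t ^ 2 * form n (F.N t) (y t)| ≤ S := by
      rw [abs_mul, abs_of_pos (pow_pos ht0 2)]
      exact (mul_le_of_le_one_left (abs_nonneg _) (pow_le_one₀ ht0.le ht1)).trans hw
    have e3 : |t * form n (F.T t) (y t)| ≤ S := by
      rw [abs_mul, abs_of_pos ht0]
      exact (mul_le_of_le_one_left (abs_nonneg _) ht1).trans hu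
    refine (abs_sub _ _).trans ((add_le_add (abs_add_le _ _) le_rfl).trans ?_)
    linarith
  have h3 : t * (|X₀.1| / 2) ≤ (F.μ₀ + 2) * S / F.freq ^ 2 := by
    calc t * (|X₀.1| / 2) ≤ t * |F.axial y t| := mul_le_mul_of_nonneg_left h1.le ht0.le
      _ = |t * F.axial y t| := by rw [abs_mul, abs_of_pos ht0]
      _ ≤ _ := by
        rw [e, abs_div, abs_of_pos hω]
        exact div_le_div_of_nonneg_right h2 hω.le
  rw [← le_div_iff₀ (by positivity)] at h3
  refine h3.trans_eq ?_
  rw [hS]; ring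

lemma norm_form_smul_sub_le {v v₀ z : Mink n} {u u₀ : Mink n} {M s : ℝ}
    (hu : ‖u‖ ≤ M) (hv₀ : ‖v₀‖ ≤ M) (hvs : ‖v - v₀‖ ≤ M * s) (hus : ‖u - u₀‖ ≤ M * s) :
    ‖form n u₀ z • v₀ - form n u z • v‖ ≤ 6 * M * M * s * ‖z‖ := by
  have e : form n u₀ z • v₀ - form n u z • v = -(form n (u - u₀) z • v₀ + form n u z • (v - v₀)) := by
    rw [map_sub, LinearMap.sub_apply]; module
  have hM : 0 ≤ M := (norm_nonneg _).trans hu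
  rw [e, norm_neg]
  refine (norm_add_le _ _).trans ?_
  rw [norm_smul, norm_smul, Real.norm_eq_abs, Real.norm_eq_abs]
  have hMs : 0 ≤ M * s := (norm_nonneg _).trans hvs
  have e1 : |form n (u - u₀) z| * ‖v₀‖ ≤ 3 * (M * s) * ‖z‖ * M :=
    mul_le_mul (abs_form_le_of_norm_le hus) hv₀ (norm_nonneg _) (by positivity)
  have e2 : |form n u z| * ‖v - v₀‖ ≤ 3 * M * ‖z‖ * (M * s) :=
    mul_le_mul (abs_form_le_of_norm_le hu) hvs (norm_nonneg _) (by positivity)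
  linarith

/-- Where the normal part vanishes in the limit, the solution approaches the osculating space. -/
lemma HasLimit.exists_tangential_bound (h : F.HasLimit y X₀) (hy : F.IsSol y)
    (h0 : X₀.2.2.2 = 0) (hk : X₀.1 ≠ 0) : ∃ B ≥ 0, ∀ᶠ t in 𝓝[>] 0, t ∈ Ioc 0 F.d ∧
      t ≤ B * ‖y t‖ ∧ ‖F.ν y t‖ ≤ B * t ^ 2 ∧ ‖F.ν y t‖ ≤ B * t * ‖y t‖ ∧
      ‖normalPart (F.C 0) (F.T 0) (F.N 0) (y t)‖ ≤ B * t * ‖y t‖ := by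
  obtain ⟨B₁, hB₁, h₁⟩ := h.norm_ν_le hy h0
  obtain ⟨B₂, hB₂, h₂⟩ := h.le_norm hk
  have hM := F.M_nonneg
  refine ⟨B₁ + B₂ + B₁ * B₂ + 18 * F.M * F.M, by positivity, ?_⟩
  filter_upwards [F.eventually_mem, h₂] with t ht h₂
  have h₁ := h₁ t ht
  have ht0 := ht.1
  have hb12 : 0 ≤ B₁ * B₂ := by positivity
  have hMM : 0 ≤ F.M * F.M := by positivity
  have hn := norm_nonneg (y t)
  have h3 : ‖F.ν y t‖ ≤ B₁ * B₂ * t * ‖y t‖ := by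
    refine h₁.trans ?_
    calc B₁ * t ^ 2 = B₁ * t * t := by ring
      _ ≤ B₁ * t * (B₂ * ‖y t‖) := mul_le_mul_of_nonneg_left h₂ (by positivity)
      _ = _ := by ring
  refine ⟨ht, h₂.trans (mul_le_mul_of_nonneg_right (by linarith) hn),
    h₁.trans (mul_le_mul_of_nonneg_right (by linarith) (by positivity)),
    h3.trans ?_, ?_⟩
  · rw [mul_assoc (B₁ * B₂), mul_assoc _ t ‖y t‖]
    exact mul_le_mul_of_nonneg_right (by linarith) (mul_nonneg ht0.le hn)
  · have hicc := Ioc_subset_Icc_self ht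
    have h00 : (0 : ℝ) ∈ Icc 0 F.d := left_mem_Icc.2 F.d_pos.le
    -- Replacing the frame at t by the frame at 0 costs O(t)‖y‖, as the frame is Lipschitz.
    have e : normalPart (F.C 0) (F.T 0) (F.N 0) (y t) = F.ν y t +
        (form n (F.N 0) (y t) • F.C 0 - form n (F.N t) (y t) • F.C t) -
        (form n (F.T 0) (y t) • F.T 0 - form n (F.T t) (y t) • F.T t) +
        (form n (F.C 0) (y t) • F.N 0 - form n (F.C t) (y t) • F.N t) := by
      rw [ν, normalPart, normalPart]; module
    have e1 := norm_form_smul_sub_le (z := y t) (F.norm_N_le t hicc) (F.norm_C_le 0 h00)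
      (F.norm_C_sub_le t ht) (F.norm_N_sub_le t ht)
    have e2 := norm_form_smul_sub_le (z := y t) (F.norm_T_le t hicc) (F.norm_T_le 0 h00)
      (F.norm_T_sub_le t ht) (F.norm_T_sub_le t ht)
    have e3 := norm_form_smul_sub_le (z := y t) (F.norm_C_le t hicc) (F.norm_N_le 0 h00)
      (F.norm_N_sub_le t ht) (F.norm_C_sub_le t ht)
    rw [e]
    refine (norm_add_le _ _).trans ((add_le_add ((norm_sub_le _ _).trans
      (add_le_add (norm_add_le _ _) le_rfl)) le_rfl).trans ?_)
    have : 0 ≤ t * ‖y t‖ := by positivity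
    nlinarith

end CurveFrame

/-! ### Frames of the osculating space -/

lemma IsNullFrame.form_eq_of_mem {C T N v : Mink n} (h : IsNullFrame C T N)
    (hv : v ∈ Submodule.span ℝ {C, T, N}) (z : Mink n) : form n v z =
      -(form n C v * form n N z) - form n N v * form n C z + form n T v * form n T z := by
  obtain ⟨a, b, c, rfl⟩ := Submodule.mem_span_triple.1 hv
  simp only [map_add, map_smul, LinearMap.add_apply, LinearMap.smul_apply, smul_eq_mul, h.CC, h.CT,
    h.TT, h.CN, h.TN, h.NN, form_comm N C, form_comm T C, form_comm N T]
  ring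

lemma IsFrame.linearIndependent {W : Submodule ℝ (Mink n)} {τ e₁ e₂ : Mink n}
    (h : IsFrame W τ e₁ e₂) : LinearIndependent ℝ ![τ, e₁, e₂] := by
  rw [Fintype.linearIndependent_iff]
  intro g hg
  simp only [Fin.sum_univ_three, Matrix.cons_val_zero, Matrix.cons_val_one,
    Matrix.cons_val_two, Matrix.head_cons, Matrix.tail_cons] at hg
  have k0 := congrArg (fun v => form n τ v) hg
  have k1 := congrArg (fun v => form n e₁ v) hg
  have k2 := congrArg (fun v => form n e₂ v) hg
  simp only [map_add, map_smul, smul_eq_mul, h.form_τ, h.form_e₁, h.form_e₂, h.form_τ_e₁,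
    h.form_τ_e₂, h.form_e₁_e₂, form_comm e₁ τ, form_comm e₂ τ, form_comm e₂ e₁, map_zero, mul_zero,
    add_zero, zero_add] at k0 k1 k2
  intro i
  fin_cases i
  · change g 0 = 0; linarith
  · change g 1 = 0; linarith
  · change g 2 = 0; linarith

lemma IsFrame.span_eq {C T N τ e₁ e₂ : Mink n}
    (h : IsFrame (Submodule.span ℝ {C, T, N}) τ e₁ e₂) :
    Submodule.span ℝ {τ, e₁, e₂} = Submodule.span ℝ {C, T, N} := by
  classical
  have hr : range ![τ, e₁, e₂] = {τ, e₁, e₂} := by ext v; simp [eq_comm]; tauto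
  have h3 : Module.finrank ℝ (Submodule.span ℝ {τ, e₁, e₂}) = 3 := by
    have := finrank_span_eq_card h.linearIndependent
    rw [hr] at this
    simpa using this
  refine Submodule.eq_of_le_of_finrank_le ?_ ?_
  · rw [Submodule.span_le]
    rintro v (rfl | rfl | rfl)
    exacts [h.mem_τ, h.mem_e₁, h.mem_e₂]
  · rw [h3]
    have := finrank_span_finset_le_card (R := ℝ) ({C, T, N} : Finset (Mink n))
    simp only [Finset.coe_insert, Finset.coe_singleton] at this
    exact this.trans Finset.card_le_three

lemma IsFrame.form_eq_of_mem {W : Submodule ℝ (Mink n)} {τ e₁ e₂ v : Mink n}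
    (h : IsFrame W τ e₁ e₂) (hv : v ∈ Submodule.span ℝ {τ, e₁, e₂}) (z : Mink n) : form n v z =
      -(form n v τ * form n z τ) + form n v e₁ * form n z e₁ + form n v e₂ * form n z e₂ := by
  obtain ⟨a, b, c, rfl⟩ := Submodule.mem_span_triple.1 hv
  simp only [map_add, map_smul, LinearMap.add_apply, LinearMap.smul_apply, smul_eq_mul, h.form_τ,
    h.form_e₁, h.form_e₂, h.form_τ_e₁, h.form_τ_e₂, h.form_e₁_e₂, form_comm e₁ τ, form_comm e₂ τ,
    form_comm e₂ e₁, form_comm z]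
  ring

/-- The form on the osculating space in a null frame and in a pseudo-orthonormal frame. -/
lemma IsFrame.form_identity {C T N τ e₁ e₂ : Mink n} (hF : IsNullFrame C T N)
    (h : IsFrame (Submodule.span ℝ {C, T, N}) τ e₁ e₂) (x z : Mink n) :
    -(form n x τ * form n z τ) + form n x e₁ * form n z e₁ + form n x e₂ * form n z e₂ =
      -(form n C x * form n N z) - form n N x * form n C z + form n T x * form n T z := by
  set P : Mink n := -form n N z • C + form n T z • T - form n C z • N with hP
  have hPW : P ∈ Submodule.span ℝ {C, T, N} := by
    refine Submodule.sub_mem _ (Submodule.add_mem _ (Submodule.smul_mem _ _ ?_)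
      (Submodule.smul_mem _ _ ?_)) (Submodule.smul_mem _ _ ?_) <;>
    exact Submodule.subset_span (by simp)
  have hPv : ∀ v, form n P v =
      -(form n C v * form n N z) - form n N v * form n C z + form n T v * form n T z := fun v => by
    simp only [hP, map_add, map_sub, map_smul, LinearMap.add_apply, LinearMap.sub_apply,
      LinearMap.smul_apply, smul_eq_mul]
    ring
  have hPW' : ∀ v ∈ Submodule.span ℝ {C, T, N}, form n P v = form n z v := fun v hv => by
    rw [hPv, form_comm z, hF.form_eq_of_mem hv]
  rw [← hPv, h.form_eq_of_mem (by rw [h.span_eq]; exact hPW) x, hPW' _ h.mem_τ, hPW' _ h.mem_e₁,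
    hPW' _ h.mem_e₂]
  ring

/-! ### Definiteness of the angular velocity -/

/-- The area form of the plane spanned by `e₁` and `e₂`. -/
def area (e₁ e₂ x z : Mink n) : ℝ := form n x e₁ * form n z e₂ - form n x e₂ * form n z e₁

/-- The area of x, z is up to sign the volume of τ, x, z. So the three areas are, up to a common
sign, components of τ in the null frame, and the expression is ⟨τ,τ⟩. The computation uses
Lagrange's identity and the Gram relations. -/
lemma IsFrame.discriminant {C T N τ e₁ e₂ : Mink n} (hF : IsNullFrame C T N)
    (h : IsFrame (Submodule.span ℝ {C, T, N}) τ e₁ e₂) :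
    area e₁ e₂ N C ^ 2 - 2 * area e₁ e₂ C T * area e₁ e₂ T N = -1 := by
  have hCC := h.form_identity hF C C
  have hCT := h.form_identity hF C T
  have hTT := h.form_identity hF T T
  have hCN := h.form_identity hF C N
  have hTN := h.form_identity hF T N
  have hNN := h.form_identity hF N N
  have hττ := h.form_identity hF τ τ
  simp only [hF.CC, hF.CT, hF.TT, hF.CN, hF.TN, hF.NN, form_comm N C, form_comm T C,
    form_comm N T] at hCC hCT hTT hCN hTN hNN
  rw [h.form_τ, h.form_τ_e₁, h.form_τ_e₂] at hττ
  simp only [area]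
  set c0 := form n C τ
  set c1 := form n C e₁
  set c2 := form n C e₂
  set t0 := form n T τ
  set t1 := form n T e₁
  set t2 := form n T e₂
  set n0 := form n N τ
  set n1 := form n N e₁
  set n2 := form n N e₂
  have a1 : c1 ^ 2 + c2 ^ 2 = c0 ^ 2 := by linear_combination hCC
  have a2 : n1 ^ 2 + n2 ^ 2 = n0 ^ 2 := by linear_combination hNN
  have a3 : c1 * n1 + c2 * n2 = c0 * n0 - 1 := by linear_combination hCN
  have a4 : c1 * t1 + c2 * t2 = c0 * t0 := by linear_combination hCT
  have a5 : t1 * n1 + t2 * n2 = t0 * n0 := by linear_combination hTN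
  have a6 : t1 ^ 2 + t2 ^ 2 = 1 + t0 ^ 2 := by linear_combination hTT
  calc (n1 * c2 - n2 * c1) ^ 2 - 2 * (c1 * t2 - c2 * t1) * (t1 * n2 - t2 * n1)
      = (n1 ^ 2 + n2 ^ 2) * (c1 ^ 2 + c2 ^ 2) - (c1 * n1 + c2 * n2) ^ 2 -
        2 * ((c1 * t1 + c2 * t2) * (t1 * n1 + t2 * n2) -
          (c1 * n1 + c2 * n2) * (t1 ^ 2 + t2 ^ 2)) := by ring
    _ = -1 := by
      rw [a1, a2, a3, a4, a5, a6]
      linear_combination 2 * hττ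

lemma exists_quadratic_lower_bound {b₁ b₂ b₃ : ℝ} (h : b₃ ^ 2 - 2 * b₁ * b₂ = -1) :
    ∃ σ : ℝ, (σ = 1 ∨ σ = -1) ∧ ∃ m > 0, ∀ u a : ℝ,
      m * (u ^ 2 + a ^ 2) ≤ σ * (u ^ 2 / 2 * b₁ + a ^ 2 * b₂ + a * u * b₃) := by
  have hpos : 0 < b₁ * b₂ := by nlinarith [sq_nonneg b₃]
  obtain ⟨σ, hσ, h1, h2⟩ : ∃ σ : ℝ, (σ = 1 ∨ σ = -1) ∧ 0 < σ * b₁ ∧ 0 < σ * b₂ := by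
    rcases pos_and_pos_or_neg_and_neg_of_mul_pos hpos with ⟨h1, h2⟩ | ⟨h1, h2⟩
    · exact ⟨1, Or.inl rfl, by linarith, by linarith⟩
    · exact ⟨-1, Or.inr rfl, by linarith, by linarith⟩
  have hσ2 : σ ^ 2 = 1 := by rcases hσ with rfl | rfl <;> norm_num
  -- Completing the square in each variable, 2σb₁ times the form is at least a² and 4σb₂ times it is
  -- at least u²; the constant comes from adding the two.
  refine ⟨σ, hσ, 1 / (2 * (σ * b₁) + 4 * (σ * b₂)), by positivity, fun u a => ?_⟩
  rw [div_mul_eq_mul_div, div_le_iff₀ (by positivity), one_mul]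
  have e1 : (2 * (σ * b₁)) * (σ * (u ^ 2 / 2 * b₁ + a ^ 2 * b₂ + a * u * b₃)) =
      (b₁ * u + b₃ * a) ^ 2 + a ^ 2 := by
    linear_combination (2 * b₁ * (u ^ 2 / 2 * b₁ + a ^ 2 * b₂ + a * u * b₃)) * hσ2 - a ^ 2 * h
  have e2 : (4 * (σ * b₂)) * (σ * (u ^ 2 / 2 * b₁ + a ^ 2 * b₂ + a * u * b₃)) =
      (2 * b₂ * a + b₃ * u) ^ 2 + u ^ 2 := by
    linear_combination (4 * b₂ * (u ^ 2 / 2 * b₁ + a ^ 2 * b₂ + a * u * b₃)) * hσ2 - u ^ 2 * h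
  nlinarith [sq_nonneg (b₁ * u + b₃ * a), sq_nonneg (2 * b₂ * a + b₃ * u)]

/-- Half of the definite form pays for the errors: m/4 absorbs the O(t) change of the coefficients,
m/4 the cross terms with ν by the arithmetic–geometric inequality. What remains is of order t⁴. -/
lemma quadratic_perturbation {σ m E S B t u a r A1 A2 A3 B1 B2 B3 V1 V2 : ℝ}
    (hσ : σ = 1 ∨ σ = -1) (hm : 0 < m) (hE0 : 0 ≤ E) (ht0 : 0 < t)
    (hq : m * (u ^ 2 + a ^ 2) ≤ σ * (u ^ 2 / 2 * B1 + a ^ 2 * B2 + a * u * B3))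
    (hsm : 4 * E * t < m / 4) (c1 : |A1 - B1| ≤ 2 * E * t) (c2 : |A2 - B2| ≤ 2 * E * t)
    (c3 : |A3 - B3| ≤ 2 * E * t) (c4 : |A1| ≤ E) (c5 : |r| ≤ 3 * B ^ 2 * t ^ 4)
    (c6 : |V1| ≤ S * t ^ 2) (c7 : |V2| ≤ S * t ^ 2) :
    m / 2 * (u ^ 2 + a ^ 2) - (3 / 2 * B ^ 2 * E + 2 * S ^ 2 / m) * t ^ 4 ≤
      σ * (u ^ 2 / 2 * A1 + a ^ 2 * A2 + a * u * A3 - r / 2 * A1 + (a * V1 - u * V2)) := by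
  have habs : |σ| = 1 := by rcases hσ with rfl | rfl <;> simp
  have key : |σ * (u ^ 2 / 2 * (A1 - B1) + a ^ 2 * (A2 - B2) + a * u * (A3 - B3) - r / 2 * A1 +
      (a * V1 - u * V2))| ≤ u ^ 2 / 2 * (2 * E * t) + a ^ 2 * (2 * E * t) +
        |a| * |u| * (2 * E * t) + 3 * B ^ 2 * t ^ 4 / 2 * E + (|a| * (S * t ^ 2) +
        |u| * (S * t ^ 2)) := by
    rw [abs_mul, habs, one_mul]
    refine (abs_add_le _ _).trans (add_le_add ((abs_sub _ _).trans (add_le_add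
      ((abs_add_le _ _).trans (add_le_add ((abs_add_le _ _).trans (add_le_add ?_ ?_)) ?_)) ?_))
      ((abs_sub _ _).trans (add_le_add ?_ ?_)))
    · rw [abs_mul, abs_of_nonneg (by positivity : 0 ≤ u ^ 2 / 2)]; gcongr
    · rw [abs_mul, abs_of_nonneg (by positivity : 0 ≤ a ^ 2)]; gcongr
    · rw [abs_mul, abs_mul]; gcongr
    · rw [abs_mul, abs_div, abs_two]; gcongr
    · rw [abs_mul]; gcongr
    · rw [abs_mul]; gcongr
  have k1 := (abs_le.1 key).1
  have hu2 := sq_abs u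
  have ha2 := sq_abs a
  have amgm : ∀ x : ℝ, x * (S * t ^ 2) ≤ m / 4 * x ^ 2 + S ^ 2 / m * t ^ 4 := fun x => by
    have : m / 4 * x ^ 2 + S ^ 2 / m * t ^ 4 - x * (S * t ^ 2) =
        (m * x / 2 - S * t ^ 2) ^ 2 / m := by field_simp; ring
    have h2 : 0 ≤ (m * x / 2 - S * t ^ 2) ^ 2 / m := by positivity
    linarith
  have g1 := amgm |a|
  have g2 := amgm |u|
  rw [ha2] at g1
  rw [hu2] at g2
  have hEt : 0 ≤ E * t := by positivity
  have hau : |a| * |u| ≤ (u ^ 2 + a ^ 2) / 2 := by nlinarith [sq_nonneg (|a| - |u|)]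
  have g3 : u ^ 2 / 2 * (2 * E * t) + a ^ 2 * (2 * E * t) + |a| * |u| * (2 * E * t) ≤
      m / 4 * (u ^ 2 + a ^ 2) := by
    have : u ^ 2 / 2 + a ^ 2 + |a| * |u| ≤ 2 * (u ^ 2 + a ^ 2) := by
      linarith [sq_nonneg u, sq_nonneg a]
    calc _ = (u ^ 2 / 2 + a ^ 2 + |a| * |u|) * (2 * E * t) := by ring
      _ ≤ 2 * (u ^ 2 + a ^ 2) * (2 * E * t) := mul_le_mul_of_nonneg_right this (by linarith)
      _ = (u ^ 2 + a ^ 2) * (4 * E * t) := by ring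
      _ ≤ (u ^ 2 + a ^ 2) * (m / 4) := mul_le_mul_of_nonneg_left hsm.le (by positivity)
      _ = _ := by ring
  have e : σ * (u ^ 2 / 2 * A1 + a ^ 2 * A2 + a * u * A3 - r / 2 * A1 + (a * V1 - u * V2)) =
      σ * (u ^ 2 / 2 * B1 + a ^ 2 * B2 + a * u * B3) + σ * (u ^ 2 / 2 * (A1 - B1) +
        a ^ 2 * (A2 - B2) + a * u * (A3 - B3) - r / 2 * A1 + (a * V1 - u * V2)) := by ring
  rw [e]
  have e2 : (3 / 2 * B ^ 2 * E + 2 * S ^ 2 / m) * t ^ 4 =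
      3 * B ^ 2 * t ^ 4 / 2 * E + 2 * (S ^ 2 / m * t ^ 4) := by ring
  rw [e2]
  linarith

lemma abs_area_le (e₁ e₂ x z : Mink n) :
    |area e₁ e₂ x z| ≤ 18 * ‖e₁‖ * ‖e₂‖ * ‖x‖ * ‖z‖ := by
  have h (u v w r : Mink n) : |form n u v * form n w r| ≤ (3 * ‖u‖ * ‖v‖) * (3 * ‖w‖ * ‖r‖) := by
    rw [abs_mul]
    exact mul_le_mul (abs_form_le _ _) (abs_form_le _ _) (abs_nonneg _) (by positivity)
  refine (abs_sub _ _).trans ((add_le_add (h _ _ _ _) (h _ _ _ _)).trans_eq ?_)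
  ring

namespace CurveFrame

variable {F : CurveFrame n} {y : ℝ → Mink n} {e₁ e₂ : Mink n}

/-- Nullity eliminates the component ⟨N,y⟩, which can be as large as 1/t. What is left is a
quadratic form in ⟨T,y⟩ and ⟨C,y⟩ plus terms containing ν. -/
lemma area_expand {t : ℝ} (ht : t ∈ Ioc 0 F.d) (hnull : form n (y t) (y t) = 0) :
    area e₁ e₂ (y t) (wedge (F.C t) (F.T t) (y t)) =
      form n (F.T t) (y t) ^ 2 / 2 * area e₁ e₂ (F.C t) (F.T t) +
      form n (F.C t) (y t) ^ 2 * area e₁ e₂ (F.T t) (F.N t) +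
      form n (F.C t) (y t) * form n (F.T t) (y t) * area e₁ e₂ (F.N t) (F.C t) -
      form n (F.ν y t) (F.ν y t) / 2 * area e₁ e₂ (F.C t) (F.T t) +
      (form n (F.C t) (y t) * area e₁ e₂ (F.ν y t) (F.T t) -
        form n (F.T t) (y t) * area e₁ e₂ (F.ν y t) (F.C t)) := by
  have h := two_mul_eq ht hnull
  have hy (e : Mink n) : form n (y t) e = -(form n (F.N t) (y t)) * form n (F.C t) e +
      form n (F.T t) (y t) * form n (F.T t) e - form n (F.C t) (y t) * form n (F.N t) e +
      form n (F.ν y t) e := by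
    conv_lhs => rw [eq_add_ν (F := F) (y := y) t]
    simp only [map_add, map_sub, map_smul, map_neg, LinearMap.add_apply, LinearMap.sub_apply,
      LinearMap.smul_apply, smul_eq_mul, neg_smul, LinearMap.neg_apply, neg_mul]
  rw [wedge_apply]
  simp only [area, map_sub, map_smul, LinearMap.sub_apply, LinearMap.smul_apply, smul_eq_mul]
  rw [hy e₁, hy e₂]
  linear_combination (-(form n (F.C t) e₁ * form n (F.T t) e₂ -
    form n (F.C t) e₂ * form n (F.T t) e₁) / 2) * h

lemma abs_area_sub_le {u u₀ v v₀ : Mink n} {M s : ℝ} (hv : ‖v‖ ≤ M) (hu₀ : ‖u₀‖ ≤ M)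
    (hus : ‖u - u₀‖ ≤ M * s) (hvs : ‖v - v₀‖ ≤ M * s) :
    |area e₁ e₂ u v - area e₁ e₂ u₀ v₀| ≤ 36 * ‖e₁‖ * ‖e₂‖ * M * M * s := by
  have e : area e₁ e₂ u v - area e₁ e₂ u₀ v₀ =
      area e₁ e₂ (u - u₀) v + area e₁ e₂ u₀ (v - v₀) := by
    simp only [area, map_sub, LinearMap.sub_apply]; ring
  rw [e]
  have hM : 0 ≤ M := (norm_nonneg _).trans hv
  have hMs : 0 ≤ M * s := (norm_nonneg _).trans hvs
  have h1 : |area e₁ e₂ (u - u₀) v| ≤ 18 * ‖e₁‖ * ‖e₂‖ * (M * s) * M :=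
    (abs_area_le _ _ _ _).trans (by gcongr)
  have h2 : |area e₁ e₂ u₀ (v - v₀)| ≤ 18 * ‖e₁‖ * ‖e₂‖ * M * (M * s) :=
    (abs_area_le _ _ _ _).trans (by gcongr)
  refine (abs_add_le _ _).trans ((add_le_add h1 h2).trans_eq ?_)
  ring

/-- The rotation in the osculating plane has a definite sense up to small errors. -/
lemma exists_area_lower_bound {τ : Mink n}
    (h : IsFrame (Submodule.span ℝ {F.C 0, F.T 0, F.N 0}) τ e₁ e₂) {B : ℝ} (hB : 0 ≤ B)
    (hnull : ∀ t ∈ Ioc 0 F.d, form n (y t) (y t) = 0)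
    (hν : ∀ᶠ t in 𝓝[>] 0, ‖F.ν y t‖ ≤ B * t ^ 2) :
    ∃ σ : ℝ, (σ = 1 ∨ σ = -1) ∧ ∃ m > 0, ∃ D ≥ 0, ∀ᶠ t in 𝓝[>] 0,
      m * (form n (F.T t) (y t) ^ 2 + form n (F.C t) (y t) ^ 2) - D * t ^ 4 ≤
        σ * area e₁ e₂ (y t) (wedge (F.C t) (F.T t) (y t)) := by
  have h00 : (0 : ℝ) ∈ Icc 0 F.d := left_mem_Icc.2 F.d_pos.le
  obtain ⟨σ, hσ, m, hm, hq⟩ := exists_quadratic_lower_bound (h.discriminant (F.frame 0 h00))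
  have hM := F.M_nonneg
  set E := 18 * ‖e₁‖ * ‖e₂‖ * F.M * F.M with hE
  have hE0 : 0 ≤ E := by positivity
  set S := 18 * ‖e₁‖ * ‖e₂‖ * F.M * B with hS
  have hS0 : 0 ≤ S := by positivity
  refine ⟨σ, hσ, m / 2, by positivity, 3 / 2 * B ^ 2 * E + 2 * S ^ 2 / m, by positivity, ?_⟩
  have hsmall : ∀ᶠ t in 𝓝[>] (0 : ℝ), 4 * E * t < m / 4 :=
    (tendsto_mul_id le_rfl (4 * E)).eventually_lt_const (by positivity)
  filter_upwards [F.eventually_mem, hν, hsmall] with t ht hν hsm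
  have hicc := Ioc_subset_Icc_self ht
  have ht0 := ht.1
  rw [area_expand ht (hnull t ht)]
  have c1 : |area e₁ e₂ (F.C t) (F.T t) - area e₁ e₂ (F.C 0) (F.T 0)| ≤ 2 * E * t :=
    (abs_area_sub_le (F.norm_T_le t hicc) (F.norm_C_le 0 h00) (F.norm_C_sub_le t ht)
      (F.norm_T_sub_le t ht)).trans_eq (by rw [hE]; ring)
  have c2 : |area e₁ e₂ (F.T t) (F.N t) - area e₁ e₂ (F.T 0) (F.N 0)| ≤ 2 * E * t :=
    (abs_area_sub_le (F.norm_N_le t hicc) (F.norm_T_le 0 h00) (F.norm_T_sub_le t ht)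
      (F.norm_N_sub_le t ht)).trans_eq (by rw [hE]; ring)
  have c3 : |area e₁ e₂ (F.N t) (F.C t) - area e₁ e₂ (F.N 0) (F.C 0)| ≤ 2 * E * t :=
    (abs_area_sub_le (F.norm_C_le t hicc) (F.norm_N_le 0 h00) (F.norm_N_sub_le t ht)
      (F.norm_C_sub_le t ht)).trans_eq (by rw [hE]; ring)
  have c4 : |area e₁ e₂ (F.C t) (F.T t)| ≤ E := by
    have hC := F.norm_C_le t hicc
    have hT := F.norm_T_le t hicc
    exact (abs_area_le _ _ _ _).trans (by rw [hE]; gcongr)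
  have c5 : |form n (F.ν y t) (F.ν y t)| ≤ 3 * B ^ 2 * t ^ 4 := by
    refine (abs_form_le _ _).trans ?_
    calc 3 * ‖F.ν y t‖ * ‖F.ν y t‖ ≤ 3 * (B * t ^ 2) * (B * t ^ 2) := by gcongr
      _ = _ := by ring
  have c6 : |area e₁ e₂ (F.ν y t) (F.T t)| ≤ S * t ^ 2 := by
    refine (abs_area_le _ _ _ _).trans ?_
    have hT := F.norm_T_le t hicc
    calc _ ≤ 18 * ‖e₁‖ * ‖e₂‖ * (B * t ^ 2) * F.M := by gcongr
      _ = _ := by rw [hS]; ring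
  have c7 : |area e₁ e₂ (F.ν y t) (F.C t)| ≤ S * t ^ 2 := by
    refine (abs_area_le _ _ _ _).trans ?_
    have hT := F.norm_C_le t hicc
    calc _ ≤ 18 * ‖e₁‖ * ‖e₂‖ * (B * t ^ 2) * F.M := by gcongr
      _ = _ := by rw [hS]; ring
  exact quadratic_perturbation hσ hm hE0 ht0 (hq _ _) hsm c1 c2 c3 c4 c5 c6 c7

end CurveFrame

end Mink

/-- A plane curve avoiding the origin has a differentiable angle function. -/
lemma exists_angle {a b : ℝ} (hab : a < b) {z₁ z₂ z₁' z₂' ψ : ℝ → ℝ}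
    (h₁ : ∀ t ∈ Ioo a b, HasDerivAt z₁ (z₁' t) t) (h₂ : ∀ t ∈ Ioo a b, HasDerivAt z₂ (z₂' t) t)
    (hne : ∀ t ∈ Ioo a b, 0 < z₁ t ^ 2 + z₂ t ^ 2) (hψ : ContinuousOn ψ (Ioo a b))
    (heq : ∀ t ∈ Ioo a b, z₁ t * z₂' t - z₂ t * z₁' t = ψ t * (z₁ t ^ 2 + z₂ t ^ 2)) :
    ∃ φ : ℝ → ℝ, (∀ t ∈ Ioo a b, HasDerivAt φ (ψ t) t) ∧ ∀ t ∈ Ioo a b,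
      z₁ t = √(z₁ t ^ 2 + z₂ t ^ 2) * Real.cos (φ t) ∧
      z₂ t = √(z₁ t ^ 2 + z₂ t ^ 2) * Real.sin (φ t) := by
  obtain ⟨p, hp⟩ : ∃ p, p ∈ Ioo a b := exists_between hab
  set ρ : ℝ → ℝ := fun t => √(z₁ t ^ 2 + z₂ t ^ 2) with hρ
  have hρ0 : ∀ t ∈ Ioo a b, 0 < ρ t := fun t ht => Real.sqrt_pos.2 (hne t ht)
  have hρ2 : ∀ t ∈ Ioo a b, ρ t ^ 2 = z₁ t ^ 2 + z₂ t ^ 2 := fun t ht => Real.sq_sqrt (hne t ht).le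
  have dρ : ∀ t ∈ Ioo a b, HasDerivAt ρ ((z₁ t * z₁' t + z₂ t * z₂' t) / ρ t) t := fun t ht => by
    have := (((h₁ t ht).pow 2).add ((h₂ t ht).pow 2)).sqrt (hne t ht).ne'
    refine this.congr_deriv ?_
    have := (hρ0 t ht).ne'
    change _ / (2 * ρ t) = _
    field_simp
    push_cast
    ring
  obtain ⟨θ, hcos, hsin⟩ := exists_cos_sin_eq (a := z₁ p / ρ p) (b := z₂ p / ρ p) (by
    have := (hρ0 p hp).ne'
    rw [div_pow, div_pow, ← add_div, hρ2 p hp, div_self (hne p hp).ne'])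
  set φ : ℝ → ℝ := fun t => θ + ∫ s in p..t, ψ s with hφ
  have dφ : ∀ t ∈ Ioo a b, HasDerivAt φ (ψ t) t := fun t ht =>
    (LinearODE.hasDerivAt_integral_of_mem_Ioo hψ hp ht).const_add θ
  have hφp : φ p = θ := by simp [hφ]
  -- Normalized and rotated back by φ, the curve has zero velocity; the choice of θ makes it (1, 0)
  -- at p, hence everywhere. `dA` and `dB` treat its two coordinates.
  have dA : ∀ t ∈ Ioo a b, HasDerivAt
      (fun s => (z₁ s * Real.cos (φ s) + z₂ s * Real.sin (φ s)) / ρ s) 0 t := fun t ht => by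
    refine ((((h₁ t ht).mul (dφ t ht).cos).add ((h₂ t ht).mul (dφ t ht).sin)).div (dρ t ht)
      (hρ0 t ht).ne').congr_deriv ?_
    have h0 := (hρ0 t ht).ne'
    have e := heq t ht
    have e2 := hρ2 t ht
    simp only [Pi.add_apply, Pi.mul_apply]
    rw [div_eq_zero_iff]
    left
    field_simp
    rw [e2]
    linear_combination (z₁ t * Real.sin (φ t) - z₂ t * Real.cos (φ t)) * e
  have dB : ∀ t ∈ Ioo a b, HasDerivAt
      (fun s => (z₂ s * Real.cos (φ s) - z₁ s * Real.sin (φ s)) / ρ s) 0 t := fun t ht => by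
    refine ((((h₂ t ht).mul (dφ t ht).cos).sub ((h₁ t ht).mul (dφ t ht).sin)).div (dρ t ht)
      (hρ0 t ht).ne').congr_deriv ?_
    have h0 := (hρ0 t ht).ne'
    have e := heq t ht
    have e2 := hρ2 t ht
    simp only [Pi.sub_apply, Pi.mul_apply]
    rw [div_eq_zero_iff]
    left
    field_simp
    rw [e2]
    linear_combination (z₁ t * Real.cos (φ t) + z₂ t * Real.sin (φ t)) * e
  refine ⟨φ, dφ, fun t ht => ?_⟩
  have cA := isOpen_Ioo.is_const_of_deriv_eq_zero isPreconnected_Ioo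
    (fun s hs => (dA s hs).differentiableAt.differentiableWithinAt)
    (fun s hs => (dA s hs).deriv) ht hp
  have cB := isOpen_Ioo.is_const_of_deriv_eq_zero isPreconnected_Ioo
    (fun s hs => (dB s hs).differentiableAt.differentiableWithinAt)
    (fun s hs => (dB s hs).deriv) ht hp
  have h0p := (hρ0 p hp).ne'
  have h0t := (hρ0 t ht).ne'
  have e2 := hρ2 p hp
  have e3 : z₁ p * (z₁ p / ρ p) + z₂ p * (z₂ p / ρ p) = ρ p := by
    field_simp; linarith
  have e4 : z₂ p * (z₁ p / ρ p) - z₁ p * (z₂ p / ρ p) = 0 := by ring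
  simp only [hφp, hcos, hsin, e3, e4, div_self h0p, zero_div] at cA cB
  rw [div_eq_one_iff_eq h0t] at cA
  rw [div_eq_zero_iff, or_iff_left h0t] at cB
  change z₁ t = ρ t * _ ∧ z₂ t = ρ t * _
  have hcs := Real.cos_sq_add_sin_sq (φ t)
  constructor
  · linear_combination Real.cos (φ t) * cA - Real.sin (φ t) * cB - z₁ t * hcs
  · linear_combination Real.sin (φ t) * cA + Real.cos (φ t) * cB - z₂ t * hcs

/-! ### Phases of a solution over the limit circle -/

namespace Mink

variable {n : ℕ}

namespace CurveFrame

variable {F : CurveFrame n} {y : ℝ → Mink n} {X₀ : ℝ × ℝ × ℝ × Mink n}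

lemma HasLimit.sq_eq (h : F.HasLimit y X₀) (hnull : ∀ t ∈ Ioc 0 F.d, form n (y t) (y t) = 0)
    (h0 : X₀.2.2.2 = 0) : X₀.2.1 ^ 2 + X₀.2.2.1 ^ 2 = X₀.1 ^ 2 := by
  have hx := h.tendsto
  have l := ((((hx.fst_nhds.mul hx.fst_nhds).neg.add
    (hx.snd_nhds.fst_nhds.mul hx.snd_nhds.fst_nhds)).add
    (hx.snd_nhds.snd_nhds.fst_nhds.mul hx.snd_nhds.snd_nhds.fst_nhds)).const_mul (F.freq ^ 2)).add
    (hx.snd_nhds.snd_nhds.snd_nhds.form hx.snd_nhds.snd_nhds.snd_nhds)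
  have e := tendsto_nhds_unique l (tendsto_const_nhds.congr' (f₁ := fun _ => (0 : ℝ)) (by
    filter_upwards [F.eventually_mem] with t ht
    rw [← hnull t ht]
    exact form_eq_slow ht y y))
  rw [h0, map_zero, add_zero, mul_eq_zero,
    or_iff_right (pow_ne_zero 2 F.freq_pos.ne')] at e
  linarith

/-- The leading terms of a solution whose limit is on the limit circle. -/
lemma HasLimit.exists_phase (h : F.HasLimit y X₀) (hk : X₀.1 ≠ 0)
    (hsq : X₀.2.1 ^ 2 + X₀.2.2.1 ^ 2 = X₀.1 ^ 2) :
    ∃ θ : ℝ, ∃ B ≥ 0, ∀ t ∈ Ioc 0 F.d,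
      |form n (F.C t) (y t) / t - X₀.1 * (1 + Real.cos (F.freq * Real.log t - θ))| ≤ B * t ∧
      |form n (F.T t) (y t) - X₀.1 * (1 + Real.cos (F.freq * Real.log t - θ) -
        F.freq * Real.sin (F.freq * Real.log t - θ))| ≤ B * t := by
  obtain ⟨θ, hcos, hsin⟩ := exists_cos_sin_eq (a := X₀.2.1 / X₀.1) (b := X₀.2.2.1 / X₀.1) (by
    rw [div_pow, div_pow, ← add_div, hsq, div_self (pow_ne_zero 2 hk)])
  obtain ⟨B, hB0, hB⟩ := h
  have hω := F.freq_pos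
  refine ⟨θ, (3 + 2 * F.freq) * B, by positivity, fun t ht => ?_⟩
  obtain ⟨x0, x1, x2, -⟩ := abs_le_of_norm_prod_le (hB t ht)
  have k1 : X₀.2.1 = X₀.1 * Real.cos θ := by rw [hcos, mul_div_cancel₀ _ hk]
  have k2 : X₀.2.2.1 = X₀.1 * Real.sin θ := by rw [hsin, mul_div_cancel₀ _ hk]
  have o1 : F.osc X₀.2.1 X₀.2.2.1 t = X₀.1 * Real.cos (F.freq * Real.log t - θ) := by
    rw [osc, k1, k2, Real.cos_sub]; ring
  have o2 : F.osc X₀.2.2.1 (-X₀.2.1) t = -(X₀.1 * Real.sin (F.freq * Real.log t - θ)) := by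
    rw [osc, k1, k2, Real.sin_sub]; ring
  simp only [slow] at x0 x1 x2
  have d1 : |F.osc (F.rot₁ y t) (F.rot₂ y t) t - F.osc X₀.2.1 X₀.2.2.1 t| ≤ 2 * (B * t) := by
    rw [osc_sub]
    exact (abs_osc_le _ _ _).trans (by linarith)
  have d2 : |F.osc (F.rot₂ y t) (-F.rot₁ y t) t - F.osc X₀.2.2.1 (-X₀.2.1) t| ≤ 2 * (B * t) := by
    rw [osc_sub]
    refine (abs_osc_le _ _ _).trans ?_
    rw [show -F.rot₁ y t - -X₀.2.1 = -(F.rot₁ y t - X₀.2.1) by ring, abs_neg]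
    linarith
  have hBt : 0 ≤ B * t := mul_nonneg hB0 ht.1.le
  have d3 : |F.axial y t + F.osc (F.rot₁ y t) (F.rot₂ y t) t -
      X₀.1 * (1 + Real.cos (F.freq * Real.log t - θ))| ≤ 3 * (B * t) := by
    rw [show F.axial y t + F.osc (F.rot₁ y t) (F.rot₂ y t) t -
      X₀.1 * (1 + Real.cos (F.freq * Real.log t - θ)) = (F.axial y t - X₀.1) +
      (F.osc (F.rot₁ y t) (F.rot₂ y t) t - F.osc X₀.2.1 X₀.2.2.1 t) by rw [o1]; ring]
    exact (abs_add_le _ _).trans (by linarith)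
  constructor
  · rw [form_C_div]
    refine d3.trans ?_
    nlinarith
  · rw [form_T_eq]
    rw [show F.axial y t + F.osc (F.rot₁ y t) (F.rot₂ y t) t +
      F.freq * F.osc (F.rot₂ y t) (-F.rot₁ y t) t - X₀.1 * (1 +
      Real.cos (F.freq * Real.log t - θ) - F.freq * Real.sin (F.freq * Real.log t - θ)) =
      (F.axial y t + F.osc (F.rot₁ y t) (F.rot₂ y t) t -
      X₀.1 * (1 + Real.cos (F.freq * Real.log t - θ))) + F.freq *
      (F.osc (F.rot₂ y t) (-F.rot₁ y t) t - F.osc X₀.2.2.1 (-X₀.2.1) t) by rw [o2]; ring]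
    refine (abs_add_le _ _).trans ?_
    rw [abs_mul, abs_of_pos hω]
    nlinarith

/-- A phase in `(0, π)` at which the tangential component is negative. -/
lemma exists_phase_neg {w : ℝ} (hw : 0 < w) : ∃ ψ ∈ Ioo 0 Real.pi, 0 < 1 + Real.cos ψ ∧
    1 + Real.cos ψ - w * Real.sin ψ = -(1 + Real.cos ψ) := by
  -- For ψ = 2x the half-angle formulas give 1 + cos ψ = 2cos²x and w sin ψ = 2w sin x cos x, which
  -- equals 4cos²x exactly when tan x = 2/w.
  set x := Real.arctan (2 / w) with hx
  have hx0 : 0 < x := Real.arctan_pos.2 (by positivity)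
  have hx1 : x < Real.pi / 2 := Real.arctan_lt_pi_div_two _
  have hc : 0 < Real.cos x := Real.cos_arctan_pos _
  have ht : w * Real.sin x = 2 * Real.cos x := by
    have := Real.tan_arctan (2 / w)
    rw [← hx, Real.tan_eq_sin_div_cos, div_eq_div_iff hc.ne' hw.ne'] at this
    linarith
  refine ⟨2 * x, ⟨by linarith, by linarith⟩, ?_, ?_⟩
  · rw [Real.cos_two_mul]; nlinarith [pow_pos hc 2]
  · rw [Real.cos_two_mul, Real.sin_two_mul]
    linear_combination -2 * Real.cos x * ht

/-- The tangential component vanishes infinitely often away from the curve. -/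
lemma HasLimit.frequently_tangent_zero (h : F.HasLimit y X₀) (hy : F.IsSol y) (hk : X₀.1 ≠ 0)
    (hsq : X₀.2.1 ^ 2 + X₀.2.2.1 ^ 2 = X₀.1 ^ 2) : ∃ κ > 0, ∃ᶠ t in 𝓝[>] 0,
      form n (F.T t) (y t) = 0 ∧ κ * t ≤ |form n (F.C t) (y t)| := by
  obtain ⟨θ, B, hB0, hB⟩ := h.exists_phase hk hsq
  obtain ⟨ψ, ⟨hψ0, hψπ⟩, hc, hψ⟩ := exists_phase_neg F.freq_pos
  have hω := F.freq_pos
  set k := X₀.1 with hkdef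
  have hk2 : 0 < k ^ 2 := by positivity
  set c := 1 + Real.cos ψ with hcdef
  have hc2 : c ≤ 2 := by linarith [Real.cos_le_one ψ]
  refine ⟨|k| * c / 2, by positivity, ?_⟩
  have hsmall : ∀ᶠ t in 𝓝[>] (0 : ℝ), B * t < |k| * c / 2 :=
    (tendsto_mul_id le_rfl B).eventually_lt_const (by positivity)
  obtain ⟨δ, hδ, hδs⟩ := mem_nhdsGT_iff_exists_Ioo_subset.1 (F.eventually_mem.and hsmall)
  rw [Filter.frequently_iff]
  intro U hU
  obtain ⟨δ', hδ', hδU⟩ := mem_nhdsGT_iff_exists_Ioo_subset.1 hU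
  obtain ⟨j, hj⟩ := ((tendsto_angleSeq (F := F) (θ + ψ)).eventually
    (Ioo_mem_nhdsGT (lt_min hδ hδ'))).exists
  set s₁ := F.angleSeq θ j with hs₁
  set s₂ := F.angleSeq (θ + ψ) j with hs₂
  have hs1 : 0 < s₁ := Real.exp_pos _
  have hs12 : s₁ < s₂ := by
    apply Real.exp_lt_exp.2
    apply div_lt_div_of_pos_right _ hω
    linarith
  have hI : ∀ t ∈ Icc s₁ s₂, t ∈ Ioc 0 F.d ∧ B * t < |k| * c / 2 := fun t ht =>
    hδs ⟨hs1.trans_le ht.1, ht.2.trans_lt (hj.2.trans_le (min_le_left _ _))⟩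
  have hcont : ContinuousOn (fun t => k * form n (F.T t) (y t)) (Icc s₁ s₂) := fun t ht =>
    ((hy.hasDerivAt_T (hI t ht).1).continuousAt.const_mul k).continuousWithinAt
  have hk3 : |k| * |k| = k ^ 2 := abs_mul_abs_self k ▸ (pow_two k).symm
  have scale : ∀ {v w e : ℝ}, |v - k * w| ≤ e → |k * v - k ^ 2 * w| ≤ |k| * e := fun {v w e} hv => by
    rw [show k * v - k ^ 2 * w = k * (v - k * w) by ring, abs_mul]
    exact mul_le_mul_of_nonneg_left hv (abs_nonneg _)
  have hkB : ∀ t ∈ Icc s₁ s₂, |k| * (B * t) < k ^ 2 * c / 2 := fun t ht => by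
    have := mul_lt_mul_of_pos_left (hI t ht).2 (abs_pos.2 hk)
    calc |k| * (B * t) < |k| * (|k| * c / 2) := this
      _ = |k| * |k| * c / 2 := by ring
      _ = _ := by rw [hk3]
  -- At phase 0 the leading term of k⟨T,y⟩ is 2k², at phase ψ it is -ck², so ⟨T,y⟩ vanishes in
  -- between. The factor k removes the dependence on its sign.
  have hv1 : 0 ≤ k * form n (F.T s₁) (y s₁) := by
    have m1 : s₁ ∈ Icc s₁ s₂ := left_mem_Icc.2 hs12.le
    have := scale (hB s₁ (hI s₁ m1).1).2
    rw [hs₁, freq_mul_log_angleSeq, show θ - j * (2 * Real.pi) - θ = 0 - j * (2 * Real.pi) by ring,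
      Real.cos_sub_nat_mul_two_pi, Real.sin_sub_nat_mul_two_pi, Real.cos_zero, Real.sin_zero,
      ← hs₁] at this
    have h1 := (abs_le.1 this).1
    have h2 := hkB s₁ m1
    nlinarith
  have hv2 : k * form n (F.T s₂) (y s₂) ≤ 0 := by
    have m1 : s₂ ∈ Icc s₁ s₂ := right_mem_Icc.2 hs12.le
    have := scale (hB s₂ (hI s₂ m1).1).2
    rw [hs₂, freq_mul_log_angleSeq,
      show θ + ψ - j * (2 * Real.pi) - θ = ψ - j * (2 * Real.pi) by ring,
      Real.cos_sub_nat_mul_two_pi, Real.sin_sub_nat_mul_two_pi, ← hs₂, hψ] at this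
    have h1 := (abs_le.1 this).2
    have h2 := hkB s₂ m1
    nlinarith
  obtain ⟨t, ht, ht0⟩ := intermediate_value_Icc' hs12.le hcont ⟨hv2, hv1⟩
  refine ⟨t, hδU ⟨hs1.trans_le ht.1, ht.2.trans_lt (hj.2.trans_le (min_le_right _ _))⟩,
    (mul_eq_zero.1 ht0).resolve_left hk, ?_⟩
  have htpos : 0 < t := (hI t ht).1.1
  -- The zero has its phase in [0, ψ], where cosine decreases; this keeps |⟨C,y⟩|/t away from 0.
  have hcosle : Real.cos ψ ≤ Real.cos (F.freq * Real.log t - θ) := by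
    set x := F.freq * Real.log t - θ + j * (2 * Real.pi) with hx
    have l1 := freq_mul_log_angleSeq (F := F) θ j
    have l2 := freq_mul_log_angleSeq (F := F) (θ + ψ) j
    have g1 : Real.log s₁ ≤ Real.log t := Real.log_le_log hs1 ht.1
    have g2 : Real.log t ≤ Real.log s₂ := Real.log_le_log htpos ht.2
    have g3 := mul_le_mul_of_nonneg_left g1 hω.le
    have g4 := mul_le_mul_of_nonneg_left g2 hω.le
    have hx0 : 0 ≤ x := by rw [hx]; linarith
    have hxψ : x ≤ ψ := by rw [hx]; linarith
    have := Real.cos_le_cos_of_nonneg_of_le_pi hx0 hψπ.le hxψ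
    rwa [hx, Real.cos_add_nat_mul_two_pi] at this
  have hα := scale (hB t (hI t ht).1).1
  have h1 := (abs_le.1 hα).1
  have h2 := hkB t ht
  have h3 : k ^ 2 * c ≤ k ^ 2 * (1 + Real.cos (F.freq * Real.log t - θ)) :=
    mul_le_mul_of_nonneg_left (by linarith) hk2.le
  have h4 : k ^ 2 * c / 2 ≤ |k| * |form n (F.C t) (y t) / t| := by
    rw [← abs_mul]
    exact le_trans (by linarith) (le_abs_self _)
  rw [abs_div, abs_of_pos htpos, ← mul_div_assoc, le_div_iff₀ htpos] at h4
  have hkp := abs_pos.2 hk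
  refine le_of_mul_le_mul_left ?_ hkp
  calc |k| * (|k| * c / 2 * t) = |k| * |k| * c / 2 * t := by ring
    _ = k ^ 2 * c / 2 * t := by rw [hk3]
    _ ≤ _ := h4

end CurveFrame

end Mink

/-! ### Real-variable lemmas for the angle -/

/-- A function whose derivative is bounded above on `(0, δ)` converges or diverges to `+∞`
at `0`. -/
lemma tendsto_atTop_or_tendsto_nhds_of_deriv_le {f f' : ℝ → ℝ} {δ B : ℝ} (hδ : 0 < δ)
    (hf : ∀ t ∈ Ioo 0 δ, HasDerivAt f (f' t) t) (hB : ∀ t ∈ Ioo 0 δ, f' t ≤ B) :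
    Tendsto f (𝓝[>] 0) atTop ∨ ∃ l, Tendsto f (𝓝[>] 0) (𝓝 l) := by
  have hd : ∀ t ∈ Ioo 0 δ, HasDerivAt (fun t => f t - B * t) (f' t - B) t := fun t ht => by
    simpa using (hf t ht).fun_sub ((hasDerivAt_id t).const_mul B)
  -- After subtracting Bt the function grows monotonically as t decreases to 0, so it is either
  -- bounded and convergent or divergent.
  have hanti : AntitoneOn (fun t => f t - B * t) (Ioo 0 δ) := by
    refine antitoneOn_of_deriv_nonpos (convex_Ioo 0 δ)
      (fun t ht => (hd t ht).continuousAt.continuousWithinAt) ?_ ?_ <;> rw [interior_Ioo]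
    · exact fun t ht => (hd t ht).differentiableAt.differentiableWithinAt
    · exact fun t ht => by rw [(hd t ht).deriv]; linarith [hB t ht]
  have hlin : Tendsto (fun t : ℝ => B * t) (𝓝[>] 0) (𝓝 0) := by
    have : Tendsto (fun t : ℝ => B * t) (𝓝 0) (𝓝 (B * 0)) := tendsto_id.const_mul _
    rw [mul_zero] at this
    exact this.mono_left nhdsWithin_le_nhds
  by_cases hbd : BddAbove ((fun t => f t - B * t) '' Ioo 0 δ)
  · right
    have hm : MonotoneOn (fun t => -(f t - B * t)) (Ioo 0 δ) := hanti.neg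
    have hbd' : BddBelow ((fun t => -(f t - B * t)) '' Ioo 0 δ) := by
      obtain ⟨u, hu⟩ := hbd
      refine ⟨-u, ?_⟩
      rintro _ ⟨t, ht, rfl⟩
      exact neg_le_neg (hu ⟨t, ht, rfl⟩)
    obtain ⟨p, hp⟩ := exists_between hδ
    have h := hm.tendsto_nhdsWithin_Ioo_right ⟨p, hp⟩ hbd'
    refine ⟨_, (h.neg.add hlin).congr fun t => ?_⟩
    ring
  · left
    have h : Tendsto (fun t => f t - B * t) (𝓝[>] 0) atTop := by
      refine tendsto_atTop.2 fun u => ?_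
      simp only [BddAbove, Set.Nonempty, mem_upperBounds, not_exists, not_forall] at hbd
      obtain ⟨_, ⟨p, hp, rfl⟩, hpu⟩ := hbd u
      filter_upwards [Ioo_mem_nhdsGT hp.1] with t ht
      exact (not_le.1 hpu).le.trans (hanti ⟨ht.1, ht.2.trans hp.2⟩ hp ht.2.le)
    exact (h.atTop_add hlin).congr fun t => by ring

/-- A function that diverges to `+∞` at `0` increases by any fixed amount in short time. -/
lemma eventually_exists_eq_add_of_tendsto_atTop {f : ℝ → ℝ} {δ : ℝ} (hδ : 0 < δ)
    (hc : ContinuousOn f (Ioo 0 δ)) (hf : Tendsto f (𝓝[>] 0) atTop) {a : ℝ} (ha : 0 < a) (N : ℝ) :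
    ∀ᶠ t in 𝓝[>] (0 : ℝ), ∃ s ∈ Ioo 0 t, f s = f t + a ∧ N < 1 / (t - s) := by
  -- As 0 < s < t, taking t below this bound already gives the frequency estimate; divergence is
  -- needed only for the existence of s.
  have hN : (0 : ℝ) < 1 / (|N| + 1) := by positivity
  filter_upwards [Ioo_mem_nhdsGT hδ, Ioo_mem_nhdsGT hN] with t ht htN
  obtain ⟨r, hr, hrt⟩ := ((hf.eventually_ge_atTop (f t + a)).and (Ioo_mem_nhdsGT ht.1)).exists
  obtain ⟨s, hs, hfs⟩ := intermediate_value_Icc' hrt.2.le (hc.mono fun x hx =>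
    ⟨hrt.1.trans_le hx.1, hx.2.trans_lt ht.2⟩) (show f t + a ∈ Icc (f t) (f r) from
      ⟨by linarith, hr⟩)
  have hst : s < t := lt_of_le_of_ne hs.2 fun h => by rw [h] at hfs; linarith
  have hs0 : 0 < s := hrt.1.trans_le hs.1
  refine ⟨s, ⟨hs0, hst⟩, hfs, ?_⟩
  have h1 : t - s < 1 / (|N| + 1) := by linarith [htN.2]
  rw [lt_div_iff₀ (by positivity)] at h1
  rw [lt_div_iff₀ (by linarith)]
  nlinarith [le_abs_self N, sub_pos.2 hst]

/-- The bound for the angular speed, as an inequality of real numbers. -/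
lemma angular_speed_bound {μ μ₀ t v A S m D k K B σ E : ℝ} (hμ : 0 < μ₀) (h1 : μ₀ / 2 ≤ μ)
    (h2 : μ ≤ 2 * μ₀) (ht : 0 < t) (hv : 0 < v) (hE : 0 ≤ E) (hm : 0 < m) (hD : 0 ≤ D) (hk : 0 < k)
    (hS1 : k * v ^ 2 ≤ S) (hS2 : S ≤ K * v ^ 2) (htv : t ≤ B * v)
    (hA : m * E - D * t ^ 4 ≤ σ * A) :
    μ₀ / 2 * m / K * (E / (t ^ 2 * v ^ 2)) - 2 * μ₀ * D * B ^ 2 / k ≤ σ * (μ / t ^ 2 * A / S) := by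
  have hS : 0 < S := lt_of_lt_of_le (by positivity) hS1
  have hK : 0 < K := by
    by_contra h
    nlinarith [pow_pos hv 2]
  have hμp : 0 < μ := by linarith
  have e1 : μ₀ / 2 * m / K * (E / (t ^ 2 * v ^ 2)) ≤ μ / t ^ 2 * (m * E) / S := by
    calc μ₀ / 2 * m / K * (E / (t ^ 2 * v ^ 2)) = μ₀ / 2 / t ^ 2 * (m * E) / (K * v ^ 2) := by
          field_simp
      _ ≤ μ / t ^ 2 * (m * E) / S := by gcongr
  -- After division by t²S the error of order t⁴ stays bounded because t ≤ Bv and S ≥ kv².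
  have e2 : μ / t ^ 2 * (D * t ^ 4) / S ≤ 2 * μ₀ * D * B ^ 2 / k := by
    have htv2 : t ^ 2 ≤ B ^ 2 * v ^ 2 := by
      rw [← mul_pow]; exact pow_le_pow_left₀ ht.le htv 2
    calc μ / t ^ 2 * (D * t ^ 4) / S = μ * D * t ^ 2 / S := by field_simp
      _ ≤ 2 * μ₀ * D * (B ^ 2 * v ^ 2) / (k * v ^ 2) := by gcongr
      _ = _ := by field_simp
  have e3 : σ * (μ / t ^ 2 * A / S) = μ / t ^ 2 * (σ * A) / S := by ring
  have e4 : μ / t ^ 2 * (m * E - D * t ^ 4) / S ≤ μ / t ^ 2 * (σ * A) / S := by gcongr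
  rw [e3]
  refine le_trans ?_ e4
  rw [mul_sub, sub_div]
  linarith

/-! ### Returns to two opposite points of the curvature circle -/

namespace Mink

variable {n : ℕ}

/-- Along a projectively convergent family a projective invariant has the expected limit. -/
lemma tendsto_form_div_form {α : Type*} {l : Filter α} {s : α → ℝ} {y : α → Mink n}
    {v τ : Mink n} (u : Mink n) (hs : ∀ᶠ a in l, s a ≠ 0) (h : Tendsto (fun a => s a • y a) l (𝓝 v))
    (hv : form n v τ ≠ 0) :
    Tendsto (fun a => form n u (y a) / form n (y a) τ) l (𝓝 (form n u v / form n v τ)) := by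
  refine ((tendsto_const_nhds.form h).div (h.form tendsto_const_nhds) hv).congr' ?_
  filter_upwards [hs] with a ha
  rw [Pi.div_apply, map_smul, map_smul, LinearMap.smul_apply, smul_eq_mul, smul_eq_mul,
    mul_div_mul_left _ _ ha]

namespace CurveFrame

variable {F : CurveFrame n} {y : ℝ → Mink n} {X₀ : ℝ × ℝ × ℝ × Mink n}

/-- A solution over the limit circle returns to the initial point of the curve. -/
lemma HasLimit.exists_tendsto_C (h : F.HasLimit y X₀) (hk : X₀.1 ≠ 0)
    (hsq : X₀.2.1 ^ 2 + X₀.2.2.1 ^ 2 = X₀.1 ^ 2) : ∃ l ≤ 𝓝[>] (0 : ℝ), l.NeBot ∧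
      Tendsto (fun t => (-(form n (F.N t) (y t))⁻¹) • y t) l (𝓝 (F.C 0)) ∧
      ∀ᶠ t in l, form n (F.N t) (y t) ≠ 0 := by
  obtain ⟨θ, B, hB0, hB⟩ := h.exists_phase hk hsq
  -- At phase π the leading terms of ⟨C,y⟩/t and ⟨T,y⟩ vanish, while t⟨N,y⟩ tends to `freq`² times
  -- the nonzero axial limit.
  have hl : map (F.angleSeq (θ + Real.pi)) atTop ≤ 𝓝[>] 0 := tendsto_angleSeq _
  refine ⟨_, hl, inferInstance, ?_⟩
  have hω := F.freq_pos
  have hk' := abs_pos.2 hk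
  refine h.tendsto_C hl (g := F.freq ^ 2 * |X₀.1| / 2) (by positivity) ?_
  have hax : Tendsto (F.axial y) (𝓝[>] 0) (𝓝 X₀.1) := h.tendsto.fst_nhds
  have hα : Tendsto (fun t => form n (F.C t) (y t) / t) (map (F.angleSeq (θ + Real.pi)) atTop)
      (𝓝 0) := by
    refine squeeze_zero_norm' ?_ (tendsto_mul_id hl B)
    rw [eventually_map]
    filter_upwards [(tendsto_angleSeq (F := F) (θ + Real.pi)).eventually F.eventually_mem] with j hj
    have := (hB _ hj).1
    rw [freq_mul_log_angleSeq,
      show θ + Real.pi - j * (2 * Real.pi) - θ = Real.pi - j * (2 * Real.pi) by ring,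
      Real.cos_sub_nat_mul_two_pi, Real.cos_pi, add_neg_cancel, mul_zero, sub_zero] at this
    exact this
  have hβ : Tendsto (fun t => form n (F.T t) (y t)) (map (F.angleSeq (θ + Real.pi)) atTop)
      (𝓝 0) := by
    refine squeeze_zero_norm' ?_ (tendsto_mul_id hl B)
    rw [eventually_map]
    filter_upwards [(tendsto_angleSeq (F := F) (θ + Real.pi)).eventually F.eventually_mem] with j hj
    have := (hB _ hj).2
    rw [freq_mul_log_angleSeq,
      show θ + Real.pi - j * (2 * Real.pi) - θ = Real.pi - j * (2 * Real.pi) by ring,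
      Real.cos_sub_nat_mul_two_pi, Real.sin_sub_nat_mul_two_pi, Real.cos_pi, Real.sin_pi,
      add_neg_cancel, mul_zero, sub_zero, mul_zero, sub_zero] at this
    exact this
  have hγ := ((((hax.mono_left hl).const_mul (F.freq ^ 2)).sub (hα.const_mul F.μ₀)).add hβ).abs
  rw [mul_zero, sub_zero, add_zero, abs_mul, abs_of_pos (pow_pos hω 2)] at hγ
  have hpos : 0 < F.freq ^ 2 * |X₀.1| := by positivity
  filter_upwards [hγ.eventually_const_lt (show F.freq ^ 2 * |X₀.1| / 2 < _ by linarith)] with t ht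
  rw [mul_form_N]
  exact ht.le

/-- A solution over the limit circle returns to the point of the curvature circle opposite to
the initial point of the curve. -/
lemma HasLimit.exists_tendsto_N (h : F.HasLimit y X₀) (hy : F.IsSol y) (h0 : X₀.2.2.2 = 0)
    (hk : X₀.1 ≠ 0) (hnull : ∀ t ∈ Ioc 0 F.d, form n (y t) (y t) = 0) :
    ∃ l ≤ 𝓝[>] (0 : ℝ), l.NeBot ∧
      Tendsto (fun t => (-(form n (F.C t) (y t))⁻¹) • y t) l (𝓝 (F.N 0)) ∧
      ∀ᶠ t in l, form n (F.C t) (y t) ≠ 0 := by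
  obtain ⟨κ, hκ, hfreq⟩ := h.frequently_tangent_zero hy hk (h.sq_eq hnull h0)
  obtain ⟨B, hB0, hB⟩ := h.norm_ν_le hy h0
  have hM := F.M_nonneg
  set A : Set ℝ := {t | form n (F.T t) (y t) = 0 ∧ κ * t ≤ |form n (F.C t) (y t)|} with hA
  have hl : 𝓝[>] (0 : ℝ) ⊓ 𝓟 A ≤ 𝓝[>] 0 := inf_le_left
  have hmem : ∀ᶠ t in 𝓝[>] (0 : ℝ) ⊓ 𝓟 A, t ∈ A := mem_inf_of_right (mem_principal_self A)
  have hne : ∀ᶠ t in 𝓝[>] (0 : ℝ) ⊓ 𝓟 A, form n (F.C t) (y t) ≠ 0 := by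
    filter_upwards [hmem, hl F.eventually_mem] with t ht htd h
    have := ht.2
    rw [h, abs_zero] at this
    linarith [mul_pos hκ htd.1]
  refine ⟨_, hl, ?_, ?_, hne⟩
  · rw [← frequently_mem_iff_neBot]; exact hfreq
  have key : Tendsto (fun t => (-(form n (F.C t) (y t))⁻¹) • y t - F.N t) (𝓝[>] (0 : ℝ) ⊓ 𝓟 A)
      (𝓝 0) := by
    refine squeeze_zero_norm' ?_ (tendsto_mul_id hl ((3 * B ^ 2 / (2 * κ) * F.M + B) / κ))
    filter_upwards [hmem, hl F.eventually_mem, hne] with t ⟨hT, hC⟩ htd hne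
    have ht0 := htd.1
    have ht1 : t ≤ 1 := htd.2.trans F.d_le
    have hicc := Ioc_subset_Icc_self htd
    have h2 := two_mul_eq htd (hnull t htd)
    have hν := hB t htd
    set a := form n (F.C t) (y t) with ha
    set w := form n (F.N t) (y t) with hw
    have e : (-a⁻¹) • y t - F.N t = (-a⁻¹) • (-w • F.C t + F.ν y t) := by
      have e' : -w • F.C t + F.ν y t = y t + a • F.N t := by
        rw [ν, normalPart, ← ha, ← hw, hT]; module
      rw [e', smul_add, smul_smul, neg_mul, inv_mul_cancel₀ hne]
      module
    -- With ⟨T,y⟩ = 0 nullity reads 2⟨C,y⟩⟨N,y⟩ = ⟨ν,ν⟩ = O(t⁴), and |⟨C,y⟩| ≥ κt. The resulting t³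
    -- is weakened to t².
    have hww : |w| ≤ 3 * B ^ 2 / (2 * κ) * t ^ 2 := by
      have e1 : 2 * (|a| * |w|) ≤ 3 * (B * t ^ 2) * (B * t ^ 2) := by
        rw [← abs_mul, ← abs_two, ← abs_mul, h2, hT, zero_pow two_ne_zero, zero_add]
        exact (abs_form_le_of_norm_le hν).trans (by gcongr)
      have e2 : κ * t * |w| ≤ |a| * |w| := by gcongr
      have e3 : 2 * κ * |w| * t ≤ 3 * B ^ 2 * t ^ 3 * t := by linarith
      have e4 := le_of_mul_le_mul_right e3 ht0
      rw [div_mul_eq_mul_div, le_div_iff₀ (by positivity)]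
      have e5 : 3 * B ^ 2 * t ^ 3 ≤ 3 * B ^ 2 * t ^ 2 := by
        have : t ^ 3 ≤ t ^ 2 := pow_le_pow_of_le_one ht0.le ht1 (by norm_num)
        gcongr
      linarith
    have hinv : |a|⁻¹ ≤ (κ * t)⁻¹ := inv_anti₀ (by positivity) hC
    rw [e, norm_smul, norm_neg, norm_inv, Real.norm_eq_abs]
    have hsum : ‖-w • F.C t + F.ν y t‖ ≤ (3 * B ^ 2 / (2 * κ) * F.M + B) * t ^ 2 := by
      refine (norm_add_le _ _).trans ?_
      rw [norm_smul, norm_neg, Real.norm_eq_abs]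
      have : |w| * ‖F.C t‖ ≤ 3 * B ^ 2 / (2 * κ) * t ^ 2 * F.M :=
        mul_le_mul hww (F.norm_C_le t hicc) (norm_nonneg _) (by positivity)
      linarith
    calc |a|⁻¹ * ‖-w • F.C t + F.ν y t‖ ≤
        (κ * t)⁻¹ * ((3 * B ^ 2 / (2 * κ) * F.M + B) * t ^ 2) := by gcongr
      _ = _ := by field_simp
  simpa using key.add (F.tendsto_frame.2.2.mono_left hl)

/-- A solution over the limit circle is uniformly close to the curvature circle. -/
lemma HasLimit.exists_planar_bound (h : F.HasLimit y X₀) (hy : F.IsSol y) (h0 : X₀.2.2.2 = 0)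
    (hk : X₀.1 ≠ 0) (hnull : ∀ t ∈ Ioc 0 F.d, form n (y t) (y t) = 0) {τ e₁ e₂ : Mink n}
    (hf : IsFrame (Submodule.span ℝ {F.C 0, F.T 0, F.N 0}) τ e₁ e₂) :
    ∃ k > 0, ∃ D ≥ 0, ∀ᶠ t in 𝓝[>] 0, k * ‖y t‖ ≤ |form n (y t) τ| ∧
      |form n (y t) e₁ ^ 2 + form n (y t) e₂ ^ 2 - form n (y t) τ ^ 2| ≤ D * t ^ 2 * ‖y t‖ ^ 2 := by
  obtain ⟨B, hB0, hB⟩ := h.exists_tangential_bound hy h0 hk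
  obtain ⟨k, hk, hkτ⟩ := exists_le_abs_form (n := n) (τ := τ) (by rw [hf.form_τ]; norm_num)
  refine ⟨k, hk, 3 * B ^ 2, by positivity, ?_⟩
  filter_upwards [hB] with t ⟨ht, _, _, _, hZ⟩
  refine ⟨hkτ _ (hnull t ht), ?_⟩
  have hF := F.frame 0 (left_mem_Icc.2 F.d_pos.le)
  have e1 := hf.form_identity hF (y t) (y t)
  have e2 := hF.form_eq (y t) (y t)
  rw [hnull t ht] at e2
  -- Since y is null, the squares of its osculating and normal parts cancel, so the radius misses 1
  -- only by the normal part.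
  have e : form n (y t) e₁ ^ 2 + form n (y t) e₂ ^ 2 - form n (y t) τ ^ 2 =
      -form n (normalPart (F.C 0) (F.T 0) (F.N 0) (y t))
        (normalPart (F.C 0) (F.T 0) (F.N 0) (y t)) := by
    linear_combination e1 - e2
  rw [e, abs_neg]
  refine (abs_form_le_of_norm_le hZ).trans ?_
  calc 3 * (B * t * ‖y t‖) * _ ≤ 3 * (B * t * ‖y t‖) * (B * t * ‖y t‖) := by
        have := ht.1
        gcongr
    _ = _ := by ring

end CurveFrame

/-! ### Angular speed and rotation -/

namespace CurveFrame

variable {F : CurveFrame n} {y : ℝ → Mink n} {X₀ : ℝ × ℝ × ℝ × Mink n}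

/-- The angular speed of a solution in a frame of the curvature circle. -/
def speed (F : CurveFrame n) (e₁ e₂ : Mink n) (y : ℝ → Mink n) (t : ℝ) : ℝ :=
  -(F.μ t / t ^ 2 * area e₁ e₂ (y t) (wedge (F.C t) (F.T t) (y t)) /
    (form n (y t) e₁ ^ 2 + form n (y t) e₂ ^ 2))

/-- Outside a neighbourhood of the initial point of the curve a null solution has a component
transversal to the curve. -/
lemma exists_transversal_bound {B : ℝ}
    (hB : ∀ᶠ t in 𝓝[>] 0, ‖F.ν y t‖ ≤ B * t * ‖y t‖) {c₀ : LightCone n} {r : ℝ} (hr : r ≠ 0)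
    (hc₀ : c₀.1 = r • F.C 0) {Y : ℝ → LightCone n} (hY : ∀ t ∈ Ioc 0 F.d, (Y t).1 = y t)
    {U : Set (Sphere n)} (hU : U ∈ 𝓝 (span c₀)) :
    ∃ κ > 0, ∀ᶠ t in 𝓝[>] 0, span (Y t) ∉ U →
      κ * ‖y t‖ ^ 2 ≤ form n (F.T t) (y t) ^ 2 + form n (F.C t) (y t) ^ 2 := by
  obtain ⟨R, hR, hball⟩ := exists_ball_of_mem_nhds hU
  have hM := F.M_nonneg
  set M := F.M + 1 with hMdef
  have hM1 : 0 < M := by positivity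
  have hr' : 0 < |r| := abs_pos.2 hr
  -- `η` bounds the transversal components relative to `‖y‖`
  set η := min (1 / (8 * M)) (R / (16 * |r| * M ^ 2)) with hη
  have hη0 : 0 < η := lt_min (by positivity) (by positivity)
  refine ⟨η ^ 2, by positivity, ?_⟩
  have h1 : ∀ᶠ t in 𝓝[>] (0 : ℝ), B * t < η :=
    (tendsto_mul_id le_rfl B).eventually_lt_const hη0
  have h2 : ∀ᶠ t in 𝓝[>] (0 : ℝ), |r| * M * t < R / 2 :=
    (tendsto_mul_id le_rfl _).eventually_lt_const (by positivity)
  filter_upwards [hB, h1, h2, F.eventually_mem] with t hν hηt hRt ht hU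
  -- If ⟨T,y⟩, ⟨C,y⟩ and ν are all small relative to ‖y‖, the C-component carries y, and a multiple
  -- of y lies within R of c₀, so the point is in U.
  by_contra! hlt
  have hicc := Ioc_subset_Icc_self ht
  have hyt : 0 < ‖y t‖ := norm_pos_iff.2 (hY t ht ▸ (Y t).2.1)
  set v := ‖y t‖ with hv
  set u := form n (F.T t) (y t) with hu
  set a := form n (F.C t) (y t) with ha
  set w := form n (F.N t) (y t) with hw
  have hua : |u| ≤ η * v ∧ |a| ≤ η * v := by
    constructor <;> refine abs_le_of_sq_le_sq ?_ (by positivity) <;> rw [mul_pow] <;>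
      linarith [sq_nonneg u, sq_nonneg a]
  have hνv : ‖F.ν y t‖ ≤ η * v := hν.trans (mul_le_mul_of_nonneg_right hηt.le hyt.le)
  have hC := (F.norm_C_le t hicc).trans (by linarith : F.M ≤ M)
  have hT := (F.norm_T_le t hicc).trans (by linarith : F.M ≤ M)
  have hN := (F.norm_N_le t hicc).trans (by linarith : F.M ≤ M)
  have hrest : ‖u • F.T t - a • F.N t + F.ν y t‖ ≤ 4 * M * η * v - η * v := by
    refine (norm_add_le _ _).trans ((add_le_add (norm_sub_le _ _) hνv).trans ?_)
    rw [norm_smul, norm_smul, Real.norm_eq_abs, Real.norm_eq_abs]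
    have g1 : |u| * ‖F.T t‖ ≤ η * v * M := mul_le_mul hua.1 hT (norm_nonneg _) (by positivity)
    have g2 : |a| * ‖F.N t‖ ≤ η * v * M := mul_le_mul hua.2 hN (norm_nonneg _) (by positivity)
    have g3 : η * v ≤ η * v * M := le_mul_of_one_le_right (by positivity) (by linarith)
    linarith
  have hey : y t + w • F.C t = u • F.T t - a • F.N t + F.ν y t := by
    rw [ν, normalPart, ← hu, ← ha, ← hw]; module
  have hηM : 4 * M * η * v ≤ v / 2 := by
    have : η ≤ 1 / (8 * M) := min_le_left _ _
    rw [le_div_iff₀ (by positivity)] at this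
    nlinarith
  have hwv : v / 2 ≤ |w| * M := by
    have g1 : v ≤ ‖y t + w • F.C t‖ + ‖w • F.C t‖ := by
      have := norm_sub_le (y t + w • F.C t) (w • F.C t)
      rwa [add_sub_cancel_right] at this
    have g2 : ‖w • F.C t‖ ≤ |w| * M := by
      rw [norm_smul, Real.norm_eq_abs]; gcongr
    rw [hey] at g1
    have : 0 ≤ η * v := by positivity
    linarith
  have hw0 : w ≠ 0 := fun h => by rw [h, abs_zero, zero_mul] at hwv; linarith
  have hwp : 0 < |w| := abs_pos.2 hw0
  refine hU (hball (Y t) (-(r * w⁻¹)) (neg_ne_zero.2 (mul_ne_zero hr (inv_ne_zero hw0))) ?_)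
  rw [hY t ht, hc₀]
  have e : -(r * w⁻¹) • y t - r • F.C 0 = -(r * w⁻¹) • (y t + w • F.C t) + r • (F.C t - F.C 0) := by
    rw [smul_add, smul_smul, neg_mul, mul_assoc, inv_mul_cancel₀ hw0]; module
  rw [e, hey]
  refine (norm_add_le _ _).trans_lt ?_
  rw [norm_smul, norm_smul, norm_neg, norm_mul, norm_inv, Real.norm_eq_abs, Real.norm_eq_abs]
  have k1 : |r| * ‖F.C t - F.C 0‖ < R / 2 := by
    refine lt_of_le_of_lt ?_ hRt
    rw [mul_assoc]
    refine mul_le_mul_of_nonneg_left ((F.norm_C_sub_le t ht).trans ?_) hr'.le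
    exact mul_le_mul_of_nonneg_right (by linarith) ht.1.le
  have k2 : |r| * |w|⁻¹ * ‖u • F.T t - a • F.N t + F.ν y t‖ ≤ R / 2 := by
    have g1 : ‖u • F.T t - a • F.N t + F.ν y t‖ ≤ 8 * M ^ 2 * η * |w| := by
      have : 0 ≤ η * v := by positivity
      have : 4 * M * η * v ≤ 4 * M * η * (2 * (|w| * M)) :=
        mul_le_mul_of_nonneg_left (by linarith) (by positivity)
      linarith
    have g2 : η * (16 * |r| * M ^ 2) ≤ R := (le_div_iff₀ (by positivity)).1 (min_le_right _ _)
    calc |r| * |w|⁻¹ * ‖u • F.T t - a • F.N t + F.ν y t‖ ≤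
        |r| * |w|⁻¹ * (8 * M ^ 2 * η * |w|) := by gcongr
      _ = η * (16 * |r| * M ^ 2) / 2 := by field_simp; norm_num
      _ ≤ R / 2 := by linarith
  linarith

/-- The angular speed of a solution over the limit circle is bounded below, by the transversal
component of the solution. -/
lemma HasLimit.exists_speed_bound (h : F.HasLimit y X₀) (hy : F.IsSol y) (h0 : X₀.2.2.2 = 0)
    (hk : X₀.1 ≠ 0) (hnull : ∀ t ∈ Ioc 0 F.d, form n (y t) (y t) = 0)
    (hne : ∀ t ∈ Ioc 0 F.d, y t ≠ 0) {τ e₁ e₂ : Mink n}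
    (hf : IsFrame (Submodule.span ℝ {F.C 0, F.T 0, F.N 0}) τ e₁ e₂) :
    ∃ σ : ℝ, (σ = 1 ∨ σ = -1) ∧ ∃ m > 0, ∃ B ≥ 0, ∀ᶠ t in 𝓝[>] 0,
      0 < form n (y t) e₁ ^ 2 + form n (y t) e₂ ^ 2 ∧
      m * ((form n (F.T t) (y t) ^ 2 + form n (F.C t) (y t) ^ 2) / (t ^ 2 * ‖y t‖ ^ 2)) - B ≤
        -(σ * F.speed e₁ e₂ y t) := by
  obtain ⟨B, hB0, hB⟩ := h.exists_tangential_bound hy h0 hk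
  obtain ⟨k, hkp, D, hD0, hD⟩ := h.exists_planar_bound hy h0 hk hnull hf
  obtain ⟨σ, hσ, m, hm, D', hD', hA⟩ := exists_area_lower_bound hf hB0 hnull
    (hB.mono fun t ht => ht.2.2.1)
  have hμ := F.μ₀_pos
  have hM := F.M_nonneg
  set K := 9 * (‖e₁‖ ^ 2 + ‖e₂‖ ^ 2) + 1 with hK
  have hKp : 0 < K := by positivity
  refine ⟨σ, hσ, F.μ₀ / 2 * m / K, by positivity, 2 * F.μ₀ * D' * B ^ 2 / (k ^ 2 / 2),
    by positivity, ?_⟩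
  have h1 : ∀ᶠ t in 𝓝[>] (0 : ℝ), F.M * t < F.μ₀ / 2 :=
    (tendsto_mul_id le_rfl _).eventually_lt_const (by positivity)
  have h2 : ∀ᶠ t in 𝓝[>] (0 : ℝ), D * t < k ^ 2 / 2 :=
    (tendsto_mul_id le_rfl _).eventually_lt_const (by positivity)
  filter_upwards [hB, hD, hA, h1, h2] with t ⟨ht, htB, _⟩ ⟨hkt, hDt⟩ hAt hMt hDk
  have ht0 := ht.1
  have hv : 0 < ‖y t‖ := norm_pos_iff.2 (hne t ht)
  have hμt := abs_le.1 (F.abs_μ_sub_le t ht)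
  have hS1 : k ^ 2 / 2 * ‖y t‖ ^ 2 ≤ form n (y t) e₁ ^ 2 + form n (y t) e₂ ^ 2 := by
    have g1 : k ^ 2 * ‖y t‖ ^ 2 ≤ form n (y t) τ ^ 2 := by
      rw [← mul_pow, ← sq_abs (form n (y t) τ)]
      exact pow_le_pow_left₀ (by positivity) hkt 2
    have g2 : D * t ^ 2 ≤ k ^ 2 / 2 := by
      have : t * (D * t) ≤ 1 * (k ^ 2 / 2) :=
        mul_le_mul (ht.2.trans F.d_le) hDk.le (by positivity) zero_le_one
      linarith
    have g3 := mul_le_mul_of_nonneg_right g2 (sq_nonneg ‖y t‖)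
    have g4 := (abs_le.1 hDt).1
    linarith
  have hS2 : form n (y t) e₁ ^ 2 + form n (y t) e₂ ^ 2 ≤ K * ‖y t‖ ^ 2 := by
    have g (e : Mink n) : form n (y t) e ^ 2 ≤ 9 * ‖e‖ ^ 2 * ‖y t‖ ^ 2 := by
      rw [← sq_abs]
      refine (pow_le_pow_left₀ (abs_nonneg _) (abs_form_le _ _) 2).trans_eq ?_
      ring
    have g1 := g e₁
    have g2 := g e₂
    rw [hK]
    linarith [sq_nonneg ‖y t‖]
  refine ⟨lt_of_lt_of_le (by positivity) hS1, ?_⟩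
  refine (angular_speed_bound (μ := F.μ t) hμ (by linarith) (by linarith) ht0 hv (by positivity) hm hD'
    (by positivity) hS1 hS2 htB hAt).trans_eq ?_
  rw [speed]; ring

lemma IsSol.continuousOn_speed (hy : F.IsSol y) {e₁ e₂ : Mink n} {s : Set ℝ}
    (hs : s ⊆ Ioc 0 F.d) (hpos : ∀ t ∈ s, 0 < form n (y t) e₁ ^ 2 + form n (y t) e₂ ^ 2) :
    ContinuousOn (F.speed e₁ e₂ y) s := by
  have cy : ContinuousOn y s := fun t ht => (hy t (hs ht)).continuousAt.continuousWithinAt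
  have cC : ContinuousOn F.C s := fun t ht =>
    (F.deriv_C t (hs ht)).continuousAt.continuousWithinAt
  have cT : ContinuousOn F.T s := fun t ht =>
    (F.deriv_T t (hs ht)).continuousAt.continuousWithinAt
  have cμ : ContinuousOn F.μ s := F.continuousOn_μ.mono hs
  have ce (e : Mink n) : ContinuousOn (fun t => form n (y t) e) s := cy.form continuousOn_const
  have cw (e : Mink n) : ContinuousOn (fun t => form n (wedge (F.C t) (F.T t) (y t)) e) s := by
    refine ((((cC.form cy).mul (cT.form (continuousOn_const (c := e))))).sub
      ((cT.form cy).mul (cC.form (continuousOn_const (c := e))))).congr fun t _ => ?_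
    simp [wedge_apply]
  refine (ContinuousOn.div ((cμ.div (continuousOn_id.pow 2) fun t ht =>
    pow_ne_zero 2 (hs ht).1.ne').mul ?_) (((ce e₁).pow 2).add ((ce e₂).pow 2)) fun t ht =>
    (hpos t ht).ne').neg
  exact ((ce e₁).mul (cw e₂)).sub ((ce e₂).mul (cw e₁))

/-- The angle of a solution around the curvature circle. -/
lemma IsSol.exists_angle (hy : F.IsSol y) {τ e₁ e₂ : Mink n} {δ : ℝ} (hδ : 0 < δ)
    (hδd : Ioo 0 δ ⊆ Ioc 0 F.d) (hτ : ∀ t ∈ Ioo 0 δ, form n (y t) τ ≠ 0)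
    (hpos : ∀ t ∈ Ioo 0 δ, 0 < form n (y t) e₁ ^ 2 + form n (y t) e₂ ^ 2) :
    ∃ φ ρ : ℝ → ℝ, ∀ t ∈ Ioo 0 δ, HasDerivAt φ (F.speed e₁ e₂ y t) t ∧ 0 < ρ t ∧
      ρ t = √((form n (y t) e₁ ^ 2 + form n (y t) e₂ ^ 2) / form n (y t) τ ^ 2) ∧
      -form n (y t) e₁ / form n (y t) τ = ρ t * Real.cos (φ t) ∧
      -form n (y t) e₂ / form n (y t) τ = ρ t * Real.sin (φ t) := by
  have hsum : ∀ t, (-form n (y t) e₁ / form n (y t) τ) ^ 2 + (-form n (y t) e₂ / form n (y t) τ) ^ 2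
      = (form n (y t) e₁ ^ 2 + form n (y t) e₂ ^ 2) / form n (y t) τ ^ 2 := fun t => by ring
  have hpos' : ∀ t ∈ Ioo 0 δ,
      0 < (form n (y t) e₁ ^ 2 + form n (y t) e₂ ^ 2) / form n (y t) τ ^ 2 := fun t ht =>
    div_pos (hpos t ht) (pow_pos (abs_pos.2 (hτ t ht)) 2 |>.trans_eq (sq_abs _))
  have hd (e : Mink n) : ∀ t ∈ Ioo 0 δ, HasDerivAt (fun s => form n (y s) e)
      (-(F.μ t / t ^ 2 * form n (wedge (F.C t) (F.T t) (y t)) e)) t := fun t ht => by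
    have h := (hy t (hδd ht)).form (hasDerivAt_const t e)
    simpa using h
  -- The plane curve comes from the representative -y/⟨y,τ⟩. In the expression z₁z₂' - z₂z₁' the
  -- derivative of the common denominator drops out, leaving the area of y and y'.
  obtain ⟨φ, hφ, hz⟩ := _root_.exists_angle hδ
    (fun t ht => (hd e₁ t ht).fun_neg.fun_div (hd τ t ht) (hτ t ht))
    (fun t ht => (hd e₂ t ht).fun_neg.fun_div (hd τ t ht) (hτ t ht))
    (fun t ht => by rw [hsum]; exact hpos' t ht) (hy.continuousOn_speed hδd hpos)
    (fun t ht => by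
      have h1 := hτ t ht
      have h2 := (hpos t ht).ne'
      rw [hsum, speed, area]
      field_simp
      ring)
  refine ⟨φ, fun t => √((form n (y t) e₁ ^ 2 + form n (y t) e₂ ^ 2) / form n (y t) τ ^ 2),
    fun t ht => ⟨hφ t ht, Real.sqrt_pos.2 (hpos' t ht), rfl, ?_⟩⟩
  have := hz t ht
  rwa [hsum] at this

end CurveFrame

namespace CurveFrame

variable {F : CurveFrame n} {y : ℝ → Mink n} {X₀ : ℝ × ℝ × ℝ × Mink n}

/-- The angle of a solution over the limit circle does not converge. -/
lemma HasLimit.not_tendsto_angle (h : F.HasLimit y X₀) (hy : F.IsSol y) (h0 : X₀.2.2.2 = 0)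
    (hk : X₀.1 ≠ 0) (hnull : ∀ t ∈ Ioc 0 F.d, form n (y t) (y t) = 0)
    (hne : ∀ t ∈ Ioc 0 F.d, y t ≠ 0) {τ e₁ e₂ : Mink n}
    (hf : IsFrame (Submodule.span ℝ {F.C 0, F.T 0, F.N 0}) τ e₁ e₂) {φ ρ : ℝ → ℝ}
    (hφ : ∀ᶠ t in 𝓝[>] 0, form n (y t) τ ≠ 0 ∧
      ρ t = √((form n (y t) e₁ ^ 2 + form n (y t) e₂ ^ 2) / form n (y t) τ ^ 2) ∧
      -form n (y t) e₁ / form n (y t) τ = ρ t * Real.cos (φ t) ∧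
      -form n (y t) e₂ / form n (y t) τ = ρ t * Real.sin (φ t)) (L : ℝ) :
    ¬ Tendsto φ (𝓝[>] 0) (𝓝 L) := by
  intro hL
  have hF := F.frame 0 (left_mem_Icc.2 F.d_pos.le)
  obtain ⟨k, hkp, D, hD0, hD⟩ := h.exists_planar_bound hy h0 hk hnull hf
  obtain ⟨k', hk', hkτ⟩ := exists_le_abs_form (n := n) (τ := τ) (by rw [hf.form_τ]; norm_num)
  have hneτ : ∀ v : Mink n, v ≠ 0 → form n v v = 0 → form n v τ ≠ 0 := fun v hv hvv h => by
    have := hkτ v hvv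
    rw [h, abs_zero] at this
    exact absurd this (not_le.2 (mul_pos hk' (norm_pos_iff.2 hv)))
  have hC0 : F.C 0 ≠ 0 := fun h => by simpa [h] using hF.CN
  have hN0 : F.N 0 ≠ 0 := fun h => by simpa [h] using hF.CN
  have hρ : Tendsto ρ (𝓝[>] 0) (𝓝 1) := by
    have h1 : Tendsto (fun t => (form n (y t) e₁ ^ 2 + form n (y t) e₂ ^ 2) / form n (y t) τ ^ 2 - 1)
        (𝓝[>] 0) (𝓝 0) := by
      refine squeeze_zero_norm' ?_ (tendsto_mul_id le_rfl (D / k ^ 2))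
      filter_upwards [hD, hφ, F.eventually_mem] with t ⟨h1, h2⟩ ⟨h3, _⟩ ht
      have hv : 0 < ‖y t‖ := norm_pos_iff.2 (hne t ht)
      have h4 : 0 < form n (y t) τ ^ 2 := by positivity
      rw [div_sub_one h4.ne', norm_div, Real.norm_eq_abs, Real.norm_eq_abs, abs_of_pos h4]
      have h5 : (k * ‖y t‖) ^ 2 ≤ form n (y t) τ ^ 2 := by
        rw [← sq_abs (form n (y t) τ)]
        exact pow_le_pow_left₀ (by positivity) h1 2
      have ht0 := ht.1
      calc _ ≤ D * t ^ 2 * ‖y t‖ ^ 2 / (k * ‖y t‖) ^ 2 :=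
            div_le_div₀ (by positivity) h2 (by positivity) h5
        _ = D / k ^ 2 * t ^ 2 := by field_simp
        _ ≤ D / k ^ 2 * t := by
          have : t ^ 2 ≤ t := by nlinarith [ht.2.trans F.d_le]
          gcongr
    have h2 := (h1.add_const 1).sqrt
    rw [zero_add, Real.sqrt_one] at h2
    refine h2.congr' ?_
    filter_upwards [hφ] with t ht
    rw [ht.2.1, sub_add_cancel]
  have hCmem : F.C 0 ∈ Submodule.span ℝ {τ, e₁, e₂} := by
    rw [hf.span_eq]; exact Submodule.subset_span (by simp)
  -- If the angle converged, so would this projective invariant, since the radius tends to 1. But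
  -- its limit is 0 on returns to C(0) and -1/⟨N(0),τ⟩ ≠ 0 on returns to N(0).
  have hg : ∃ g, Tendsto (fun t => form n (F.C 0) (y t) / form n (y t) τ) (𝓝[>] 0) (𝓝 g) := by
    have hcos := (Real.continuous_cos.tendsto L).comp hL
    have hsin := (Real.continuous_sin.tendsto L).comp hL
    refine ⟨_, ((((hρ.mul hcos).const_mul (form n (F.C 0) e₁)).add
      ((hρ.mul hsin).const_mul (form n (F.C 0) e₂))).const_add (form n (F.C 0) τ)).neg.congr' ?_⟩
    filter_upwards [hφ] with t ⟨h1, _, h2, h3⟩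
    rw [Function.comp_apply, Function.comp_apply, ← h2, ← h3, hf.form_eq_of_mem hCmem (y t)]
    field_simp
    ring
  obtain ⟨g, hg⟩ := hg
  obtain ⟨l₁, hl₁, hb₁, ht₁, hn₁⟩ := h.exists_tendsto_C hk (h.sq_eq hnull h0)
  obtain ⟨l₂, hl₂, hb₂, ht₂, hn₂⟩ := h.exists_tendsto_N hy h0 hk hnull
  have k₁ := tendsto_form_div_form (F.C 0) (hn₁.mono fun t ht => neg_ne_zero.2 (inv_ne_zero ht)) ht₁
    (hneτ _ hC0 hF.CC)
  have k₂ := tendsto_form_div_form (F.C 0) (hn₂.mono fun t ht => neg_ne_zero.2 (inv_ne_zero ht)) ht₂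
    (hneτ _ hN0 hF.NN)
  have u₁ := tendsto_nhds_unique k₁ (hg.mono_left hl₁)
  have u₂ := tendsto_nhds_unique k₂ (hg.mono_left hl₂)
  rw [hF.CC, zero_div] at u₁
  rw [hF.CN, ← u₁, div_eq_zero_iff] at u₂
  rcases u₂ with h | h
  · norm_num at h
  · exact hneτ _ hN0 hF.NN h

/-- Solutions over the limit circle rotate around the curvature circle with frequency tending
to infinity. -/
theorem HasLimit.rotatesFast (h : F.HasLimit y X₀) (hy : F.IsSol y) (h0 : X₀.2.2.2 = 0)
    (hk : X₀.1 ≠ 0) {Y : ℝ → LightCone n} (hY : ∀ t, (Y t).1 = y t) {c₀ : LightCone n} {r : ℝ}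
    (hr : r ≠ 0) (hc₀ : c₀.1 = r • F.C 0) :
    RotatesFast (fun t => span (Y t)) (Submodule.span ℝ {F.C 0, F.T 0, F.N 0}) (span c₀) := by
  intro τ e₁ e₂ hf
  have hnull : ∀ t ∈ Ioc 0 F.d, form n (y t) (y t) = 0 := fun t _ => hY t ▸ (Y t).2.2
  have hne : ∀ t ∈ Ioc 0 F.d, y t ≠ 0 := fun t _ => hY t ▸ (Y t).2.1
  obtain ⟨σ, hσ, m, hm, B, hB0, hsp⟩ := h.exists_speed_bound hy h0 hk hnull hne hf
  obtain ⟨k, hkp, _, _, hD⟩ := h.exists_planar_bound hy h0 hk hnull hf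
  have hev : ∀ᶠ t in 𝓝[>] (0 : ℝ), t ∈ Ioc 0 F.d ∧ form n (y t) τ ≠ 0 ∧
      0 < form n (y t) e₁ ^ 2 + form n (y t) e₂ ^ 2 ∧ σ * F.speed e₁ e₂ y t ≤ B := by
    filter_upwards [hsp, hD, F.eventually_mem] with t ⟨h1, h2⟩ ⟨h3, _⟩ ht
    refine ⟨ht, fun h => ?_, h1, ?_⟩
    · rw [h, abs_zero] at h3
      exact absurd h3 (not_le.2 (mul_pos hkp (norm_pos_iff.2 (hne t ht))))
    · have : 0 ≤ m * ((form n (F.T t) (y t) ^ 2 + form n (F.C t) (y t) ^ 2) /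
        (t ^ 2 * ‖y t‖ ^ 2)) := by positivity
      linarith
  obtain ⟨δ, hδ, hδs⟩ := mem_nhdsGT_iff_exists_Ioo_subset.1 hev
  have hδ : 0 < δ := hδ
  obtain ⟨φ, ρ, hφ⟩ := hy.exists_angle (τ := τ) (e₁ := e₁) (e₂ := e₂) hδ (fun t ht => (hδs ht).1)
    (fun t ht => (hδs ht).2.1) (fun t ht => (hδs ht).2.2.1)
  have hσ2 : σ * σ = 1 := by rcases hσ with rfl | rfl <;> norm_num
  have hd : ∀ t ∈ Ioo 0 δ, HasDerivAt (fun t => σ * φ t) (σ * F.speed e₁ e₂ y t) t :=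
    fun t ht => (hφ t ht).1.const_mul σ
  have hmem : ∀ᶠ t in 𝓝[>] (0 : ℝ), t ∈ Ioo 0 δ := Ioo_mem_nhdsGT hδ
  -- The speed bound makes the derivative of σφ bounded above, so only convergence has to be
  -- excluded.
  have htop : Tendsto (fun t => σ * φ t) (𝓝[>] 0) atTop := by
    refine (tendsto_atTop_or_tendsto_nhds_of_deriv_le hδ hd fun t ht =>
      (hδs ht).2.2.2).resolve_right ?_
    rintro ⟨L, hL⟩
    refine h.not_tendsto_angle hy h0 hk hnull hne hf (φ := φ) (ρ := ρ) ?_ (σ * L) ?_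
    · filter_upwards [hmem] with t ht
      exact ⟨(hδs ht).2.1, (hφ t ht).2.2⟩
    · refine (hL.const_mul σ).congr fun t => ?_
      rw [← mul_assoc, hσ2, one_mul]
  refine ⟨δ, hδ, φ, fun t ht => (hφ t ht).1.differentiableAt.differentiableWithinAt,
    fun t ht => ?_, σ, hσ, htop, fun N => ?_, fun U hU => ?_⟩
  · obtain ⟨-, h1, -, h2, h3⟩ := hφ t ht
    have hτ := (hδs ht).2.1
    have hτ' : -(form n (y t) τ)⁻¹ ≠ 0 := neg_ne_zero.2 (inv_ne_zero hτ)
    refine ⟨(Y t).scale _ hτ', span_scale _ _ _, ?_, ρ t, h1, ?_, ?_⟩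
    · simp [LightCone.scale, hY, hτ]
    · rw [← h2]; simp [LightCone.scale, hY]; ring
    · rw [← h3]; simp [LightCone.scale, hY]; ring
  · have := eventually_exists_eq_add_of_tendsto_atTop hδ
      (fun t ht => (hd t ht).continuousAt.continuousWithinAt) htop Real.two_pi_pos N
    filter_upwards [this] with t ⟨s, hs, h1, h2⟩
    refine ⟨s, hs, ?_, h2⟩
    linear_combination σ * h1 - (φ s - φ t) * hσ2
  · obtain ⟨B', -, hB'⟩ := h.exists_tangential_bound hy h0 hk
    obtain ⟨κ, hκ, hκe⟩ := exists_transversal_bound (hB'.mono fun t ht => ht.2.2.2.1) hr hc₀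
      (fun t _ => hY t) hU
    have hle : 𝓝[{t | 0 < t ∧ span (Y t) ∉ U}] (0 : ℝ) ≤ 𝓝[>] 0 := nhdsWithin_mono 0 fun t ht => ht.1
    -- Outside U the transversal part is at least κ‖y‖², which turns the speed bound into mκ/t² - B.
    have hlow : Tendsto (fun t : ℝ => m * κ * (t⁻¹ * t⁻¹) - B)
        (𝓝[{t | 0 < t ∧ span (Y t) ∉ U}] 0) atTop := by
      have h1 : Tendsto (fun t : ℝ => t⁻¹) (𝓝[>] 0) atTop := tendsto_inv_nhdsGT_zero
      exact tendsto_atTop_add_const_right _ (-B)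
        (((h1.atTop_mul_atTop₀ h1).const_mul_atTop (by positivity)).mono_left hle)
    refine tendsto_atTop_mono' _ ?_ hlow
    filter_upwards [hle hκe, hle hsp, hle hmem, self_mem_nhdsWithin] with t h1 ⟨_, h2⟩ ht htU
    rw [(hφ t ht).1.deriv]
    refine le_trans ?_ h2
    have hv : 0 < ‖y t‖ := norm_pos_iff.2 (hne t (hδs ht).1)
    have ht0 := ht.1
    have h3 : κ * (t⁻¹ * t⁻¹) ≤ (form n (F.T t) (y t) ^ 2 + form n (F.C t) (y t) ^ 2) /
        (t ^ 2 * ‖y t‖ ^ 2) := by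
      rw [le_div_iff₀ (by positivity)]
      refine le_trans (le_of_eq ?_) (h1 htU.2)
      field_simp
    have := mul_le_mul_of_nonneg_left h3 hm.le
    linarith

end CurveFrame

end Mink

/-! ### Smooth curves -/

lemma ContDiffOn.hasDerivAt_of_isOpen {E : Type*} [NormedAddCommGroup E] [NormedSpace ℝ E]
    {f : ℝ → E} {s : Set ℝ} (hf : ContDiffOn ℝ ∞ f s) (hs : IsOpen s) {t : ℝ} (ht : t ∈ s) :
    HasDerivAt f (deriv f t) t :=
  ((hf.differentiableOn (by simp)).differentiableAt (hs.mem_nhds ht)).hasDerivAt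

lemma ContDiffOn.exists_lipschitz_bound {E : Type*} [NormedAddCommGroup E] [NormedSpace ℝ E]
    {f : ℝ → E} {s : Set ℝ} (hf : ContDiffOn ℝ ∞ f s) (hs : IsOpen s) {d : ℝ} (hd : Icc 0 d ⊆ s) :
    ∃ M ≥ 0, ∀ t ∈ Icc 0 d, ‖f t‖ ≤ M ∧ ‖f t - f 0‖ ≤ M * t := by
  have hf' : ContDiffOn ℝ ∞ (deriv f) s := hf.deriv_of_isOpen hs (by simp)
  obtain ⟨A, hA⟩ := isCompact_Icc.exists_bound_of_continuousOn (hf.continuousOn.mono hd)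
  obtain ⟨B, hB⟩ := isCompact_Icc.exists_bound_of_continuousOn (hf'.continuousOn.mono hd)
  refine ⟨max 0 (max A B), le_max_left _ _, fun t ht =>
    ⟨(hA t ht).trans ((le_max_left A B).trans (le_max_right _ _)), ?_⟩⟩
  have := (convex_Icc 0 d).norm_image_sub_le_of_norm_deriv_le
    (fun x hx => (hf.hasDerivAt_of_isOpen hs (hd hx)).differentiableAt) hB
    (left_mem_Icc.2 (ht.1.trans ht.2)) ht
  rw [sub_zero, Real.norm_eq_abs, abs_of_nonneg ht.1] at this
  exact this.trans (mul_le_mul_of_nonneg_right ((le_max_right A B).trans (le_max_right _ _)) ht.1)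

namespace Mink

variable {n : ℕ}

lemma _root_.ContDiffOn.form {f g : ℝ → Mink n} {s : Set ℝ} (hf : ContDiffOn ℝ ∞ f s)
    (hg : ContDiffOn ℝ ∞ g s) : ContDiffOn ℝ ∞ (fun t => Mink.form n (f t) (g t)) s :=
  ((formL n).contDiff.comp_contDiffOn hf).clm_apply hg

lemma form_deriv_add_form_deriv {f g : ℝ → Mink n} {s : Set ℝ} (hs : IsOpen s)
    (hf : ContDiffOn ℝ ∞ f s) (hg : ContDiffOn ℝ ∞ g s) {k : ℝ}
    (h : ∀ t ∈ s, form n (f t) (g t) = k) {t : ℝ} (ht : t ∈ s) :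
    form n (deriv f t) (g t) + form n (f t) (deriv g t) = 0 := by
  have h1 := (hf.hasDerivAt_of_isOpen hs ht).form (hg.hasDerivAt_of_isOpen hs ht)
  have h2 : (fun r => form n (f r) (g r)) =ᶠ[𝓝 t] fun _ => k :=
    eventually_of_mem (hs.mem_nhds ht) h
  exact (h1.congr_of_eventuallyEq h2.symm).unique (hasDerivAt_const t k)

/-- A unit speed light cone curve and a smooth coefficient give a `CurveFrame`. -/
lemma exists_curveFrame {C : ℝ → Mink n} {μ : ℝ → ℝ} {a b : ℝ} (ha : a < 0) (hb : 0 < b)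
    (hC : ContDiffOn ℝ ∞ C (Ioo a b)) (hμ : ContDiffOn ℝ ∞ μ (Ioo a b)) (hμ₀ : 1 < 2 * μ 0)
    (hCC : ∀ t ∈ Ioo a b, form n (C t) (C t) = 0)
    (hTT : ∀ t ∈ Ioo a b, form n (deriv C t) (deriv C t) = 1) :
    ∃ F : CurveFrame n, F.d < b ∧ F.C = C ∧ F.T = deriv C ∧ F.μ = μ ∧
      ∃ q : ℝ, F.N 0 = deriv (deriv C) 0 + q • C 0 := by
  have ho : IsOpen (Ioo a b) := isOpen_Ioo
  set T := deriv C with hTdef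
  set A := deriv T with hAdef
  have hT : ContDiffOn ℝ ∞ T (Ioo a b) := hC.deriv_of_isOpen ho (by simp)
  have hA : ContDiffOn ℝ ∞ A (Ioo a b) := hT.deriv_of_isOpen ho (by simp)
  have hA' : ContDiffOn ℝ ∞ (deriv A) (Ioo a b) := hA.deriv_of_isOpen ho (by simp)
  have hCT : ∀ t ∈ Ioo a b, form n (C t) (T t) = 0 := fun t ht => by
    have := form_deriv_add_form_deriv ho hC hC hCC ht
    rw [form_comm (deriv C t)] at this
    change form n (C t) (deriv C t) = 0
    linarith
  have hCA : ∀ t ∈ Ioo a b, form n (C t) (A t) = -1 := fun t ht => by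
    have := form_deriv_add_form_deriv ho hC hT hCT ht
    rw [← hTdef, hTT t ht, ← hAdef] at this
    linarith
  have hTA : ∀ t ∈ Ioo a b, form n (T t) (A t) = 0 := fun t ht => by
    have := form_deriv_add_form_deriv ho hT hT hTT ht
    rw [form_comm (deriv T t), ← hAdef] at this
    linarith
  have hTA' : ∀ t ∈ Ioo a b, form n (T t) (deriv A t) = -form n (A t) (A t) := fun t ht => by
    have := form_deriv_add_form_deriv ho hT hA hTA ht
    rw [← hAdef] at this
    linarith
  have hCA' : ∀ t ∈ Ioo a b, form n (C t) (deriv A t) = 0 := fun t ht => by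
    have := form_deriv_add_form_deriv ho hC hA hCA ht
    rw [← hTdef, hTA t ht] at this
    linarith
  -- This q is forced by ⟨N,N⟩ = 0 for N = C'' + qC, and K is then what remains of N' + qT.
  set q : ℝ → ℝ := fun t => form n (A t) (A t) / 2 with hq
  set N : ℝ → Mink n := fun t => A t + q t • C t with hN
  set K : ℝ → Mink n := fun t => deriv A t + form n (A t) (deriv A t) • C t +
    form n (A t) (A t) • T t with hK
  have hqs : ContDiffOn ℝ ∞ q (Ioo a b) := (hA.form hA).div_const 2
  have hNs : ContDiffOn ℝ ∞ N (Ioo a b) := hA.add (hqs.smul hC)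
  have hKs : ContDiffOn ℝ ∞ K (Ioo a b) :=
    (hA'.add ((hA.form hA').smul hC)).add ((hA.form hA).smul hT)
  set d := min 1 (b / 2) with hd
  have hd0 : 0 < d := lt_min one_pos (by linarith)
  have hdb : d < b := (min_le_right _ _).trans_lt (by linarith)
  have hsub : Icc 0 d ⊆ Ioo a b := fun t ht => ⟨ha.trans_le ht.1, ht.2.trans_lt hdb⟩
  obtain ⟨M₁, hM₁, b₁⟩ := hC.exists_lipschitz_bound ho hsub
  obtain ⟨M₂, hM₂, b₂⟩ := hT.exists_lipschitz_bound ho hsub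
  obtain ⟨M₃, hM₃, b₃⟩ := hNs.exists_lipschitz_bound ho hsub
  obtain ⟨M₄, hM₄, b₄⟩ := hKs.exists_lipschitz_bound ho hsub
  obtain ⟨M₅, hM₅, b₅⟩ := hqs.exists_lipschitz_bound ho hsub
  obtain ⟨M₆, hM₆, b₆⟩ := hμ.exists_lipschitz_bound ho hsub
  set M := M₁ + M₂ + M₃ + M₄ + M₅ + M₆ with hM
  have lip {x r m : ℝ} (ht : 0 ≤ r) (h : x ≤ m * r) (hm : m ≤ M) : x ≤ M * r :=
    h.trans (mul_le_mul_of_nonneg_right hm ht)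
  have hI : ∀ t ∈ Ioc 0 d, t ∈ Icc 0 d := fun t ht => Ioc_subset_Icc_self ht
  refine ⟨{ C := C, T := T, N := N, K := K, q := q, μ := μ, μ₀ := μ 0, d := d, M := M
            d_pos := hd0
            d_le := min_le_left _ _
            M_nonneg := by positivity
            one_lt := hμ₀
            frame := fun t ht => ?_
            deriv_C := fun t ht => hC.hasDerivAt_of_isOpen ho (hsub (hI t ht))
            deriv_T := fun t ht => (hT.hasDerivAt_of_isOpen ho (hsub (hI t ht))).congr_deriv
              (add_sub_cancel_right _ _).symm
            deriv_N := fun t ht => ?_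
            form_K := fun t ht => ?_
            continuousOn_μ := hμ.continuousOn.mono fun t ht => hsub (hI t ht)
            abs_q_le := fun t ht => (b₅ t (hI t ht)).1.trans (by linarith)
            norm_K_le := fun t ht => (b₄ t (hI t ht)).1.trans (by linarith)
            norm_C_le := fun t ht => (b₁ t ht).1.trans (by linarith)
            norm_T_le := fun t ht => (b₂ t ht).1.trans (by linarith)
            norm_N_le := fun t ht => (b₃ t ht).1.trans (by linarith)
            abs_μ_sub_le := fun t ht => lip ht.1.le (b₆ t (hI t ht)).2 (by linarith)
            norm_C_sub_le := fun t ht => lip ht.1.le (b₁ t (hI t ht)).2 (by linarith)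
            norm_T_sub_le := fun t ht => lip ht.1.le (b₂ t (hI t ht)).2 (by linarith)
            norm_N_sub_le := fun t ht => lip ht.1.le (b₃ t (hI t ht)).2 (by linarith) },
    hdb, rfl, rfl, rfl, q 0, rfl⟩
  · have ht' := hsub ht
    refine ⟨hCC t ht', hCT t ht', hTT t ht', ?_, ?_, ?_⟩
    · simp [hN, hCA t ht', hCC t ht']
    · simp [hN, hTA t ht', form_comm (T t) (C t), hCT t ht']
    · simp [hN, hCC t ht', form_comm (A t) (C t), hCA t ht', hq]
      ring
  · have ht' := hsub (hI t ht)
    have dA := hA.hasDerivAt_of_isOpen ho ht'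
    have h : HasDerivAt N _ t :=
      dA.fun_add (((dA.form dA).div_const 2).fun_smul (hC.hasDerivAt_of_isOpen ho ht'))
    refine h.congr_deriv ?_
    rw [form_comm (deriv A t) (A t)]
    simp only [hK, hq, hTdef]
    module
  · have ht' := hsub (hI t ht)
    refine ⟨?_, ?_, ?_⟩
    · simp [hK, hCC t ht', form_comm (deriv A t) (C t), hCA' t ht', form_comm (T t) (C t),
        hCT t ht']
    · simp [hK, hTT t ht', form_comm (deriv A t) (T t), hTA' t ht', hCT t ht']
    · simp [hK, hN, form_comm (deriv A t) (A t), form_comm (deriv A t) (C t), hCA' t ht',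
        form_comm (T t) (C t), hCT t ht', hCC t ht', hCA t ht', hTA t ht']

lemma wedge_smul_add_smul (v w : Mink n) (a b d : ℝ) :
    wedge (a • v) (b • v + d • w) = (a * d) • wedge v w := by
  ext1 x
  simp only [wedge_apply, map_add, map_smul, LinearMap.add_apply, LinearMap.smul_apply, smul_eq_mul,
    _root_.smul_apply]
  module

/-- The light cone lift with unit speed of a regular curve. -/
lemma IsRegularLift.exists_unit_lift {c : ℝ → LightCone n} {s : Set ℝ} (hc : IsRegularLift c s)
    (hs : IsOpen s) : ∃ l : ℝ → ℝ, ContDiffOn ℝ ∞ l s ∧ ∀ t ∈ s, l t ≠ 0 ∧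
      0 < form n (deriv (fun r => (c r).1) t) (deriv (fun r => (c r).1) t) ∧
      form n (deriv (fun r => l r • (c r).1) t) (deriv (fun r => l r • (c r).1) t) = 1 ∧
      wedge (l t • (c t).1) (deriv (fun r => l r • (c r).1) t) =
        (form n (deriv (fun r => (c r).1) t) (deriv (fun r => (c r).1) t))⁻¹ •
          wedge (c t).1 (deriv (fun r => (c r).1) t) ∧
      Submodule.span ℝ {l t • (c t).1, deriv (fun r => l r • (c r).1) t,
        deriv (deriv (fun r => l r • (c r).1)) t} = osculatingSpace c t := by
  obtain ⟨hγ, hli⟩ := hc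
  set γ : ℝ → Mink n := fun r => (c r).1 with hγdef
  have hγ' : ContDiffOn ℝ ∞ (deriv γ) s := hγ.deriv_of_isOpen hs (by simp)
  have hnull : ∀ t, form n (γ t) (γ t) = 0 := fun t => (c t).2.2
  have horth : ∀ t ∈ s, form n (γ t) (deriv γ t) = 0 := fun t ht => by
    have := form_deriv_add_form_deriv hs hγ hγ (fun t _ => hnull t) ht
    rw [form_comm (deriv γ t)] at this
    linarith
  have hpos : ∀ t ∈ s, 0 < form n (deriv γ t) (deriv γ t) := fun t ht => by
    obtain ⟨h1, h2⟩ := form_self_of_orthogonal_null (c t).2.1 (hnull t) (horth t ht)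
    refine h1.lt_of_ne fun h => ?_
    obtain ⟨a, ha⟩ := h2 h.symm
    have := LinearIndependent.pair_iff.1 (hli t ht) a (-1) (by rw [ha]; simp)
    norm_num at this
  have hg : ContDiffOn ℝ ∞ (fun t => √(form n (deriv γ t) (deriv γ t))) s :=
    (hγ'.form hγ').sqrt fun t ht => (hpos t ht).ne'
  -- As γ is null and orthogonal to γ', the lift lγ has speed |l|‖γ'‖, and its wedge with its
  -- derivative is l² γ ∧ γ'. This accounts for the factor 1/‖c'‖² in `assocForm`.
  set l : ℝ → ℝ := (fun t => √(form n (deriv γ t) (deriv γ t)))⁻¹ with hl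
  have hls : ContDiffOn ℝ ∞ l s := hg.inv fun t ht => (Real.sqrt_pos.2 (hpos t ht)).ne'
  have hls' : ContDiffOn ℝ ∞ (deriv l) s := hls.deriv_of_isOpen hs (by simp)
  have hl0 : ∀ t ∈ s, l t ≠ 0 := fun t ht => inv_ne_zero (Real.sqrt_pos.2 (hpos t ht)).ne'
  have hl2 : ∀ t ∈ s, l t * l t = (form n (deriv γ t) (deriv γ t))⁻¹ := fun t ht => by
    rw [hl, Pi.inv_apply, ← mul_inv, Real.mul_self_sqrt (hpos t ht).le]
  have hd : ∀ t ∈ s, HasDerivAt (fun r => l r • γ r) (deriv l t • γ t + l t • deriv γ t) t :=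
    fun t ht => ((hls.hasDerivAt_of_isOpen hs ht).fun_smul
      (hγ.hasDerivAt_of_isOpen hs ht)).congr_deriv (add_comm _ _)
  refine ⟨l, hls, fun t ht => ⟨hl0 t ht, hpos t ht, ?_, ?_, ?_⟩⟩
  · rw [(hd t ht).deriv]
    simp only [map_add, map_smul, LinearMap.add_apply, LinearMap.smul_apply, smul_eq_mul, hnull,
      horth t ht, form_comm (deriv γ t) (γ t)]
    have := congrArg (· * form n (deriv γ t) (deriv γ t)) (hl2 t ht)
    simp only [inv_mul_cancel₀ (hpos t ht).ne'] at this
    linear_combination this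
  · rw [(hd t ht).deriv, ← hl2 t ht]
    exact wedge_smul_add_smul _ _ _ _ _
  · have hdd : deriv (deriv fun r => l r • γ r) t =
        deriv (deriv l) t • γ t + (2 * deriv l t) • deriv γ t + l t • deriv (deriv γ) t := by
      have he : (deriv fun r => l r • γ r) =ᶠ[𝓝 t] fun r => deriv l r • γ r + l r • deriv γ r :=
        eventually_of_mem (hs.mem_nhds ht) fun r hr => (hd r hr).deriv
      have h : HasDerivAt (fun r => deriv l r • γ r + l r • deriv γ r) _ t :=
        ((hls'.hasDerivAt_of_isOpen hs ht).fun_smul (hγ.hasDerivAt_of_isOpen hs ht)).fun_add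
          ((hls.hasDerivAt_of_isOpen hs ht).fun_smul (hγ'.hasDerivAt_of_isOpen hs ht))
      rw [he.deriv_eq, h.deriv]
      module
    rw [(hd t ht).deriv, hdd, osculatingSpace]
    change _ = Submodule.span ℝ {γ t, deriv γ t, deriv (deriv γ) t}
    apply le_antisymm
    · have m1 : γ t ∈ Submodule.span ℝ {γ t, deriv γ t, deriv (deriv γ) t} :=
        Submodule.subset_span (by simp)
      have m2 : deriv γ t ∈ Submodule.span ℝ {γ t, deriv γ t, deriv (deriv γ) t} :=
        Submodule.subset_span (by simp)
      have m3 : deriv (deriv γ) t ∈ Submodule.span ℝ {γ t, deriv γ t, deriv (deriv γ) t} :=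
        Submodule.subset_span (by simp)
      rw [Submodule.span_le]
      rintro v (rfl | rfl | rfl)
      · exact Submodule.smul_mem _ _ m1
      · exact Submodule.add_mem _ (Submodule.smul_mem _ _ m1) (Submodule.smul_mem _ _ m2)
      · exact Submodule.add_mem _ (Submodule.add_mem _ (Submodule.smul_mem _ _ m1)
          (Submodule.smul_mem _ _ m2)) (Submodule.smul_mem _ _ m3)
    · set S := Submodule.span ℝ {l t • γ t, deriv l t • γ t + l t • deriv γ t,
        deriv (deriv l) t • γ t + (2 * deriv l t) • deriv γ t + l t • deriv (deriv γ) t} with hS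
      have h0 := hl0 t ht
      have m1 : γ t ∈ S := (Submodule.smul_mem_iff _ h0).1 (Submodule.subset_span (by simp))
      have m2 : deriv γ t ∈ S := (Submodule.smul_mem_iff _ h0).1
        ((Submodule.add_mem_iff_right _ (Submodule.smul_mem _ (deriv l t) m1)).1
          (Submodule.subset_span (by simp)))
      have m3 : deriv (deriv γ) t ∈ S := (Submodule.smul_mem_iff _ h0).1
        ((Submodule.add_mem_iff_right _ (Submodule.add_mem _
          (Submodule.smul_mem _ (deriv (deriv l) t) m1)
          (Submodule.smul_mem _ (2 * deriv l t) m2))).1 (Submodule.subset_span (by simp)))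
      rw [Submodule.span_le]
      rintro v (rfl | rfl | rfl)
      exacts [m1, m2, m3]

lemma span_add_smul (u v w : Mink n) (a : ℝ) :
    Submodule.span ℝ {u, v, w + a • u} = Submodule.span ℝ {u, v, w} := by
  apply le_antisymm <;> rw [Submodule.span_le]
  · have hu : u ∈ Submodule.span ℝ {u, v, w} := Submodule.subset_span (by simp)
    rintro x (rfl | rfl | rfl)
    · exact hu
    · exact Submodule.subset_span (by simp)
    · exact Submodule.add_mem _ (Submodule.subset_span (by simp)) (Submodule.smul_mem _ _ hu)
  · have hu : u ∈ Submodule.span ℝ {u, v, w + a • u} := Submodule.subset_span (by simp)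
    rintro x (rfl | rfl | rfl)
    · exact hu
    · exact Submodule.subset_span (by simp)
    · exact (Submodule.add_mem_iff_left _ (Submodule.smul_mem _ a hu)).1
        (Submodule.subset_span (by simp))

/-- The projection along a null frame as a continuous linear map. -/
def normalProj (C T N : Mink n) : Mink n →L[ℝ] Mink n :=
  LinearMap.toContinuousLinearMap (LinearMap.id + (form n N).smulRight C -
    (form n T).smulRight T + (form n C).smulRight N)

lemma normalProj_apply (C T N z : Mink n) : normalProj C T N z = normalPart C T N z := rfl

lemma IsNullFrame.normalProj_eq_zero_iff {C T N : Mink n} (h : IsNullFrame C T N) (x : Mink n) :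
    normalProj C T N x = 0 ↔ x ∈ Submodule.span ℝ {C, T, N} := by
  rw [normalProj_apply]
  constructor
  · intro h0
    have e : x = normalPart C T N x +
        (-form n N x • C + form n T x • T + -form n C x • N) := by rw [normalPart]; module
    rw [h0, zero_add] at e
    exact Submodule.mem_span_triple.2 ⟨_, _, _, e.symm⟩
  · intro hx
    obtain ⟨a, b, d, rfl⟩ := Submodule.mem_span_triple.1 hx
    have h1 : form n N (a • C + b • T + d • N) = -a := by
      simp [h.CN, h.TN, h.NN, form_comm N C, form_comm N T]
    have h2 : form n T (a • C + b • T + d • N) = b := by simp [h.CT, h.TT, h.TN, form_comm T C]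
    have h3 : form n C (a • C + b • T + d • N) = -d := by simp [h.CC, h.CT, h.CN]
    rw [normalPart, h1, h2, h3]
    module

/-- Near the pole, the Darboux equation of a polarized curve is the Darboux equation of a
`CurveFrame`. -/
lemma exists_curveFrame_of_hasPole {b ε : ℝ} (hb : 0 < b) (hε : 0 < ε) {c : ℝ → LightCone n}
    (hc : IsRegularLift c (Ioo (-ε) b)) {Q : ℝ → ℝ} (hpole : HasPole Q 0 b 2) {q₀ : ℝ}
    (hq₀ : Tendsto (fun t => t ^ 2 * Q t) (𝓝[>] 0) (𝓝 q₀)) {lam : ℝ}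
    (hlam : 1 - 2 * lam * q₀ < 0) {p : ℝ} (hp : p ∈ Ioo 0 b) :
    ∃ F : CurveFrame n, osculatingSpace c 0 = Submodule.span ℝ {F.C 0, F.T 0, F.N 0} ∧
      (∀ t ∈ Icc 0 F.d, ∃ a : ℝ, a ≠ 0 ∧ (c t).1 = a • F.C t) ∧
      ∀ x, F.IsSol fun t =>
        ((primitive (fun r => lam • assocForm c Q r) (Ioo 0 b) p t)⁻¹).1 x := by
  obtain ⟨ε', hε', h, hh, -, hhQ⟩ := hpole
  obtain ⟨l, hl, hunit⟩ := hc.exists_unit_lift isOpen_Ioo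
  have hγ' := hc.1.deriv_of_isOpen isOpen_Ioo (m := ∞) (by simp)
  have hIb : Ioo 0 b ⊆ Ioo (-ε) b := Ioo_subset_Ioo_left (by linarith)
  have hIh : Ioo 0 b ⊆ Ioo (0 - ε') b := Ioo_subset_Ioo_left (by linarith)
  have h0h : (0 : ℝ) ∈ Ioo (0 - ε') b := ⟨by linarith, hb⟩
  have hmemb : ∀ᶠ t in 𝓝[>] (0 : ℝ), t ∈ Ioo 0 b := Ioo_mem_nhdsGT hb
  have hQ : ∀ t ∈ Ioo 0 b, Q t = h t / t ^ 2 := fun t ht => by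
    rw [hhQ t ht, zero_sub, neg_sq, mul_div_cancel_right₀ _ (pow_ne_zero 2 ht.1.ne')]
  have hh0 : h 0 = q₀ := by
    have h1 : Tendsto h (𝓝[>] 0) (𝓝 (h 0)) :=
      (hh.continuousOn.continuousAt (isOpen_Ioo.mem_nhds h0h)).tendsto.mono_left nhdsWithin_le_nhds
    refine tendsto_nhds_unique h1 (hq₀.congr' ?_)
    filter_upwards [hmemb] with t ht
    rw [hhQ t ht]; ring
  set a := max (-ε) (0 - ε') with ha
  have ha0 : a < 0 := max_lt (by linarith) (by linarith)
  have hI1 : Ioo a b ⊆ Ioo (-ε) b := Ioo_subset_Ioo_left (le_max_left _ _)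
  have hI2 : Ioo a b ⊆ Ioo (0 - ε') b := Ioo_subset_Ioo_left (le_max_right _ _)
  -- The coefficient μ = λh is the smooth extension of λt²Q, with value λq₀ at 0, so the condition 1
  -- < 2μ₀ is the hypothesis on λ.
  obtain ⟨F, hFd, hFC, hFT, hFμ, q, hFN⟩ := exists_curveFrame (C := fun r => l r • (c r).1)
    (μ := fun t => lam * h t) ha0 hb ((hl.smul hc.1).mono hI1) (contDiffOn_const.mul (hh.mono hI2))
    (by rw [hh0]; linarith) (fun t _ => by simp [(c t).2.2]) (fun t ht => (hunit t (hI1 ht)).2.2.1)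
  have h00 : (0 : ℝ) ∈ Ioo (-ε) b := ⟨by linarith, hb⟩
  refine ⟨F, ?_, fun t ht => ?_, fun x t ht => ?_⟩
  · rw [hFN, hFC, hFT, span_add_smul]
    exact (hunit 0 h00).2.2.2.2.symm
  · have ht' : t ∈ Ioo (-ε) b := ⟨by linarith [ht.1], ht.2.trans_lt hFd⟩
    have hlt := (hunit t ht').1
    refine ⟨(l t)⁻¹, inv_ne_zero hlt, ?_⟩
    rw [hFC, smul_smul, inv_mul_cancel₀ hlt, one_smul]
  · have ht' : t ∈ Ioo 0 b := ⟨ht.1, ht.2.trans_lt hFd⟩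
    have hskew : ∀ t ∈ Ioo 0 b, ∀ x y, form n ((lam • assocForm c Q t) x) y =
        -form n x ((lam • assocForm c Q t) y) := fun t _ x y => by
      simp [assocForm, form_wedge]
    have hcont : ContinuousOn (fun r => lam • assocForm c Q r) (Ioo 0 b) := by
      have hQc : ContinuousOn Q (Ioo 0 b) := ((hh.continuousOn.mono hIh).div
        (continuousOn_id.pow 2) fun t ht => pow_ne_zero 2 ht.1.ne').congr hQ
      have hγc := hγ'.continuousOn.mono hIb
      exact ((hQc.div (hγc.form hγc) fun t ht => (hunit t (hIb ht)).2.1.ne').smul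
        (continuousOn_wedge (hc.1.continuousOn.mono hIb) hγc)).const_smul lam
    have hprim := isPrimitive_primitive hcont hp hskew
    refine (hprim.hasDerivAt_inv_apply ht' (hskew t ht') x).congr_deriv ?_
    have e : lam • assocForm c Q t = (F.μ t / t ^ 2) • wedge (F.C t) (F.T t) := by
      rw [hFC, hFT, hFμ, (hunit t (hIb ht')).2.2.2.1, assocForm, hQ t ht', smul_smul, smul_smul]
      congr 1
      ring
    rw [e]
    rfl

end Mink

end

/-! ### The limit circle and the two kinds of Darboux transforms -/

theorem theorem5p7 (n : ℕ) (b ε : ℝ) (hb : 0 < b) (hε : 0 < ε)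
    (c : ℝ → Mink.LightCone n) (hc : Mink.IsRegularLift c (Set.Ioo (-ε) b))
    (Q : ℝ → ℝ) (hQ : ∀ t ∈ Set.Ioo 0 b, Q t ≠ 0) (hpole : Mink.HasPole Q 0 b 2)
    (q₀ : ℝ) (hq₀ : Filter.Tendsto (fun t => t ^ 2 * Q t) (nhdsWithin 0 (Set.Ioi 0)) (nhds q₀))
    (lam : ℝ) (hlam : 1 - 2 * lam * q₀ < 0) (p : ℝ) (hp : p ∈ Set.Ioo 0 b) :
    Mink.IsCircle (Mink.limitSet (Mink.calapso c Q (Set.Ioo 0 b) lam p)) ∧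
    ∀ x : Mink.Sphere n,
      (x ∉ Mink.limitSet (Mink.calapso c Q (Set.Ioo 0 b) lam p) →
        Filter.Tendsto (Mink.darboux c Q (Set.Ioo 0 b) lam p x) (nhdsWithin 0 (Set.Ioi 0))
          (nhds (Mink.span (c 0)))) ∧
      (x ∈ Mink.limitSet (Mink.calapso c Q (Set.Ioo 0 b) lam p) →
        Filter.Tendsto (Mink.darboux c Q (Set.Ioo 0 b) lam p x) (nhdsWithin 0 (Set.Ioi 0))
          (nhdsSet (Mink.curvatureCircle c 0)) ∧
        Mink.RotatesFast (Mink.darboux c Q (Set.Ioo 0 b) lam p x) (Mink.osculatingSpace c 0)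
          (Mink.span (c 0))) := by
  open Mink in
  obtain ⟨F, hosc, hcF, hsol⟩ := exists_curveFrame_of_hasPole hb hε hc hpole hq₀ hlam hp
  set G := primitive (fun r => lam • assocForm c Q r) (Set.Ioo 0 b) p with hG
  obtain ⟨W, hW3, hWτ, hlim, Λ, hΛ, hΛW⟩ := CurveFrame.exists_limitCircle hsol
    (L := fun t => coneMap (G t) (c t)) (fun t ht => by
      obtain ⟨a, ha, h⟩ := hcF t (Set.Ioc_subset_Icc_self ht)
      exact ⟨a, ha, by
        change (G t).1 (c t).1 = _
        rw [h, map_smul]⟩)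
  have hcal : limitSet (calapso c Q (Set.Ioo 0 b) lam p) = pointsOf W := hlim
  rw [hcal]
  refine ⟨⟨W, hW3, hWτ, rfl⟩, fun x => ?_⟩
  obtain ⟨x₀, rfl⟩ := exists_span_eq x
  obtain ⟨r, hr, hr0⟩ := hcF 0 (Set.left_mem_Icc.2 F.d_pos.le)
  have hdar : darboux c Q (Set.Ioo 0 b) lam p (span x₀) = fun t => span (coneMap (G t)⁻¹ x₀) := rfl
  have hnull : ∀ t ∈ Set.Ioc 0 F.d, form n (((G t)⁻¹).1 x₀.1) (((G t)⁻¹).1 x₀.1) = 0 :=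
    fun t _ => (coneMap (G t)⁻¹ x₀).2.2
  have hF := F.frame 0 (Set.left_mem_Icc.2 F.d_pos.le)
  rw [hdar, mem_pointsOf, hΛW]
  constructor
  · intro hx
    obtain ⟨h1, h2⟩ := CurveFrame.form_limit_normal_self hΛ x₀.1
    obtain ⟨h3, h4⟩ := (hΛ x₀.1).tendsto_C_of_normal_pos hnull (h1.lt_of_ne fun h => hx (h2 h.symm))
    refine tendsto_span (s := fun t => r * -(form n (F.N t) (((G t)⁻¹).1 x₀.1))⁻¹)
      (h4.mono fun t ht => mul_ne_zero hr (neg_ne_zero.2 (inv_ne_zero ht))) ?_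
    rw [hr0]
    refine (h3.const_smul r).congr fun t => ?_
    rw [smul_smul]
    rfl
  · intro hx
    -- Over the limit circle the planar limits have the length of the axial one. If that were 0, all
    -- slow limits would vanish and x₀ would be orthogonal to every vector.
    have hk : (Λ x₀.1).1 ≠ 0 := fun hk => by
      have hsq := (hΛ x₀.1).sq_eq hnull hx
      rw [hk] at hsq
      have h1 : (Λ x₀.1).2.1 = 0 := by nlinarith [sq_nonneg (Λ x₀.1).2.1, sq_nonneg (Λ x₀.1).2.2.1]
      have h2 : (Λ x₀.1).2.2.1 = 0 := by nlinarith [sq_nonneg (Λ x₀.1).2.1, sq_nonneg (Λ x₀.1).2.2.1]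
      refine x₀.2.1 (eq_of_forall_form_eq fun z => ?_)
      rw [CurveFrame.form_limit_eq hΛ x₀.1 z, hk, h1, h2, hx]
      simp
    constructor
    · rw [curvatureCircle, hosc]
      refine tendsto_nhdsSet_pointsOf hF.normalProj_eq_zero_iff ?_
      obtain ⟨B, hB0, hB⟩ := (hΛ x₀.1).exists_tangential_bound (hsol x₀.1) hx hk
      refine squeeze_zero' (Filter.Eventually.of_forall fun t => ratio_nonneg _ _) ?_
        (CurveFrame.tendsto_mul_id le_rfl B)
      filter_upwards [hB] with t ht
      rw [ratio_span, div_le_iff₀ (norm_pos_iff.2 (coneMap (G t)⁻¹ x₀).2.1)]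
      exact ht.2.2.2.2
    · rw [hosc]
      exact (hΛ x₀.1).rotatesFast (hsol x₀.1) hx hk (fun _ => rfl) hr hr0
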